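/- Let $k$ be a field and $(H,\mathcal R)$ a quasitriangular Hopf algebra over $k$: $\mathcal R\in H\otimes H$ is invertible, $(\Delta\otimes\mathrm{id})\mathcal R=\mathcal R_{13}\mathcal R_{23}$, $(\mathrm{id}\otimes\Delta)\mathcal R=\mathcal R_{13}\mathcal R_{12}$ and $\Delta^{\rm cop}h=\mathcal R(\Delta h)\mathcal R^{-1}$. Let $H^*$ be a Hopf algebra with a non-degenerate Hopf pairing $\langle\ ,\ \rangle$ with $H$ ($\langle hg,a\rangle=\langle h,a_1\rangle\langle g,a_2\rangle$, $\langle h,ab\rangle=\langle h_1,a\rangle\langle h_2,b\rangle$, compatible with units, counits and antipodes; $\Delta h=h_1\otimes h_2$ in Sweedler notation). Put $Q=\mathcal R_{21}\mathcal R=Q^{[1]}\otimes Q^{[2]}$ and assume that $(H,\mathcal R)$ is factorisable: the map $Q:H^*\to H$, $Q(a)=\langle a,Q^{[1]}\rangle Q^{[2]}$, is bijective. Write $\mathcal R=\mathcal R^{[1]}\otimes\mathcal R^{[2]}$, $\mathcal R^{-1}=\mathcal R^{-[1]}\otimes\mathcal R^{-[2]}$, $Q^{-1}=Q^{-[1]}\otimes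 Q^{-[2]}$ for the inverses in $H\otimes H$, and $\mathcal R(a\otimes b)=\langle a,\mathcal R^{[1]}\rangle\langle b,\mathcal R^{[2]}\rangle$. A left covariant system $(K,V)$ is a Hopf algebra $K$ with a left $K$-module algebra $V$. An isomorphism of covariant systems is a Hopf algebra isomorphism together with an algebra isomorphism intertwining the actions. A twisting cocycle is an invertible $\chi\in K\otimes K$ with $\chi_{12}(\Delta\otimes\mathrm{id})\chi=\chi_{23}(\mathrm{id}\otimes\Delta)\chi$ and $(\epsilon\otimes\mathrm{id})\chi=1$; the twist of $(K,V)$ by $\chi$ is $(K_\chi,V_\chi)$ with the same algebra $K$, coproduct $\chi(\Delta\,\cdot\,)\chi^{-1}$, the same action, and product $v\cdot_\chi w=\cdot(\chi^{-1}\triangleright(v\otimes w))$ on $V$. Consider the following data. * $D(H)=H\bowtie H^{*\rm op}$: the space $H\otimes H^*$ with product $(h\otimes a)(g\otimes b)=hg_2\otimes b\,a_2\,\langle g_1,a_1\rangle\langle Sg_3,a_3\rangle$ and the tensor product coproduct, acting on the algebra $H$ by $(h\otimes a)\triangleright\phi=\langle\phi_1,a\rangle\,h_1\phi_2Sh_2$.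 * $(D(H),\underline{H^*})$: the algebra $\underline{H^*}$ is the space $H^*$ with product $a\,\underline\cdot\,b=a_2b_2\,\mathcal R((Sa_1)a_3\otimes Sb_1)$, and $D(H)$ acts by $(h\otimes a)\triangleright b=b_3\langle h,(Sb_2)b_4\rangle\,\mathcal R(a_1\otimes b_1)\,\mathcal R(b_5\otimes a_2)$. * The bicrossproduct $B=H^{\rm cop}\blacktriangleright\!\!\!\triangleleft H$: the space $H\otimes H$ with $(\phi\otimes h)(\psi\otimes g)=\phi\,h_1\psi\,Sh_2\otimes h_3g$ and $\Delta(\phi\otimes h)=(\phi_2\otimes h_2)\otimes(\phi_1h_1Sh_3\otimes h_4)$, acting on the algebra $H^*$ by $(\phi\otimes h)\triangleright a=\langle Sh_1\,S\phi,a_1\rangle a_2\langle h_2,a_3\rangle$. * $\theta_1:H^{\rm cop}\otimes H\to B$, $\theta_1(\phi\otimes h)=\phi Sh_1\otimes h_2$; $\theta_2:D(H)\to H\otimes H$, $\theta_2(h\otimes a)=h_1\mathcal R^{-[2]}\otimes h_2\mathcal R^{[1]}\langle a,\mathcal R^{-[1]}\mathcal R^{[2]}\rangle$; $\chi=\mathcal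 R_{23}^{-1}\mathcal R_{13}^{-1}\in(H^{\rm cop}\otimes H)^{\otimes2}$, legs numbered in $H^{\otimes4}$. Then: 1. $(D(H),H)$, $(B,H^*)$ and $(D(H),\underline{H^*})$ are left covariant systems, and $(B,H^*)$ is the semidual of $(D(H),H)$. That is: with $a\triangleright h=h_2\langle h_1,a_1\rangle\langle Sh_3,a_2\rangle$ and $a\triangleleft h=a_2\langle h_1,a_1\rangle\langle Sh_2,a_3\rangle$ one has $(1\otimes a)(h\otimes1)=a_1\triangleright h_1\otimes a_2\triangleleft h_2$ in $D(H)$; the adjoint action $h\triangleright\phi=h_1\phi Sh_2$ and the coaction $h\mapsto h_2\otimes h_1Sh_3$ that enter the product and the coproduct of $B$ are dual to them, $\langle h\triangleright\phi,a\rangle=\langle\phi,a\triangleleft h\rangle$ and $h_2\langle h_1Sh_3,a\rangle=a\triangleright h$; and $B$ has an invertible antipode $S$ for which $x\triangleright a=a\triangleleft S^{-1}x$, where $a\triangleleft(\phi\otimes h)=\langle\phi,a_1\rangle\,a_2\triangleleft h$ is the canonical right action of $B$. 2. $(\mathrm{id},Q)$ is an isomorphism of covariant systems from $(D(H),\underline{H^*})$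 to $(D(H),H)$. 3. $(\theta_1\otimes\theta_1)(\chi)=\mathcal R_{23}^{-1}$, this element of $B\otimes B$ is a twisting cocycle of $B$, and the twist of $(B,H^*)$ by it is a left covariant system. 4. $\theta=\theta_1\theta_2:D(H)\to B$ is bijective and is given by $$\theta(h\otimes a)=h_1Q^{-[2]}Sh_2\otimes h_3\mathcal R^{[1]}\langle a,Q^{-[1]}\mathcal R^{[2]}\rangle ,$$ and $(\theta,\mathrm{id})$ is an isomorphism of covariant systems from $(D(H),\underline{H^*})$ to the twist of $(B,H^*)$ by $\mathcal R_{23}^{-1}$. 5. $(\theta_1\otimes\theta_1)(\mathcal R_{13}^{-1}\mathcal R_{24})$ and $(\theta_1\otimes\theta_1)(\mathcal R_{31}\mathcal R_{24})$ are quasitriangular structures on the Hopf algebra $B$. -/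

import Mathlib

open TensorProduct

noncomputable section

namespace QuantumDouble

/-- The iterated coproduct `h ↦ h₁ ⊗ (h₂ ⊗ h₃)`. -/
def comul₃ (k C : Type*) [Field k] [AddCommGroup C] [Module k C] [Coalgebra k C] :
    C →ₗ[k] C ⊗[k] (C ⊗[k] C) :=
  (Coalgebra.comul (R := k) (A := C)).lTensor C ∘ₗ Coalgebra.comul

section General

/-- `x ↦ x ⊗ 1`. -/
def inl (k K : Type*) [Field k] [Ring K] [Algebra k K] : K →ₗ[k] K ⊗[k] K :=
  (TensorProduct.mk k K K).flip 1

/-- `x ↦ 1 ⊗ x`. -/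
def inr (k K : Type*) [Field k] [Ring K] [Algebra k K] : K →ₗ[k] K ⊗[k] K :=
  TensorProduct.mk k K K 1

variable {k K L V W : Type*} [Field k] [Ring K] [Algebra k K] [Ring L] [Algebra k L]
  [AddCommGroup V] [Module k V] [AddCommGroup W] [Module k W]

/-- `t₁₂ = t¹ ⊗ t² ⊗ 1`. -/
def leg₁₂ (t : K ⊗[k] K) : K ⊗[k] (K ⊗[k] K) := (inl k K).lTensor K t

/-- `t₁₃ = t¹ ⊗ 1 ⊗ t²`. -/
def leg₁₃ (t : K ⊗[k] K) : K ⊗[k] (K ⊗[k] K) := (inr k K).lTensor K t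

/-- `t₂₃ = 1 ⊗ t¹ ⊗ t²`. -/
def leg₂₃ (t : K ⊗[k] K) : K ⊗[k] (K ⊗[k] K) := TensorProduct.mk k K (K ⊗[k] K) 1 t

/-- `t₁₃` in `K⊗⁴`, where `K⊗⁴` is bracketed as `(K ⊗ K) ⊗ (K ⊗ K)`. -/
def quad₁₃ (t : K ⊗[k] K) : (K ⊗[k] K) ⊗[k] (K ⊗[k] K) := TensorProduct.map (inl k K) (inl k K) t

/-- `t₂₃` in `K⊗⁴`. -/
def quad₂₃ (t : K ⊗[k] K) : (K ⊗[k] K) ⊗[k] (K ⊗[k] K) := TensorProduct.map (inr k K) (inl k K) t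

/-- `t₂₄` in `K⊗⁴`. -/
def quad₂₄ (t : K ⊗[k] K) : (K ⊗[k] K) ⊗[k] (K ⊗[k] K) := TensorProduct.map (inr k K) (inr k K) t

/-- The flip `t₂₁`. -/
def swap (t : K ⊗[k] K) : K ⊗[k] K := TensorProduct.comm k K K t

/-- `S` is an antipode: `(S x₁) x₂ = ε(x) 1 = x₁ (S x₂)`. -/
structure IsAntipode (Δ : K →ₗ[k] K ⊗[k] K) (ε : K →ₗ[k] k) (S : K →ₗ[k] K) : Prop where
  left : LinearMap.mul' k K ∘ₗ S.rTensor K ∘ₗ Δ = Algebra.linearMap k K ∘ₗ ε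
  right : LinearMap.mul' k K ∘ₗ S.lTensor K ∘ₗ Δ = Algebra.linearMap k K ∘ₗ ε

/-- The coproduct `Δ` and the counit `ε` make the algebra `K` a Hopf algebra. (A predicate on the
structure maps, since one algebra carries several coproducts below: the axioms are those of
`HopfAlgebra`.) -/
structure IsHopfAlgebra (Δ : K →ₗ[k] K ⊗[k] K) (ε : K →ₗ[k] k) : Prop where
  coassoc : (TensorProduct.assoc k K K K).toLinearMap ∘ₗ Δ.rTensor K ∘ₗ Δ = Δ.lTensor K ∘ₗ Δ
  rTensor_counit : ε.rTensor K ∘ₗ Δ = TensorProduct.mk k k K 1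
  lTensor_counit : ε.lTensor K ∘ₗ Δ = (TensorProduct.mk k K k).flip 1
  comul_one : Δ 1 = 1
  comul_mul : ∀ x y : K, Δ (x * y) = Δ x * Δ y
  counit_one : ε 1 = 1
  counit_mul : ∀ x y : K, ε (x * y) = ε x * ε y
  antipode : ∃ S : K →ₗ[k] K, IsAntipode Δ ε S

/-- Quasitriangular structures `R` for the coproduct `Δ`:
`(Δ ⊗ id) R = R₁₃ R₂₃`, `(id ⊗ Δ) R = R₁₃ R₁₂`, `Δᶜᵒᵖ x = R (Δ x) R⁻¹`. -/
structure IsQuasitriangular (Δ : K →ₗ[k] K ⊗[k] K) (R : K ⊗[k] K) : Prop where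
  isUnit : IsUnit R
  comul_left : TensorProduct.assoc k K K K (Δ.rTensor K R) = leg₁₃ R * leg₂₃ R
  comul_right : Δ.lTensor K R = leg₁₃ R * leg₁₂ R
  comul_swap : ∀ x : K, swap (Δ x) = R * Δ x * Ring.inverse R

/-- Invertible twisting 2-cocycles: `χ₁₂ (Δ ⊗ id) χ = χ₂₃ (id ⊗ Δ) χ` and `(ε ⊗ id) χ = 1`. -/
structure IsTwistingCocycle (Δ : K →ₗ[k] K ⊗[k] K) (ε : K →ₗ[k] k) (χ : K ⊗[k] K) : Prop where
  isUnit : IsUnit χ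
  cocycle : leg₁₂ χ * TensorProduct.assoc k K K K (Δ.rTensor K χ) = leg₂₃ χ * Δ.lTensor K χ
  counit : TensorProduct.lid k K (ε.rTensor K χ) = 1

/-- The structure maps of a left covariant system: a coproduct and a counit on the algebra `K`,
a map `K ⊗ V → V`, and a product and a unit on `V`. -/
structure CovariantData (k K V : Type*) [Field k] [Ring K] [Algebra k K] [AddCommGroup V]
    [Module k V] where
  comul : K →ₗ[k] K ⊗[k] K
  counit : K →ₗ[k] k
  act : K →ₗ[k] V →ₗ[k] V
  mul : V ⊗[k] V →ₗ[k] V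
  one : V

namespace CovariantData

/-- The action of `K ⊗ K` on `V ⊗ V`. -/
def act₂ (C : CovariantData k K V) : K ⊗[k] K →ₗ[k] V ⊗[k] V →ₗ[k] V ⊗[k] V :=
  TensorProduct.homTensorHomMap (RingHom.id k) V V V V ∘ₗ TensorProduct.map C.act C.act

/-- A left covariant system: a Hopf algebra `K` and a left `K`-module algebra `V`. -/
structure IsCovariantSystem (C : CovariantData k K V) : Prop where
  hopf : IsHopfAlgebra C.comul C.counit
  mul_assoc : C.mul ∘ₗ C.mul.rTensor V =
    C.mul ∘ₗ C.mul.lTensor V ∘ₗ (TensorProduct.assoc k V V V).toLinearMap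
  one_mul : ∀ v : V, C.mul (C.one ⊗ₜ v) = v
  mul_one : ∀ v : V, C.mul (v ⊗ₜ C.one) = v
  one_act : ∀ v : V, C.act 1 v = v
  mul_act : ∀ (x y : K) (v : V), C.act (x * y) v = C.act x (C.act y v)
  act_mul : ∀ (x : K) (t : V ⊗[k] V), C.act x (C.mul t) = C.mul (C.act₂ (C.comul x) t)
  act_one : ∀ x : K, C.act x C.one = C.counit x • C.one

/-- The twist by `χ`: the coproduct becomes `χ (Δ x) χ⁻¹` and the product on `V` becomes
`v ⊗ w ↦ · (χ⁻¹ ▷ (v ⊗ w))`; nothing else changes. -/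
def twist (C : CovariantData k K V) (χ : K ⊗[k] K) : CovariantData k K V where
  comul := LinearMap.mulLeft k χ ∘ₗ LinearMap.mulRight k (Ring.inverse χ) ∘ₗ C.comul
  counit := C.counit
  act := C.act
  mul := C.mul ∘ₗ C.act₂ (Ring.inverse χ)
  one := C.one

/-- `(θ, f)` is an isomorphism of covariant systems: an isomorphism `θ` of Hopf algebras and an
isomorphism `f` of algebras that intertwine the actions. -/
structure IsIso (C : CovariantData k K V) (D : CovariantData k L W) (θ : K ≃ₐ[k] L)
    (f : V ≃ₗ[k] W) : Prop where
  comul : ∀ x : K, TensorProduct.map θ.toLinearMap θ.toLinearMap (C.comul x) = D.comul (θ x)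
  counit : ∀ x : K, D.counit (θ x) = C.counit x
  mul : ∀ v w : V, f (C.mul (v ⊗ₜ w)) = D.mul (f v ⊗ₜ f w)
  one : f C.one = D.one
  act : ∀ (x : K) (v : V), f (C.act x v) = D.act (θ x) (f v)

end CovariantData

end General

section Bicross

variable (k H : Type*) [Field k] [Ring H] [HopfAlgebra k H]

/-- The left adjoint action `h ▷ φ = h₁ φ (S h₂)`. -/
def adAct : H →ₗ[k] H →ₗ[k] H :=
  LinearMap.mk₂ k
    (fun h φ => LinearMap.mul' k H (TensorProduct.map (LinearMap.mulRight k φ)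
      (HopfAlgebra.antipode k) (Coalgebra.comul h)))
    (by simp) (by simp)
    (by intros h a b; generalize (Coalgebra.comul h : H ⊗[k] H) = t
        induction t with
        | zero => simp
        | add s t hs ht => simp only [map_add, hs, ht]; abel
        | tmul x y => simp [mul_add, add_mul])
    (by intros c h a; generalize (Coalgebra.comul h : H ⊗[k] H) = t
        induction t with
        | zero => simp
        | add s t hs ht => simp only [map_add, hs, ht, smul_add]
        | tmul x y => simp)

/-- The right coaction `h ↦ h₂ ⊗ h₁ (S h₃)`. -/
def coadCoact : H →ₗ[k] H ⊗[k] H :=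
  (LinearMap.mul' k H ∘ₗ (HopfAlgebra.antipode k).lTensor H).lTensor H ∘ₗ
    (TensorProduct.leftComm k H H H).toLinearMap ∘ₗ comul₃ k H

/-- The operator `ψ ⊗ g ↦ (h₁ ▷ ψ) ⊗ h₂ g`. -/
def smashAct : H →ₗ[k] H ⊗[k] H →ₗ[k] H ⊗[k] H :=
  TensorProduct.homTensorHomMap (RingHom.id k) H H H H ∘ₗ
    TensorProduct.map (adAct k H) (LinearMap.mul k H) ∘ₗ Coalgebra.comul

/-- `(φ ⊗ h) (ψ ⊗ g) = φ (h₁ ▷ ψ) ⊗ h₂ g`. -/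
def bicrossMul : H ⊗[k] H →ₗ[k] H ⊗[k] H →ₗ[k] H ⊗[k] H :=
  TensorProduct.lift <| LinearMap.mk₂ k
    (fun φ h => LinearMap.mulLeft k (φ ⊗ₜ[k] (1 : H)) ∘ₗ smashAct k H h)
    (by intros; ext; simp [TensorProduct.add_tmul, add_mul])
    (by intros; ext; simp [← TensorProduct.smul_tmul'])
    (by intros; ext; simp [mul_add]) (by intros; ext; simp)

/-- `Δ (φ ⊗ h) = (φ₂ ⊗ h₂) ⊗ (φ₁ h₁ (S h₃) ⊗ h₄)`: the product in `H⊗⁴` of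
`(φ₂ ⊗ 1) ⊗ (φ₁ ⊗ 1)` and `(1 ⊗ h₁⁰) ⊗ (h₁¹ ⊗ h₂)`, where `h⁰ ⊗ h¹` is the coaction of `h`. -/
def bicrossComul : H ⊗[k] H →ₗ[k] (H ⊗[k] H) ⊗[k] (H ⊗[k] H) :=
  LinearMap.mul' k ((H ⊗[k] H) ⊗[k] (H ⊗[k] H)) ∘ₗ TensorProduct.map
    (TensorProduct.map (inl k H) (inl k H) ∘ₗ (TensorProduct.comm k H H).toLinearMap ∘ₗ
      Coalgebra.comul)
    ((inr k H).rTensor (H ⊗[k] H) ∘ₗ (TensorProduct.assoc k H H H).toLinearMap ∘ₗ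
      (coadCoact k H).rTensor H ∘ₗ Coalgebra.comul)

/-- `φ ⊗ h ↦ φ (S h₁) ⊗ h₂`. -/
def theta₁ : H ⊗[k] H →ₗ[k] H ⊗[k] H :=
  TensorProduct.lift <| LinearMap.mk₂ k
    (fun φ h => (φ ⊗ₜ[k] (1 : H)) * (HopfAlgebra.antipode k).rTensor H (Coalgebra.comul h))
    (by intros; simp [TensorProduct.add_tmul, add_mul])
    (by intros; simp [← TensorProduct.smul_tmul'])
    (by intros; simp [mul_add]) (by intros; simp)

/-- `φ ⊗ h ↦ φ h₁ ⊗ h₂`. -/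
def theta₁Inv : H ⊗[k] H →ₗ[k] H ⊗[k] H :=
  TensorProduct.lift <| LinearMap.mk₂ k
    (fun φ h => (φ ⊗ₜ[k] (1 : H)) * Coalgebra.comul h)
    (by intros; simp [TensorProduct.add_tmul, add_mul])
    (by intros; simp [← TensorProduct.smul_tmul'])
    (by intros; simp [mul_add]) (by intros; simp)

variable {k H}

theorem adAct_apply (h φ : H) : adAct k H h φ =
    LinearMap.mul' k H (TensorProduct.map (LinearMap.mulRight k φ)
      (HopfAlgebra.antipode k) (Coalgebra.comul h)) := rfl

theorem antipode_comul_cancel (y : H) :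
    LinearMap.mul' k (H ⊗[k] H) (TensorProduct.map ((TensorProduct.mk k H H).flip 1 ∘ₗ
      HopfAlgebra.antipode k) Coalgebra.comul (Coalgebra.comul y)) = 1 ⊗ₜ[k] y := by
  let N : H ⊗[k] (H ⊗[k] H) →ₗ[k] H ⊗[k] H :=
    (LinearMap.mul' k H ∘ₗ (HopfAlgebra.antipode k).rTensor H).rTensor H ∘ₗ
      (TensorProduct.assoc k H H H).symm.toLinearMap
  have h1 : ∀ t : H ⊗[k] H, LinearMap.mul' k (H ⊗[k] H) (TensorProduct.map
      ((TensorProduct.mk k H H).flip 1 ∘ₗ HopfAlgebra.antipode k) Coalgebra.comul t) =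
      N (Coalgebra.comul.lTensor H t) := by
    intro t
    induction t with
    | zero => simp
    | add s t hs ht => simp only [map_add, hs, ht]
    | tmul u v =>
      simp only [TensorProduct.map_tmul, LinearMap.lTensor_tmul]
      generalize (Coalgebra.comul v : H ⊗[k] H) = w
      induction w with
      | zero => simp
      | add s t hs ht => simp only [map_add, TensorProduct.tmul_add, hs, ht]
      | tmul a b => simp [N]
  rw [h1, ← Coalgebra.coassoc_apply]
  simp only [N, LinearMap.comp_apply, LinearEquiv.coe_coe, LinearEquiv.symm_apply_apply]
  rw [← LinearMap.rTensor_comp_apply, LinearMap.comp_assoc, HopfAlgebra.mul_antipode_rTensor_comul,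
    LinearMap.rTensor_comp_apply, Coalgebra.rTensor_counit_comul]
  simp

theorem comul_antipode_cancel (y : H) :
    LinearMap.mul' k (H ⊗[k] H) (TensorProduct.map ((TensorProduct.mk k H H).flip 1)
      ((HopfAlgebra.antipode k).rTensor H ∘ₗ Coalgebra.comul) (Coalgebra.comul y)) =
      1 ⊗ₜ[k] y := by
  let N : H ⊗[k] (H ⊗[k] H) →ₗ[k] H ⊗[k] H :=
    (LinearMap.mul' k H ∘ₗ (HopfAlgebra.antipode k).lTensor H).rTensor H ∘ₗ
      (TensorProduct.assoc k H H H).symm.toLinearMap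
  have h1 : ∀ t : H ⊗[k] H, LinearMap.mul' k (H ⊗[k] H) (TensorProduct.map
      ((TensorProduct.mk k H H).flip 1) ((HopfAlgebra.antipode k).rTensor H ∘ₗ Coalgebra.comul) t) =
      N (Coalgebra.comul.lTensor H t) := by
    intro t
    induction t with
    | zero => simp
    | add s t hs ht => simp only [map_add, hs, ht]
    | tmul u v =>
      simp only [TensorProduct.map_tmul, LinearMap.lTensor_tmul, LinearMap.comp_apply]
      generalize (Coalgebra.comul v : H ⊗[k] H) = w
      induction w with
      | zero => simp
      | add s t hs ht => simp only [map_add, TensorProduct.tmul_add, hs, ht]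
      | tmul a b => simp [N]
  rw [h1, ← Coalgebra.coassoc_apply]
  simp only [N, LinearMap.comp_apply, LinearEquiv.coe_coe, LinearEquiv.symm_apply_apply]
  rw [← LinearMap.rTensor_comp_apply, LinearMap.comp_assoc, HopfAlgebra.mul_antipode_lTensor_comul,
    LinearMap.rTensor_comp_apply, Coalgebra.rTensor_counit_comul]
  simp

theorem theta₁_theta₁Inv (x : H ⊗[k] H) : theta₁ k H (theta₁Inv k H x) = x := by
  induction x with
  | zero => simp
  | add s t hs ht => simp only [map_add, hs, ht]
  | tmul φ h =>
    have h1 : ∀ t : H ⊗[k] H, theta₁ k H ((φ ⊗ₜ[k] 1) * t) = (φ ⊗ₜ[k] 1) *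
        LinearMap.mul' k (H ⊗[k] H) (TensorProduct.map ((TensorProduct.mk k H H).flip 1)
          ((HopfAlgebra.antipode k).rTensor H ∘ₗ Coalgebra.comul) t) := by
      intro t
      induction t with
      | zero => simp
      | add s t hs ht => simp only [map_add, mul_add, hs, ht]
      | tmul u v => simp [theta₁, ← mul_assoc]
    simp only [theta₁Inv, TensorProduct.lift.tmul, LinearMap.mk₂_apply]
    rw [h1, comul_antipode_cancel]
    simp

theorem adAct_comul (h ψ : H) :
    LinearMap.mul' k (H ⊗[k] H) (TensorProduct.map ((TensorProduct.mk k H H).flip 1 ∘ₗ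
      (adAct k H).flip ψ) Coalgebra.comul (Coalgebra.comul h)) =
      Coalgebra.comul h * (ψ ⊗ₜ[k] 1) := by
  let N : H ⊗[k] (H ⊗[k] H) →ₗ[k] H ⊗[k] H :=
    LinearMap.mul' k (H ⊗[k] H) ∘ₗ TensorProduct.map
      ((TensorProduct.mk k H H).flip 1 ∘ₗ LinearMap.mulRight k ψ)
      (LinearMap.mul' k (H ⊗[k] H) ∘ₗ (TensorProduct.map ((TensorProduct.mk k H H).flip 1 ∘ₗ
      HopfAlgebra.antipode k) Coalgebra.comul))
  have h1 : ∀ t : H ⊗[k] H, LinearMap.mul' k (H ⊗[k] H) (TensorProduct.map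
      ((TensorProduct.mk k H H).flip 1 ∘ₗ (adAct k H).flip ψ) Coalgebra.comul t) =
      N (TensorProduct.assoc k H H H (Coalgebra.comul.rTensor H t)) := by
    intro t
    induction t with
    | zero => simp
    | add s t hs ht => simp only [map_add, hs, ht]
    | tmul u v =>
      simp only [TensorProduct.map_tmul, LinearMap.rTensor_tmul, LinearMap.comp_apply,
        LinearMap.flip_apply, adAct_apply]
      generalize (Coalgebra.comul u : H ⊗[k] H) = w
      induction w with
      | zero => simp
      | add s t hs ht =>
        simp only [map_add, TensorProduct.add_tmul, LinearMap.add_apply, ← hs, ← ht,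
          LinearMap.mul'_apply, TensorProduct.mk_apply]
      | tmul a b => simp [N, ← mul_assoc]
  have h2 : ∀ t : H ⊗[k] H, N (Coalgebra.comul.lTensor H t) = t * (ψ ⊗ₜ[k] 1) := by
    intro t
    induction t with
    | zero => simp
    | add s t hs ht => simp only [map_add, add_mul, hs, ht]
    | tmul u v =>
      simp [N, antipode_comul_cancel]
  rw [h1, Coalgebra.coassoc_apply, h2]

theorem theta₁Inv_smashAct (h : H) (t : H ⊗[k] H) :
    theta₁Inv k H (smashAct k H h t) = Coalgebra.comul h * theta₁Inv k H t := by
  induction t with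
  | zero => simp
  | add s t hs ht => simp only [map_add, mul_add, hs, ht]
  | tmul ψ g =>
    simp only [theta₁Inv, TensorProduct.lift.tmul, LinearMap.mk₂_apply]
    rw [← mul_assoc, ← adAct_comul, smashAct, LinearMap.comp_apply, LinearMap.comp_apply]
    generalize (Coalgebra.comul h : H ⊗[k] H) = w
    induction w with
    | zero => simp
    | add s t hs ht => simp only [map_add, add_mul, LinearMap.add_apply, hs, ht]
    | tmul a b => simp [mul_assoc]

theorem theta₁Inv_mul (x y : H ⊗[k] H) :
    theta₁Inv k H (bicrossMul k H x y) = theta₁Inv k H x * theta₁Inv k H y := by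
  induction x with
  | zero => simp
  | add s t hs ht => simp only [map_add, LinearMap.add_apply, add_mul, hs, ht]
  | tmul φ h =>
    have h1 : ∀ t : H ⊗[k] H, theta₁Inv k H ((φ ⊗ₜ[k] 1) * t) =
        (φ ⊗ₜ[k] 1) * theta₁Inv k H t := by
      intro t
      induction t with
      | zero => simp
      | add s t hs ht => simp only [map_add, mul_add, hs, ht]
      | tmul u v => simp [theta₁Inv, ← mul_assoc]
    simp only [bicrossMul, TensorProduct.lift.tmul, LinearMap.mk₂_apply, LinearMap.comp_apply,
      LinearMap.mulLeft_apply, h1, theta₁Inv_smashAct]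
    simp [theta₁Inv, mul_assoc]

theorem theta₁Inv_injective : Function.Injective (theta₁Inv k H) :=
  Function.LeftInverse.injective theta₁_theta₁Inv

theorem theta₁Inv_one : theta₁Inv k H (1 ⊗ₜ 1) = 1 := by
  simp [theta₁Inv, Algebra.TensorProduct.one_def]

theorem bicrossMul_assoc (x y z : H ⊗[k] H) :
    bicrossMul k H (bicrossMul k H x y) z = bicrossMul k H x (bicrossMul k H y z) :=
  theta₁Inv_injective (by simp only [theta₁Inv_mul, mul_assoc])

theorem bicrossMul_one (x : H ⊗[k] H) : bicrossMul k H x (1 ⊗ₜ 1) = x :=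
  theta₁Inv_injective (by simp only [theta₁Inv_mul, theta₁Inv_one, mul_one])

theorem one_bicrossMul (x : H ⊗[k] H) : bicrossMul k H (1 ⊗ₜ 1) x = x :=
  theta₁Inv_injective (by simp only [theta₁Inv_mul, theta₁Inv_one, one_mul])

end Bicross
section Pairing

/-- A dual pairing of Hopf algebras, `form a h = ⟨h, a⟩` for `a ∈ A`, `h ∈ H`:
`⟨h g, a⟩ = ⟨h, a₁⟩ ⟨g, a₂⟩`, `⟨h, a b⟩ = ⟨h₁, a⟩ ⟨h₂, b⟩`, `⟨1, a⟩ = ε a`, `⟨h, 1⟩ = ε h`,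
`⟨S h, a⟩ = ⟨h, S a⟩`. -/
structure HopfPairing (k H A : Type*) [Field k] [Ring H] [HopfAlgebra k H] [Ring A]
    [HopfAlgebra k A] where
  form : A →ₗ[k] H →ₗ[k] k
  mul_right : ∀ (a : A) (h g : H), form a (h * g) =
    TensorProduct.lid k k (TensorProduct.map (form.flip h) (form.flip g) (Coalgebra.comul a))
  mul_left : ∀ (a b : A) (h : H), form (a * b) h =
    TensorProduct.lid k k (TensorProduct.map (form a) (form b) (Coalgebra.comul h))
  one_right : ∀ a : A, form a 1 = Coalgebra.counit a
  one_left : ∀ h : H, form 1 h = Coalgebra.counit h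
  antipode_right : ∀ (a : A) (h : H),
    form a (HopfAlgebra.antipode k h) = form (HopfAlgebra.antipode k a) h

variable {k H A : Type*} [Field k] [Ring H] [HopfAlgebra k H] [Ring A] [HopfAlgebra k A]

variable (P : HopfPairing k H A)

/-- `x, a ↦ ⟨x, a₁⟩ a₂`. -/
def leftEval : H →ₗ[k] A →ₗ[k] A :=
  LinearMap.mk₂ k
    (fun x a => TensorProduct.lid k A ((P.form.flip x).rTensor A (Coalgebra.comul a)))
    (by simp [LinearMap.rTensor_add]) (by simp [LinearMap.rTensor_smul]) (by simp) (by simp)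

/-- `y, a ↦ a₁ ⟨y, a₂⟩`. -/
def rightEval : H →ₗ[k] A →ₗ[k] A :=
  LinearMap.mk₂ k
    (fun y a => TensorProduct.rid k A ((P.form.flip y).lTensor A (Coalgebra.comul a)))
    (by simp [LinearMap.lTensor_add]) (by simp [LinearMap.lTensor_smul]) (by simp) (by simp)

/-- `x ⊗ y, a ↦ ⟨x, a₁⟩ a₂ ⟨y, a₃⟩`. -/
def biEval : H ⊗[k] H →ₗ[k] A →ₗ[k] A :=
  TensorProduct.lift (LinearMap.mk₂ k (fun x y => leftEval P x ∘ₗ rightEval P y)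
    (by intros; ext; simp) (by intros; ext; simp) (by intros; ext; simp) (by intros; ext; simp))

/-- `a, h ↦ h₂ ⊗ ⟨h₁, a₁⟩ a₂ ⟨S h₃, a₃⟩`. -/
def crossMap : A →ₗ[k] H →ₗ[k] H ⊗[k] A :=
  LinearMap.mk₂ k
    (fun a h => (((biEval P).flip a) ∘ₗ (HopfAlgebra.antipode k).lTensor H).lTensor H
      (TensorProduct.leftComm k H H H (comul₃ k H h)))
    (by intros; simp [LinearMap.lTensor_add, LinearMap.add_comp])
    (by intros; simp [LinearMap.lTensor_smul, LinearMap.smul_comp])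
    (by intros; simp) (by intros; simp)

/-- `(h ⊗ a) (g ⊗ b) = h g₂ ⊗ b a₂ ⟨g₁, a₁⟩ ⟨S g₃, a₃⟩`, the right-hand side being computed from
the ordinary product of `H ⊗ A`. -/
def doubleMul : H ⊗[k] A →ₗ[k] H ⊗[k] A →ₗ[k] H ⊗[k] A :=
  TensorProduct.lift <| LinearMap.mk₂ k
    (fun h a => TensorProduct.lift <| LinearMap.mk₂ k (fun g b => (h ⊗ₜ[k] b) * crossMap P a g)
      (by intros; simp [mul_add]) (by intros; simp)
      (by intros; simp [TensorProduct.tmul_add, add_mul]) (by intros; simp [TensorProduct.tmul_smul]))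
    (by intros; ext; simp [TensorProduct.add_tmul, add_mul])
    (by intros; ext; simp [← TensorProduct.smul_tmul'])
    (by intros; ext; simp [mul_add])
    (by intros; ext; simp)


theorem comul₃_one : comul₃ k H 1 = 1 := by
  simp [comul₃, Algebra.TensorProduct.one_def]

theorem comul₃_mul (g h : H) : comul₃ k H (g * h) = comul₃ k H g * comul₃ k H h := by
  have := map_mul ((Algebra.TensorProduct.map (AlgHom.id k H) (Bialgebra.comulAlgHom k H)).comp
    (Bialgebra.comulAlgHom k H)) g h
  exact this


theorem leftEval_apply (x : H) (a : A) : leftEval P x a =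
    TensorProduct.lid k A ((P.form.flip x).rTensor A (Coalgebra.comul a)) := rfl

theorem rightEval_apply (x : H) (a : A) : rightEval P x a =
    TensorProduct.rid k A ((P.form.flip x).lTensor A (Coalgebra.comul a)) := rfl

theorem biEval_tmul (x y : H) (a : A) :
    biEval P (x ⊗ₜ[k] y) a = leftEval P x (rightEval P y a) := rfl

theorem crossMap_apply (a : A) (h : H) : crossMap P a h =
    (((biEval P).flip a) ∘ₗ (HopfAlgebra.antipode k).lTensor H).lTensor H
      (TensorProduct.leftComm k H H H (comul₃ k H h)) := rfl

theorem doubleMul_tmul (h g : H) (a b : A) :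
    doubleMul P (h ⊗ₜ[k] a) (g ⊗ₜ[k] b) = (h ⊗ₜ[k] b) * crossMap P a g := rfl

theorem leftEval_mul (x y : H) (a : A) :
    leftEval P (x * y) a = leftEval P y (leftEval P x a) := by
  let F : A ⊗[k] (A ⊗[k] A) →ₗ[k] A :=
    (TensorProduct.lid k A).toLinearMap ∘ₗ TensorProduct.map (P.form.flip x)
      ((TensorProduct.lid k A).toLinearMap ∘ₗ (P.form.flip y).rTensor A)
  have h1 : ∀ t : A ⊗[k] A, leftEval P y (TensorProduct.lid k A ((P.form.flip x).rTensor A t)) =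
      F (Coalgebra.comul.lTensor A t) := by
    intro t
    induction t with
    | zero => simp
    | add s t hs ht => simp only [map_add, hs, ht]
    | tmul u v => simp [F, leftEval_apply]
  have h2 : ∀ t : A ⊗[k] A, TensorProduct.lid k A ((P.form.flip (x * y)).rTensor A t) =
      F (TensorProduct.assoc k A A A (Coalgebra.comul.rTensor A t)) := by
    intro t
    induction t with
    | zero => simp
    | add s t hs ht => simp only [map_add, hs, ht]
    | tmul u v =>
      simp only [LinearMap.rTensor_tmul, LinearMap.flip_apply, P.mul_right, TensorProduct.lid_tmul]
      generalize (Coalgebra.comul u : A ⊗[k] A) = w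
      induction w with
      | zero => simp
      | add s t hs ht => simp only [map_add, TensorProduct.add_tmul, add_smul, hs, ht]
      | tmul u v => simp [F, smul_smul, mul_comm]
  rw [leftEval_apply P x, h1, leftEval_apply, h2, Coalgebra.coassoc_apply]

theorem rightEval_mul (x y : H) (a : A) :
    rightEval P (x * y) a = rightEval P x (rightEval P y a) := by
  let F : A ⊗[k] (A ⊗[k] A) →ₗ[k] A :=
    (TensorProduct.rid k A).toLinearMap ∘ₗ ((TensorProduct.lid k k).toLinearMap ∘ₗ
      TensorProduct.map (P.form.flip x) (P.form.flip y)).lTensor A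
  have h1 : ∀ t : A ⊗[k] A, rightEval P x (TensorProduct.rid k A ((P.form.flip y).lTensor A t)) =
      F (TensorProduct.assoc k A A A (Coalgebra.comul.rTensor A t)) := by
    intro t
    induction t with
    | zero => simp
    | add s t hs ht => simp only [map_add, hs, ht]
    | tmul u v =>
      simp only [LinearMap.lTensor_tmul, TensorProduct.rid_tmul, map_smul, rightEval_apply,
        LinearMap.rTensor_tmul]
      generalize (Coalgebra.comul u : A ⊗[k] A) = w
      induction w with
      | zero => simp
      | add s t hs ht => simp only [map_add, TensorProduct.add_tmul, smul_add, hs, ht]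
      | tmul u v => simp [F, smul_smul, mul_comm]
  have h2 : ∀ t : A ⊗[k] A, TensorProduct.rid k A ((P.form.flip (x * y)).lTensor A t) =
      F (Coalgebra.comul.lTensor A t) := by
    intro t
    induction t with
    | zero => simp
    | add s t hs ht => simp only [map_add, hs, ht]
    | tmul u v =>
      simp only [LinearMap.lTensor_tmul, LinearMap.flip_apply, P.mul_right, TensorProduct.rid_tmul]
      generalize (Coalgebra.comul v : A ⊗[k] A) = w
      induction w with
      | zero => simp
      | add s t hs ht => simp only [map_add, TensorProduct.tmul_add, add_smul, hs, ht]
      | tmul u v => simp [F]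
  rw [rightEval_apply P y, h1, rightEval_apply, h2, Coalgebra.coassoc_apply]

/-- Contraction of the outer legs: `u ⊗ (v ⊗ w) ↦ f u • g w • v`. -/
theorem biEval_apply (x y : H) (a : A) : leftEval P x (rightEval P y a) =
    TensorProduct.lid k A (TensorProduct.map (P.form.flip x)
      ((TensorProduct.rid k A).toLinearMap ∘ₗ (P.form.flip y).lTensor A) (comul₃ k A a)) := by
  have h1 : ∀ t : A ⊗[k] A, leftEval P x (TensorProduct.rid k A ((P.form.flip y).lTensor A t)) =
      TensorProduct.lid k A (TensorProduct.map (P.form.flip x)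
      ((TensorProduct.rid k A).toLinearMap ∘ₗ (P.form.flip y).lTensor A)
        (TensorProduct.assoc k A A A (Coalgebra.comul.rTensor A t))) := by
    intro t
    induction t with
    | zero => simp
    | add s t hs ht => simp only [map_add, hs, ht]
    | tmul u v =>
      simp only [LinearMap.lTensor_tmul, TensorProduct.rid_tmul, map_smul, leftEval_apply,
        LinearMap.rTensor_tmul]
      generalize (Coalgebra.comul u : A ⊗[k] A) = w
      induction w with
      | zero => simp
      | add s t hs ht => simp only [map_add, TensorProduct.add_tmul, smul_add, hs, ht]
      | tmul u v => simp
  rw [rightEval_apply, h1, Coalgebra.coassoc_apply, comul₃, LinearMap.comp_apply]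

theorem leftEval_rightEval (x y : H) (a : A) :
    leftEval P x (rightEval P y a) = rightEval P y (leftEval P x a) := by
  have h1 : ∀ t : A ⊗[k] A, rightEval P y (TensorProduct.lid k A ((P.form.flip x).rTensor A t)) =
      TensorProduct.lid k A (TensorProduct.map (P.form.flip x)
      ((TensorProduct.rid k A).toLinearMap ∘ₗ (P.form.flip y).lTensor A)
        (Coalgebra.comul.lTensor A t)) := by
    intro t
    induction t with
    | zero => simp
    | add s t hs ht => simp only [map_add, hs, ht]
    | tmul u v => simp [rightEval_apply]
  rw [biEval_apply, leftEval_apply, h1, comul₃, LinearMap.comp_apply]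

/-- The same pairing with the two Hopf algebras exchanged. -/
def HopfPairing.flip : HopfPairing k A H where
  form := P.form.flip
  mul_right h a b := P.mul_left a b h
  mul_left h g a := P.mul_right a h g
  one_right := P.one_left
  one_left := P.one_right
  antipode_right h a := (P.antipode_right a h).symm

/-- Contraction of the outer legs of both arguments of `crossMap`. -/
def crossContract (t : A ⊗[k] (A ⊗[k] A)) : H ⊗[k] (H ⊗[k] H) →ₗ[k] H ⊗[k] A :=
  (TensorProduct.lift (LinearMap.mk₂ k (fun x z => TensorProduct.lid k A
      (TensorProduct.map (P.form.flip x) ((TensorProduct.rid k A).toLinearMap ∘ₗ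
        (P.form.flip (HopfAlgebra.antipode k z)).lTensor A) t))
    (by intros; simp [TensorProduct.map_add_left])
    (by intros; simp [TensorProduct.map_smul_left])
    (by intros; simp [LinearMap.lTensor_add, LinearMap.comp_add, TensorProduct.map_add_right])
    (by intros; simp [LinearMap.lTensor_smul, LinearMap.comp_smul, TensorProduct.map_smul_right]))).lTensor H ∘ₗ
  (TensorProduct.leftComm k H H H).toLinearMap

theorem crossContract_add (s t : A ⊗[k] (A ⊗[k] A)) :
    crossContract P (s + t) = crossContract P s + crossContract P t := by
  ext; simp [crossContract, TensorProduct.tmul_add]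

@[simp] theorem crossContract_zero : crossContract P 0 = 0 := by
  ext; simp [crossContract]

theorem crossContract_comul (a : A) (h : H) :
    crossContract P (comul₃ k A a) (comul₃ k H h) = crossMap P a h := by
  rw [crossMap_apply, crossContract, LinearMap.comp_apply]
  congr 2
  ext x z
  simp [biEval_tmul, biEval_apply]

theorem crossMap_flip (a : A) (h : H) :
    TensorProduct.comm k A H (crossMap P.flip h a) = crossMap P a h := by
  have h1 := crossContract_comul P a h
  have h2 := crossContract_comul P.flip h a
  rw [← h1, ← h2]
  generalize comul₃ k H h = s
  generalize comul₃ k A a = t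
  induction s with
  | zero => simp
  | add s s' hs hs' => simp only [map_add, LinearMap.add_apply, crossContract_add, hs, hs']
  | tmul x s =>
    induction s with
    | zero => simp
    | add s s' hs hs' =>
      simp only [map_add, LinearMap.add_apply, crossContract_add, TensorProduct.tmul_add, hs, hs']
    | tmul y z =>
      induction t with
      | zero => simp
      | add s t hs ht => simp only [map_add, LinearMap.add_apply, crossContract_add, hs, ht]
      | tmul x' t =>
        induction t with
        | zero => simp
        | add s t hs ht => simp only [map_add, LinearMap.add_apply, crossContract_add, TensorProduct.tmul_add, hs, ht]
        | tmul y' z' =>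
          simp [crossContract, HopfPairing.flip, P.antipode_right, TensorProduct.smul_tmul',
            TensorProduct.tmul_smul, mul_comm]

/-- `x ⊗ a ↦ (x ⊗ 1) * crossMap a h`. -/
def pushCross (h : H) : H ⊗[k] A →ₗ[k] H ⊗[k] A :=
  TensorProduct.lift (LinearMap.mk₂ k (fun x a => (x ⊗ₜ[k] 1) * crossMap P a h)
    (by simp [TensorProduct.add_tmul, add_mul]) (by simp [← TensorProduct.smul_tmul'])
    (by simp [mul_add]) (by simp))

theorem crossMap_mul (a : A) (g h : H) :
    crossMap P a (g * h) = pushCross P h (crossMap P a g) := by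
  rw [crossMap_apply, comul₃_mul, crossMap_apply P a g]
  have key : ∀ s : H ⊗[k] (H ⊗[k] H),
      (((biEval P).flip a) ∘ₗ (HopfAlgebra.antipode k).lTensor H).lTensor H
        (TensorProduct.leftComm k H H H (s * comul₃ k H h)) =
      pushCross P h ((((biEval P).flip a) ∘ₗ (HopfAlgebra.antipode k).lTensor H).lTensor H
        (TensorProduct.leftComm k H H H s)) := by
    intro s
    induction s with
    | zero => simp
    | add s t hs ht => simp only [map_add, add_mul, hs, ht]
    | tmul x s =>
      induction s with
      | zero => simp
      | add s t hs ht => simp only [map_add, add_mul, TensorProduct.tmul_add, hs, ht]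
      | tmul y z =>
        simp only [TensorProduct.leftComm_tmul, LinearMap.lTensor_tmul, pushCross,
          LinearMap.comp_apply, LinearMap.flip_apply, TensorProduct.lift.tmul, LinearMap.mk₂_apply, crossMap_apply]
        generalize comul₃ k H h = t
        induction t with
        | zero => simp
        | add s t hs ht => simp only [map_add, mul_add, hs, ht]
        | tmul x' t =>
          induction t with
          | zero => simp
          | add s t hs ht => simp only [map_add, mul_add, TensorProduct.tmul_add, hs, ht]
          | tmul y' z' =>
            simp [biEval_tmul, leftEval_mul, rightEval_mul, HopfAlgebra.antipode_mul_antidistrib,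
              leftEval_rightEval]
  exact key _

/-- `g ⊗ b ↦ (1 ⊗ b) * crossMap a g`. -/
def pullCross (a : A) : H ⊗[k] A →ₗ[k] H ⊗[k] A :=
  TensorProduct.lift (LinearMap.mk₂ k (fun g b => (1 ⊗ₜ[k] b) * crossMap P a g)
    (by simp [mul_add]) (by simp)
    (by simp [TensorProduct.tmul_add, add_mul]) (by simp))

theorem crossMap_mul_left (a b : A) (g : H) :
    crossMap P (b * a) g = pullCross P a (crossMap P b g) := by
  rw [← crossMap_flip, crossMap_mul, ← crossMap_flip P b g]
  generalize crossMap P.flip g b = t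
  induction t with
  | zero => simp
  | add s t hs ht => simp only [map_add, hs, ht]
  | tmul b' g' =>
    simp only [pushCross, pullCross, TensorProduct.lift.tmul, LinearMap.mk₂_apply,
      TensorProduct.comm_tmul, ← crossMap_flip P a g']
    generalize crossMap P.flip g' a = t
    induction t with
    | zero => simp
    | add s t hs ht => simp only [map_add, mul_add, hs, ht]
    | tmul b' g' => simp

theorem tmul_mul_pullCross (g : H) (a : A) (t : H ⊗[k] A) :
    (g ⊗ₜ[k] 1) * pullCross P a t = doubleMul P (g ⊗ₜ[k] a) t := by
  induction t with
  | zero => simp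
  | add s t hs ht => simp only [map_add, mul_add, hs, ht]
  | tmul f b => simp [pullCross, doubleMul_tmul, ← mul_assoc]

theorem doubleMul_mul_left (h : H) (b c : A) (f : H) (s : H ⊗[k] A) :
    doubleMul P ((h ⊗ₜ[k] b) * s) (f ⊗ₜ[k] c) =
      (h ⊗ₜ[k] c) * doubleMul P s (crossMap P b f) := by
  induction s with
  | zero => simp
  | add s t hs ht => simp only [map_add, mul_add, LinearMap.add_apply, hs, ht]
  | tmul g a =>
    rw [Algebra.TensorProduct.tmul_mul_tmul, doubleMul_tmul, crossMap_mul_left,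
      ← tmul_mul_pullCross, ← mul_assoc, Algebra.TensorProduct.tmul_mul_tmul, mul_one]

theorem doubleMul_mul_right (h g : H) (a c : A) (t : H ⊗[k] A) :
    doubleMul P (h ⊗ₜ[k] a) ((g ⊗ₜ[k] c) * t) =
      (h ⊗ₜ[k] c) * doubleMul P (crossMap P a g) t := by
  induction t with
  | zero => simp
  | add s t hs ht => simp only [map_add, mul_add, hs, ht]
  | tmul f b =>
    rw [Algebra.TensorProduct.tmul_mul_tmul, doubleMul_tmul, crossMap_mul]
    generalize crossMap P a g = s
    induction s with
    | zero => simp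
    | add s t hs ht => simp only [map_add, mul_add, LinearMap.add_apply, hs, ht]
    | tmul x u => simp [pushCross, doubleMul_tmul, ← mul_assoc]

theorem doubleMul_assoc (x y z : H ⊗[k] A) :
    doubleMul P (doubleMul P x y) z = doubleMul P x (doubleMul P y z) := by
  induction x with
  | zero => simp
  | add s t hs ht => simp only [map_add, LinearMap.add_apply, hs, ht]
  | tmul h a =>
  induction y with
  | zero => simp
  | add s t hs ht => simp only [map_add, LinearMap.add_apply, hs, ht]
  | tmul g b =>
  induction z with
  | zero => simp
  | add s t hs ht => simp only [map_add, hs, ht]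
  | tmul f c =>
    rw [doubleMul_tmul, doubleMul_tmul P g, doubleMul_mul_left, doubleMul_mul_right]

theorem crossMap_one_right (a : A) : crossMap P a 1 = 1 ⊗ₜ a := by
  have h1 : ∀ b : A, leftEval P 1 b = b := fun b => by
    have : P.form.flip 1 = Coalgebra.counit := LinearMap.ext P.one_right
    simp [leftEval_apply, this]
  have h2 : ∀ b : A, rightEval P 1 b = b := fun b => by
    have : P.form.flip 1 = Coalgebra.counit := LinearMap.ext P.one_right
    simp [rightEval_apply, this]
  simp [crossMap_apply, comul₃_one, Algebra.TensorProduct.one_def, biEval_tmul, h1, h2,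
    HopfAlgebra.antipode_one]

theorem crossMap_one_left (h : H) : crossMap P 1 h = h ⊗ₜ 1 := by
  rw [← crossMap_flip, crossMap_one_right, TensorProduct.comm_tmul]

theorem doubleMul_one (x : H ⊗[k] A) : doubleMul P x (1 ⊗ₜ 1) = x := by
  induction x with
  | zero => simp
  | add s t hs ht => simp only [map_add, LinearMap.add_apply, hs, ht]
  | tmul h a => simp [doubleMul_tmul, crossMap_one_right]

theorem one_doubleMul (x : H ⊗[k] A) : doubleMul P (1 ⊗ₜ 1) x = x := by
  induction x with
  | zero => simp
  | add s t hs ht => simp only [map_add, hs, ht]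
  | tmul h a => simp [doubleMul_tmul, crossMap_one_left]

end Pairing

section Double

variable {k H A : Type*} [Field k] [Ring H] [HopfAlgebra k H] [Ring A] [HopfAlgebra k A]

/-- The quantum double `D(H) = H ⋈ Aᵒᵖ`, `A` the dual of `H`: the vector space `H ⊗ A` with
the product `doubleMul`. -/
def Double (_P : HopfPairing k H A) : Type _ := H ⊗[k] A

instance (P : HopfPairing k H A) : AddCommGroup (Double P) :=
  inferInstanceAs (AddCommGroup (H ⊗[k] A))

instance (P : HopfPairing k H A) : Module k (Double P) :=
  inferInstanceAs (Module k (H ⊗[k] A))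

variable (P : HopfPairing k H A)

/-- The identification of vector spaces. -/
def Double.of : H ⊗[k] A ≃ₗ[k] Double P := LinearEquiv.refl k _

instance : Ring (Double P) :=
  { (inferInstance : AddCommGroup (Double P)) with
    mul := fun x y => doubleMul P x y
    one := Double.of P (1 ⊗ₜ 1)
    mul_assoc := doubleMul_assoc P
    one_mul := one_doubleMul P
    mul_one := doubleMul_one P
    left_distrib := fun x y z => map_add (doubleMul P x) y z
    right_distrib := fun x y z => LinearMap.map_add₂ (doubleMul P) x y z
    zero_mul := fun x => LinearMap.map_zero₂ (doubleMul P) x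
    mul_zero := fun x => map_zero (doubleMul P x) }

instance : Algebra k (Double P) :=
  Algebra.ofModule (fun r x y => LinearMap.map_smul₂ (doubleMul P) r x y)
    (fun r x y => map_smul (doubleMul P x) r y)

/-- The tensor product coproduct. -/
def Double.comul : Double P →ₗ[k] Double P ⊗[k] Double P :=
  TensorProduct.map (Double.of P).toLinearMap (Double.of P).toLinearMap ∘ₗ
    Coalgebra.comul ∘ₗ (Double.of P).symm.toLinearMap

/-- The tensor product counit. -/
def Double.counit : Double P →ₗ[k] k := Coalgebra.counit ∘ₗ (Double.of P).symm.toLinearMap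

/-- The covariant system `(D(H), H)`: `(h ⊗ a) ▷ φ = ⟨φ₁, a⟩ h ▷ φ₂`, with the left adjoint action
of `H` on itself on the right-hand side. -/
def doubleOnH : CovariantData k (Double P) H where
  comul := Double.comul P
  counit := Double.counit P
  act := TensorProduct.lift (LinearMap.mk₂ k (fun h a => adAct k H h ∘ₗ leftEval P.flip a)
    (by intros; ext; simp) (by intros; ext; simp) (by intros; ext; simp) (by intros; ext; simp)) ∘ₗ
    (Double.of P).symm.toLinearMap
  mul := LinearMap.mul' k H
  one := 1

/-- `⟨a, t¹⟩ t²`. -/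
def contractLeft (t : H ⊗[k] H) : A →ₗ[k] H where
  toFun a := TensorProduct.lid k H ((P.form a).rTensor H t)
  map_add' := by simp [LinearMap.rTensor_add]
  map_smul' := by simp [LinearMap.rTensor_smul]

/-- `t¹ ⟨a, t²⟩`. -/
def contractRight (t : H ⊗[k] H) : A →ₗ[k] H where
  toFun a := TensorProduct.rid k H ((P.form a).lTensor H t)
  map_add' := by simp [LinearMap.lTensor_add]
  map_smul' := by simp [LinearMap.lTensor_smul]

/-- `x ⊗ y ⊗ z, a ↦ x ⊗ y ⟨a, z⟩`. -/
def contractThird (t : H ⊗[k] (H ⊗[k] H)) : A →ₗ[k] H ⊗[k] H where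
  toFun a := ((TensorProduct.rid k H).toLinearMap ∘ₗ (P.form a).lTensor H).lTensor H t
  map_add' := by simp [LinearMap.lTensor_add, LinearMap.comp_add]
  map_smul' := by simp [LinearMap.lTensor_smul, LinearMap.comp_smul]

/-- `Q = R₂₁ R`. -/
def quantumKilling (R : H ⊗[k] H) : H ⊗[k] H := swap R * R

/-- The map `Q : A → H`, `Q(a) = ⟨a, Q¹⟩ Q²`. -/
def killingMap (R : H ⊗[k] H) : A →ₗ[k] H := contractLeft P (quantumKilling R)

/-- The right adjoint coaction `a ↦ a₂ ⊗ (S a₁) a₃`. -/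
def adCoact : A →ₗ[k] A ⊗[k] A :=
  (LinearMap.mul' k A ∘ₗ (HopfAlgebra.antipode k).rTensor A).lTensor A ∘ₗ
    (TensorProduct.leftComm k A A A).toLinearMap ∘ₗ comul₃ k A

/-- `R(a ⊗ b) = ⟨a, R¹⟩ ⟨b, R²⟩`. -/
def pairR (R : H ⊗[k] H) : A ⊗[k] A →ₗ[k] k :=
  TensorProduct.lift (P.form.flip ∘ₗ contractLeft P R)

/-- The transmuted product `a ⊗ b ↦ a₂ b₂ R((S a₁) a₃ ⊗ S b₁)` of the braided version of `A`. -/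
def transmutedMul (R : H ⊗[k] H) : A ⊗[k] A →ₗ[k] A :=
  (TensorProduct.rid k A).toLinearMap ∘ₗ
    TensorProduct.map (LinearMap.mul' k A) (pairR P R ∘ₗ (HopfAlgebra.antipode k).lTensor A) ∘ₗ
    (TensorProduct.tensorTensorTensorComm k A A A A).toLinearMap ∘ₗ
    TensorProduct.map adCoact ((TensorProduct.comm k A A).toLinearMap ∘ₗ Coalgebra.comul)

/-- `h, b ↦ b₂ ⟨h, (S b₁) b₃⟩`. -/
def coadAct : H →ₗ[k] A →ₗ[k] A :=
  LinearMap.mk₂ k (fun h b => TensorProduct.rid k A ((P.form.flip h).lTensor A (adCoact (k := k) b)))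
    (by simp [LinearMap.lTensor_add]) (by simp [LinearMap.lTensor_smul]) (by simp) (by simp)

/-- `a, b ↦ R(a₁ ⊗ b₁) b₂ R(b₃ ⊗ a₂)`. -/
def braidAct (R : H ⊗[k] H) : A →ₗ[k] A →ₗ[k] A :=
  biEval P ∘ₗ TensorProduct.map (contractLeft P R) (contractRight P R) ∘ₗ Coalgebra.comul

/-- The covariant system `(D(H), A)`, where `A` has the transmuted product and the action is
`(h ⊗ a) ▷ b = b₃ ⟨h, (S b₂) b₄⟩ R(a₁ ⊗ b₁) R(b₅ ⊗ a₂)`. -/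
def doubleOnDual (R : H ⊗[k] H) : CovariantData k (Double P) A where
  comul := Double.comul P
  counit := Double.counit P
  act := TensorProduct.lift (LinearMap.mk₂ k (fun h a => coadAct P h ∘ₗ braidAct P R a)
    (by intros; ext; simp) (by intros; ext; simp) (by intros; ext; simp) (by intros; ext; simp)) ∘ₗ
    (Double.of P).symm.toLinearMap
  mul := transmutedMul P R
  one := 1

/-- The action `a ▷ h = ⟨h₁, a₁⟩ h₂ ⟨S h₃, a₂⟩` of `Aᵒᵖ` on `H`; `⟨S h₃, a₂⟩` is written
`⟨h₃, S a₂⟩`. -/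
def matchedLeft : A →ₗ[k] H →ₗ[k] H :=
  biEval P.flip ∘ₗ (HopfAlgebra.antipode k).lTensor A ∘ₗ Coalgebra.comul

/-- The action `h, a ↦ a ◁ h = ⟨h₁, a₁⟩ a₂ ⟨S h₂, a₃⟩` of `H` on `Aᵒᵖ`. -/
def matchedRight : H →ₗ[k] A →ₗ[k] A :=
  biEval P ∘ₗ (HopfAlgebra.antipode k).lTensor H ∘ₗ Coalgebra.comul

end Double

section Mirror

/-- The bicrossproduct `Hᶜᵒᵖ ▶◁ H`: the vector space `H ⊗ H` with the product `bicrossMul` and the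
coproduct `bicrossComul`. -/
def Bicross (k H : Type*) [Field k] [Ring H] [HopfAlgebra k H] : Type _ := H ⊗[k] H

variable (k H : Type*) [Field k] [Ring H] [HopfAlgebra k H]

instance : AddCommGroup (Bicross k H) := inferInstanceAs (AddCommGroup (H ⊗[k] H))

instance : Module k (Bicross k H) := inferInstanceAs (Module k (H ⊗[k] H))

/-- The identification of vector spaces. -/
def Bicross.of : H ⊗[k] H ≃ₗ[k] Bicross k H := LinearEquiv.refl k _

instance : Ring (Bicross k H) :=
  { (inferInstance : AddCommGroup (Bicross k H)) with
    mul := fun x y => bicrossMul k H x y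
    one := Bicross.of k H (1 ⊗ₜ 1)
    mul_assoc := bicrossMul_assoc
    one_mul := one_bicrossMul
    mul_one := bicrossMul_one
    left_distrib := fun x y z => map_add (bicrossMul k H x) y z
    right_distrib := fun x y z => LinearMap.map_add₂ (bicrossMul k H) x y z
    zero_mul := fun x => LinearMap.map_zero₂ (bicrossMul k H) x
    mul_zero := fun x => map_zero (bicrossMul k H x) }

instance : Algebra k (Bicross k H) :=
  Algebra.ofModule (fun r x y => LinearMap.map_smul₂ (bicrossMul k H) r x y)
    (fun r x y => map_smul (bicrossMul k H x) r y)

/-- The coproduct of the bicrossproduct. -/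
def Bicross.comul : Bicross k H →ₗ[k] Bicross k H ⊗[k] Bicross k H :=
  TensorProduct.map (Bicross.of k H).toLinearMap (Bicross.of k H).toLinearMap ∘ₗ
    bicrossComul k H ∘ₗ (Bicross.of k H).symm.toLinearMap

/-- The counit `φ ⊗ h ↦ ε(φ) ε(h)`. -/
def Bicross.counit : Bicross k H →ₗ[k] k :=
  Coalgebra.counit ∘ₗ (Bicross.of k H).symm.toLinearMap

/-- The map `θ₁ : Hᶜᵒᵖ ⊗ H → Hᶜᵒᵖ ▶◁ H`, `φ ⊗ h ↦ φ (S h₁) ⊗ h₂`. -/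
def thetaOne : H ⊗[k] H →ₗ[k] Bicross k H := (Bicross.of k H).toLinearMap ∘ₗ theta₁ k H

/-- `θ₁ ⊗ θ₁`. -/
def thetaOneTwice : (H ⊗[k] H) ⊗[k] (H ⊗[k] H) →ₗ[k] Bicross k H ⊗[k] Bicross k H :=
  TensorProduct.map (thetaOne k H) (thetaOne k H)

variable {k H} {A : Type*} [Ring A] [HopfAlgebra k A] (P : HopfPairing k H A)

/-- The covariant system `(Hᶜᵒᵖ ▶◁ H, A)`: `(φ ⊗ h) ▷ a = ⟨(S h₁) (S φ), a₁⟩ a₂ ⟨h₂, a₃⟩`. -/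
def mirrorOnDual : CovariantData k (Bicross k H) A where
  comul := Bicross.comul k H
  counit := Bicross.counit k H
  act := TensorProduct.lift (LinearMap.mk₂ k
    (fun φ h => biEval P (((LinearMap.mul k H).flip (HopfAlgebra.antipode k φ) ∘ₗ
      HopfAlgebra.antipode k).rTensor H (Coalgebra.comul h)))
    (by intros; simp [LinearMap.add_comp, LinearMap.rTensor_add])
    (by intros; simp [LinearMap.smul_comp, LinearMap.rTensor_smul])
    (by intros; simp) (by intros; simp)) ∘ₗ (Bicross.of k H).symm.toLinearMap
  mul := LinearMap.mul' k A
  one := 1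

/-- The right action `a ◁ (φ ⊗ h) = ⟨φ, a₁⟩ (a₂ ◁ h)` of `Hᶜᵒᵖ ▶◁ H` on `Aᵒᵖ`. -/
def mirrorRightAct : Bicross k H →ₗ[k] A →ₗ[k] A :=
  TensorProduct.lift (LinearMap.mk₂ k (fun φ h => matchedRight P h ∘ₗ leftEval P φ)
    (by intros; ext; simp) (by intros; ext; simp) (by intros; ext; simp) (by intros; ext; simp)) ∘ₗ
    (Bicross.of k H).symm.toLinearMap

/-- The covariant system `(Hᶜᵒᵖ ▶◁ H, A)` is the semidual of `(D(H), H)`: `D(H) = H ⋈ Aᵒᵖ` is the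
double crossproduct of the actions `▷`, `◁` of a matched pair; the action of `H` and the coaction
of `Hᶜᵒᵖ` that define the bicrossproduct arise from `◁` and `▷` by dualising `Aᵒᵖ` to `Hᶜᵒᵖ`; and
the left action on `A` is the canonical right action on `Aᵒᵖ` composed with the inverse
antipode. -/
structure IsSemidual : Prop where
  double : ∀ (a : A) (h : H), Double.of P (1 ⊗ₜ a) * Double.of P (h ⊗ₜ 1) =
    Double.of P (TensorProduct.map (TensorProduct.lift (matchedLeft P))
      (TensorProduct.lift (matchedRight P).flip) (Coalgebra.comul (a ⊗ₜ[k] h)))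
  act : ∀ (a : A) (h φ : H), P.form a (adAct k H h φ) = P.form (matchedRight P h a) φ
  coact : ∀ (a : A) (h : H),
    TensorProduct.rid k H ((P.form a).lTensor H (coadCoact k H h)) = matchedLeft P a h
  flip : ∃ S : Bicross k H ≃ₗ[k] Bicross k H,
    IsAntipode (Bicross.comul k H) (Bicross.counit k H) S.toLinearMap ∧
    ∀ (x : Bicross k H) (a : A), (mirrorOnDual P).act x a = mirrorRightAct P (S.symm x) a

/-- The cocycle `χ = R₂₃⁻¹ R₁₃⁻¹` of `Hᶜᵒᵖ ⊗ H`. -/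
def chi (R : H ⊗[k] H) : (H ⊗[k] H) ⊗[k] (H ⊗[k] H) :=
  quad₂₃ (Ring.inverse R) * quad₁₃ (Ring.inverse R)

/-- The element `R₂₃⁻¹` of `(Hᶜᵒᵖ ▶◁ H) ⊗ (Hᶜᵒᵖ ▶◁ H)`. -/
def chiMirror (R : H ⊗[k] H) : Bicross k H ⊗[k] Bicross k H :=
  TensorProduct.map (Bicross.of k H).toLinearMap (Bicross.of k H).toLinearMap
    (quad₂₃ (Ring.inverse R))

/-- The map `θ₂ : D(H) → H ⊗ H`, `θ₂(h ⊗ a) = h₁ R⁻² ⊗ h₂ R¹ ⟨a, R⁻¹ R²⟩`, where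
`R⁻¹ ⊗ R⁻²` stands for the inverse of `R`: the product of `Δ h` and `⟨a, ·⟩` of the third leg of
`R₃₁⁻¹ R₂₃`. -/
def thetaTwo (R : H ⊗[k] H) : Double P →ₗ[k] H ⊗[k] H :=
  LinearMap.mul' k (H ⊗[k] H) ∘ₗ TensorProduct.map Coalgebra.comul
    (contractThird P (leg₁₃ (swap (Ring.inverse R)) * leg₂₃ R)) ∘ₗ (Double.of P).symm.toLinearMap

/-- `θ(h ⊗ a) = h₁ Q⁻² (S h₂) ⊗ h₃ R¹ ⟨a, Q⁻¹ R²⟩`, where `Q⁻¹ ⊗ Q⁻²` stands for the inverse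
of `Q`; note `smashAct h (x ⊗ y) = h₁ x (S h₂) ⊗ h₃ y`. -/
def thetaFormula (R : H ⊗[k] H) (h : H) (a : A) : Bicross k H :=
  Bicross.of k H (smashAct k H h (contractThird P
    (leg₁₃ (swap (Ring.inverse (quantumKilling R))) * leg₂₃ R) a))

end Mirror

end QuantumDouble

end

open QuantumDouble

/-!
The three covariant systems are compared with a simpler one, `tensorOnDual`: the Hopf algebra
`Hᶜᵒᵖ ⊗ H`, acting on the dual `A` of `H` by `(x ⊗ y) ▷ a = ⟨S x, a₁⟩ a₂ ⟨y, a₃⟩`.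

* `θ₁⁻¹ (φ ⊗ h) = φ h₁ ⊗ h₂` identifies the bicrossproduct `B` and its action on `A` with this
  system (`isIso_mirrorOnDual_tensorOnDual`).
* `θ₂` identifies `D(H)` and its action on the transmuted algebra `A` with the twist of this system
  by `χ = R₂₃⁻¹ R₁₃⁻¹` (`isIso_doubleOnDual_twist`). That `θ₂` respects products and coproducts
  amounts to the relations between `R` and the coproduct, and the Yang-Baxter equation, for the
  element `R₃₁⁻¹ R₂₃`, whose evaluations in the third leg are the values of `θ₂` on `A`.
* `χ` equals `(Δ ⊗ id) R⁻¹` and `θ₁⁻¹` maps `1 ⊗ h` to `Δ h`. Hence `θ₁ ⊗ θ₁` maps `χ` to `R₂₃⁻¹`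
  (`mapTwo_thetaOne_chi`), and `θ₁ θ₂` leads from `D(H)` to the twist of `B` by `R₂₃⁻¹`.

So the axioms of a covariant system, the cocycle identity and the quasitriangular structures need to
be verified on `Hᶜᵒᵖ ⊗ H` only, and are carried over along isomorphisms and twists
(`CovariantData.IsCovariantSystem.transport`, `CovariantData.IsCovariantSystem.twist`,
`IsQuasitriangular.tensor`, `IsQuasitriangular.transport`). The antipode of a twist, which
`CovariantData.IsCovariantSystem.twist` takes as given, comes from `D(H)`
(`exists_antipode_twist_chi`).

The map `Q` intertwines the actions of `D(H)` on `A` and on `H` (`killingMap_coadAct`,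
`killingMap_braidAct`) and turns the transmuted product into the product of `H`
(`killingMap_mul_eq`), which makes the covariant system on `H` isomorphic to the one on `A`.

Factorisability enters through three facts. A bijective `Q` has finite rank, so that `H` is
finite-dimensional (`finite_of_factorisable`). Since `S ∘ Q ∘ S` is the transpose of `Q`, the
antipodes of `H` and `A` are bijective (`bijective_antipode`, `bijective_antipode_dual`), which
provides the antipodes of `Hᶜᵒᵖ`, of `B` and of `D(H)`. Finally `θ₂` maps `ρ(a₁) ⊗ a₂`, where
`ρ(a) = ⟨a, R¹⟩ R²`, to `1 ⊗ Q¹ ⟨a, Q²⟩`, which makes `θ₂` surjective (`surjective_thetaTwo`), and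
it is bijective because both sides have the same dimension.

The computations are carried out in two forms that avoid Sweedler indices. A tensor `t` is placed in
the commuting images of two algebra maps `f` and `g` as `legs f g t`, which turns identities between
`R`-matrices into identities between words in a ring. Identities in a variable `h ∈ H` with several
coproducts become identities between words in the convolution algebra of maps out of `H`, with the
invertible elements `leg f` and the constants `constFun H x`.
-/

noncomputable section

namespace QuantumDouble

open WithConv

/-! ### Legs of a tensor and the convolution algebra -/

section Legs

variable {k K L X Y : Type*} [Field k] [Ring K] [Algebra k K] [Ring L] [Algebra k L]
  [Ring X] [Algebra k X] [Ring Y] [Algebra k Y]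

/-- Two algebra maps into `X` have elementwise commuting images. -/
def CommutingLegs (f : K →ₐ[k] X) (g : L →ₐ[k] X) : Prop := ∀ x y, Commute (f x) (g y)

theorem CommutingLegs.symm {f : K →ₐ[k] X} {g : L →ₐ[k] X} (h : CommutingLegs f g) :
    CommutingLegs g f := fun x y => (h y x).symm

/-- `x ⊗ y ↦ f x * g y`: the element `t` placed in the legs `f` and `g`. -/
def legs (f : K →ₐ[k] X) (g : L →ₐ[k] X) : K ⊗[k] L →ₗ[k] X :=
  LinearMap.mul' k X ∘ₗ TensorProduct.map f.toLinearMap g.toLinearMap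

@[simp] theorem legs_tmul (f : K →ₐ[k] X) (g : L →ₐ[k] X) (x : K) (y : L) :
    legs f g (x ⊗ₜ y) = f x * g y := rfl

@[simp] theorem legs_one (f : K →ₐ[k] X) (g : L →ₐ[k] X) : legs f g 1 = 1 := by
  simp [Algebra.TensorProduct.one_def]

theorem lift_eq_legs (f : K →ₐ[k] X) (g : L →ₐ[k] X) (h : CommutingLegs f g) (t : K ⊗[k] L) :
    Algebra.TensorProduct.lift f g h t = legs f g t := by
  induction t with
  | zero => simp
  | add s t hs ht => simp only [map_add, hs, ht]
  | tmul x y => exact Algebra.TensorProduct.lift_tmul f g h x y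

theorem legs_mul {f : K →ₐ[k] X} {g : L →ₐ[k] X} (h : CommutingLegs f g) (s t : K ⊗[k] L) :
    legs f g (s * t) = legs f g s * legs f g t := by
  simp only [← lift_eq_legs f g h, map_mul]

theorem map_legs (φ : X →ₐ[k] Y) (f : K →ₐ[k] X) (g : L →ₐ[k] X) (t : K ⊗[k] L) :
    φ (legs f g t) = legs (φ.comp f) (φ.comp g) t := by
  induction t with
  | zero => simp
  | add s t hs ht => simp only [map_add, hs, ht]
  | tmul x y => simp

theorem commute_legs {f : K →ₐ[k] X} {g : L →ₐ[k] X} {z : X} (hf : ∀ x, Commute (f x) z)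
    (hg : ∀ y, Commute (g y) z) (t : K ⊗[k] L) : Commute (legs f g t) z := by
  induction t with
  | zero => simp
  | add s t hs ht => rw [map_add]; exact hs.add_left ht
  | tmul x y => exact (hf x).mul_left (hg y)

theorem commute_legs_legs {M N : Type*} [Ring M] [Algebra k M] [Ring N] [Algebra k N]
    {f : K →ₐ[k] X} {g : L →ₐ[k] X} {u : M →ₐ[k] X} {v : N →ₐ[k] X}
    (h₁ : CommutingLegs f u) (h₂ : CommutingLegs f v) (h₃ : CommutingLegs g u)
    (h₄ : CommutingLegs g v) (s : K ⊗[k] L) (t : M ⊗[k] N) :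
    Commute (legs f g s) (legs u v t) :=
  commute_legs (fun x => (commute_legs (fun y => (h₁ x y).symm) (fun y => (h₂ x y).symm) t).symm)
    (fun x => (commute_legs (fun y => (h₃ x y).symm) (fun y => (h₄ x y).symm) t).symm) s

theorem legs_swap {f g : K →ₐ[k] X} (h : CommutingLegs f g) (t : K ⊗[k] K) :
    legs f g (swap t) = legs g f t := by
  simp only [swap]
  induction t with
  | zero => simp
  | add s t hs ht => simp only [map_add, hs, ht]
  | tmul x y => simpa using (h y x).eq

theorem legs_inverse_mul {f g : K →ₐ[k] X} (h : CommutingLegs f g) {t : K ⊗[k] K}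
    (ht : IsUnit t) : legs f g (Ring.inverse t) * legs f g t = 1 := by
  rw [← legs_mul h, Ring.inverse_mul_cancel t ht, legs_one]

theorem legs_mul_inverse {f g : K →ₐ[k] X} (h : CommutingLegs f g) {t : K ⊗[k] K}
    (ht : IsUnit t) : legs f g t * legs f g (Ring.inverse t) = 1 := by
  rw [← legs_mul h, Ring.mul_inverse_cancel t ht, legs_one]

theorem swap_mul (s t : K ⊗[k] K) : swap (s * t) = swap s * swap t :=
  map_mul (Algebra.TensorProduct.comm k K K) s t

theorem swap_one : swap (1 : K ⊗[k] K) = 1 := map_one (Algebra.TensorProduct.comm k K K)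

@[simp] theorem swap_tmul (x y : K) : swap (x ⊗ₜ[k] y) = y ⊗ₜ x := rfl

@[simp] theorem swap_swap (t : K ⊗[k] K) : swap (swap t) = t := by
  simp only [swap]
  induction t with
  | zero => simp
  | add s t hs ht => simp only [map_add, hs, ht]
  | tmul x y => simp

theorem isUnit_swap {t : K ⊗[k] K} (h : IsUnit t) : IsUnit (swap t) :=
  h.map (Algebra.TensorProduct.comm k K K)

theorem ring_inverse_eq_of_mul_eq_one {t s : K} (h : s * t = 1) (ht : IsUnit t) :
    Ring.inverse t = s := by
  rw [← one_mul (Ring.inverse t), ← h, mul_assoc, Ring.mul_inverse_cancel t ht, mul_one]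

theorem swap_inverse {t : K ⊗[k] K} (h : IsUnit t) :
    Ring.inverse (swap t) = swap (Ring.inverse t) :=
  ring_inverse_eq_of_mul_eq_one (by rw [← swap_mul, Ring.inverse_mul_cancel t h, swap_one])
    (isUnit_swap h)

theorem inverse_inverse {t : K} (h : IsUnit t) : Ring.inverse (Ring.inverse t) = t :=
  ring_inverse_eq_of_mul_eq_one (Ring.mul_inverse_cancel t h) h.ringInverse

section Inclusions

/-- The first tensor factor. -/
abbrev incl (k K L : Type*) [Field k] [Ring K] [Algebra k K] [Ring L] [Algebra k L] :
    K →ₐ[k] K ⊗[k] L := Algebra.TensorProduct.includeLeft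

/-- The second tensor factor. -/
abbrev incr (k K L : Type*) [Field k] [Ring K] [Algebra k K] [Ring L] [Algebra k L] :
    L →ₐ[k] K ⊗[k] L := Algebra.TensorProduct.includeRight

variable {M N : Type*} [Ring M] [Algebra k M] [Ring N] [Algebra k N]

theorem commutingLegs_incl_incr : CommutingLegs (incl k K L) (incr k K L) := by
  intro x y; simp [Commute, SemiconjBy]

theorem CommutingLegs.comp {f : K →ₐ[k] X} {g : L →ₐ[k] X} (h : CommutingLegs f g)
    (u : M →ₐ[k] K) (v : N →ₐ[k] L) : CommutingLegs (f.comp u) (g.comp v) := fun _ _ => h _ _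

theorem CommutingLegs.map {f : K →ₐ[k] X} {g : L →ₐ[k] X} (h : CommutingLegs f g)
    (φ : X →ₐ[k] Y) : CommutingLegs (φ.comp f) (φ.comp g) := fun x y => (h x y).map φ

end Inclusions

theorem leg₁₂_eq (t : K ⊗[k] K) : leg₁₂ t =
    legs (incl k K (K ⊗[k] K)) ((incr k K (K ⊗[k] K)).comp (incl k K K)) t := by
  induction t with
  | zero => simp [leg₁₂]
  | add s t hs ht => simp only [leg₁₂, map_add] at *; rw [hs, ht]
  | tmul x y => simp [leg₁₂, inl]

theorem leg₁₃_eq (t : K ⊗[k] K) : leg₁₃ t =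
    legs (incl k K (K ⊗[k] K)) ((incr k K (K ⊗[k] K)).comp (incr k K K)) t := by
  induction t with
  | zero => simp [leg₁₃]
  | add s t hs ht => simp only [leg₁₃, map_add] at *; rw [hs, ht]
  | tmul x y => simp [leg₁₃, inr]

theorem leg₂₃_eq (t : K ⊗[k] K) : leg₂₃ t = legs ((incr k K (K ⊗[k] K)).comp (incl k K K))
    ((incr k K (K ⊗[k] K)).comp (incr k K K)) t := by
  induction t with
  | zero => simp [leg₂₃]
  | add s t hs ht => simp only [leg₂₃, map_add] at *; rw [hs, ht]
  | tmul x y => simp [leg₂₃]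

/-- `x ⊗ y ⊗ z ↦ f x * (g y * h z)`. -/
def legs₃ (f g h : K →ₐ[k] X) : K ⊗[k] (K ⊗[k] K) →ₗ[k] X :=
  LinearMap.mul' k X ∘ₗ TensorProduct.map f.toLinearMap (legs g h)

@[simp] theorem legs₃_tmul (f g h : K →ₐ[k] X) (x : K) (t : K ⊗[k] K) :
    legs₃ f g h (x ⊗ₜ t) = f x * legs g h t := rfl

theorem legs₃_mul {f g h : K →ₐ[k] X} (hfg : CommutingLegs f g) (hfh : CommutingLegs f h)
    (hgh : CommutingLegs g h) (s t : K ⊗[k] (K ⊗[k] K)) :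
    legs₃ f g h (s * t) = legs₃ f g h s * legs₃ f g h t := by
  have hc : CommutingLegs f (Algebra.TensorProduct.lift g h hgh) := fun x y => by
    rw [lift_eq_legs]
    exact (commute_legs (fun u => (hfg x u).symm) (fun u => (hfh x u).symm) y).symm
  have h1 : ∀ t, legs₃ f g h t = legs f (Algebra.TensorProduct.lift g h hgh) t := by
    intro t
    induction t with
    | zero => simp
    | add s t hs ht => simp only [map_add, hs, ht]
    | tmul x y => rw [legs₃_tmul, legs_tmul, lift_eq_legs]
  simp only [h1, legs_mul hc]

theorem legs₃_leg₁₂ (f g h : K →ₐ[k] X) (t : K ⊗[k] K) :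
    legs₃ f g h (leg₁₂ t) = legs f g t := by
  induction t with
  | zero => simp [leg₁₂]
  | add s t hs ht => simp only [leg₁₂, map_add] at *; rw [hs, ht]
  | tmul x y => simp [leg₁₂, inl]

theorem legs₃_leg₁₃ (f g h : K →ₐ[k] X) (t : K ⊗[k] K) :
    legs₃ f g h (leg₁₃ t) = legs f h t := by
  induction t with
  | zero => simp [leg₁₃]
  | add s t hs ht => simp only [leg₁₃, map_add] at *; rw [hs, ht]
  | tmul x y => simp [leg₁₃, inr]

theorem legs₃_leg₂₃ (f g h : K →ₐ[k] X) (t : K ⊗[k] K) :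
    legs₃ f g h (leg₂₃ t) = legs g h t := by
  induction t with
  | zero => simp [leg₂₃]
  | add s t hs ht => simp only [leg₂₃, map_add] at *; rw [hs, ht]
  | tmul x y => simp [leg₂₃]

end Legs

section Quasitriangular

variable {k K X : Type*} [Field k] [Ring K] [Algebra k K] [Ring X] [Algebra k X]
  {Δ : K →ₗ[k] K ⊗[k] K} {R : K ⊗[k] K}

theorem legs₃_assoc_rTensor {f g h p : K →ₐ[k] X} (hp : ∀ x, p x = legs f g (Δ x))
    (t : K ⊗[k] K) :
    legs₃ f g h (TensorProduct.assoc k K K K (Δ.rTensor K t)) = legs p h t := by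
  induction t with
  | zero => simp
  | add s t hs ht => simp only [map_add, hs, ht]
  | tmul x y =>
    rw [legs_tmul, hp, LinearMap.rTensor_tmul]
    induction Δ x with
    | zero => simp
    | add s t hs ht => simp only [map_add, add_mul, TensorProduct.add_tmul, hs, ht]
    | tmul x y => simp [mul_assoc]

theorem legs₃_lTensor {f g h p : K →ₐ[k] X} (hp : ∀ x, p x = legs g h (Δ x))
    (t : K ⊗[k] K) : legs₃ f g h (Δ.lTensor K t) = legs f p t := by
  induction t with
  | zero => simp
  | add s t hs ht => simp only [map_add, hs, ht]
  | tmul x y => rw [legs_tmul, hp, LinearMap.lTensor_tmul, legs₃_tmul]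

/-- `(Δ ⊗ id) R = R₁₃ R₂₃`, with the legs `f`, `g`, `h`. -/
theorem IsQuasitriangular.legs_left (hR : IsQuasitriangular Δ R) {f g h p : K →ₐ[k] X}
    (hp : ∀ x, p x = legs f g (Δ x)) (hfg : CommutingLegs f g) (hfh : CommutingLegs f h)
    (hgh : CommutingLegs g h) : legs p h R = legs f h R * legs g h R := by
  rw [← legs₃_assoc_rTensor hp, hR.comul_left, legs₃_mul hfg hfh hgh, legs₃_leg₁₃, legs₃_leg₂₃]

/-- `(id ⊗ Δ) R = R₁₃ R₁₂`, with the legs `h`, `f`, `g`. -/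
theorem IsQuasitriangular.legs_right (hR : IsQuasitriangular Δ R) {f g h p : K →ₐ[k] X}
    (hp : ∀ x, p x = legs f g (Δ x)) (hfg : CommutingLegs f g) (hhf : CommutingLegs h f)
    (hhg : CommutingLegs h g) : legs h p R = legs h g R * legs h f R := by
  rw [← legs₃_lTensor hp, hR.comul_right, legs₃_mul hhf hhg hfg, legs₃_leg₁₃, legs₃_leg₁₂]

theorem IsQuasitriangular.swap_mul_eq (hR : IsQuasitriangular Δ R) (x : K) :
    swap (Δ x) * R = R * Δ x := by
  rw [hR.comul_swap, mul_assoc, Ring.inverse_mul_cancel R hR.isUnit, mul_one]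

theorem IsQuasitriangular.legs_swap_mul (hR : IsQuasitriangular Δ R) {f g : K →ₐ[k] X}
    (h : CommutingLegs f g) (x : K) :
    legs f g R * legs f g (Δ x) = legs g f (Δ x) * legs f g R := by
  rw [← legs_swap h, ← legs_mul h, ← legs_mul h, hR.swap_mul_eq]

end Quasitriangular

section Hopf

variable {k H X : Type*} [Field k] [Ring H] [HopfAlgebra k H] [Ring X] [Algebra k X]

/-- The convolution product of two commuting algebra maps. -/
def convLegs (f g : H →ₐ[k] X) (h : CommutingLegs f g) : H →ₐ[k] X :=
  (Algebra.TensorProduct.lift f g h).comp (Bialgebra.comulAlgHom k H)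

theorem convLegs_apply (f g : H →ₐ[k] X) (h : CommutingLegs f g) (x : H) :
    convLegs f g h x = legs f g (Coalgebra.comul x) :=
  lift_eq_legs f g h _

/-- The Yang-Baxter equation. -/
theorem IsQuasitriangular.yangBaxter {R : H ⊗[k] H} (hR : IsQuasitriangular Coalgebra.comul R)
    {f g h : H →ₐ[k] X} (hfg : CommutingLegs f g) (hfh : CommutingLegs f h)
    (hgh : CommutingLegs g h) :
    legs f g R * legs f h R * legs g h R = legs g h R * legs f h R * legs f g R := by
  have h1 := hR.legs_left (p := convLegs f g hfg) (convLegs_apply _ _ _) hfg hfh hgh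
  have h2 := hR.legs_left (p := convLegs g f hfg.symm) (convLegs_apply _ _ _) hfg.symm hgh hfh
  have h3 : ∀ t : H ⊗[k] H, legs f g R * legs (convLegs f g hfg) h t =
      legs (convLegs g f hfg.symm) h t * legs f g R := by
    intro t
    induction t with
    | zero => simp
    | add s t hs ht => simp only [map_add, mul_add, add_mul, hs, ht]
    | tmul x y =>
      rw [legs_tmul, legs_tmul, ← mul_assoc, convLegs_apply, convLegs_apply, hR.legs_swap_mul hfg,
        mul_assoc, mul_assoc,
        (commute_legs (fun x => hfh x y) (fun x => hgh x y) R : Commute (legs f g R) (h y)).eq]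
  rw [mul_assoc, ← h1, h3, h2]

/-- The map with value `ε(c) x` at `c`: the constant `x` in the convolution algebra. -/
def constFun (C : Type*) [AddCommGroup C] [Module k C] [Coalgebra k C] (x : X) :
    WithConv (C →ₗ[k] X) :=
  toConv (LinearMap.toSpanSingleton k X x ∘ₗ Coalgebra.counit)

variable {C : Type*} [AddCommGroup C] [Module k C] [Coalgebra k C]

theorem constFun_mul_apply (x : X) (F : WithConv (C →ₗ[k] X)) (c : C) :
    (constFun C x * F).ofConv c = x * F.ofConv c := by
  have h1 : ∀ t : C ⊗[k] C, LinearMap.mul' k X (TensorProduct.map (constFun C x).ofConv F.ofConv t)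
      = x * F.ofConv (TensorProduct.lid k C (Coalgebra.counit.rTensor C t)) := by
    intro t
    induction t with
    | zero => simp
    | add s t hs ht => simp only [map_add, mul_add, hs, ht]
    | tmul u v => simp [constFun]
  rw [LinearMap.convMul_apply, h1, Coalgebra.rTensor_counit_comul]
  simp

theorem mul_constFun_apply (x : X) (F : WithConv (C →ₗ[k] X)) (c : C) :
    (F * constFun C x).ofConv c = F.ofConv c * x := by
  have h1 : ∀ t : C ⊗[k] C, LinearMap.mul' k X (TensorProduct.map F.ofConv (constFun C x).ofConv t)
      = F.ofConv (TensorProduct.rid k C (Coalgebra.counit.lTensor C t)) * x := by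
    intro t
    induction t with
    | zero => simp
    | add s t hs ht => simp only [map_add, add_mul, hs, ht]
    | tmul u v => simp [constFun]
  rw [LinearMap.convMul_apply, h1, Coalgebra.lTensor_counit_comul]
  simp

/-- An algebra map as an element of the convolution algebra. -/
def leg (f : H →ₐ[k] X) : WithConv (H →ₗ[k] X) := toConv f.toLinearMap

/-- The convolution inverse of an algebra map. -/
def legInv (f : H →ₐ[k] X) : WithConv (H →ₗ[k] X) :=
  toConv (f.toLinearMap ∘ₗ HopfAlgebra.antipode k)

theorem leg_apply (f : H →ₐ[k] X) (x : H) : (leg f).ofConv x = f x := rfl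

theorem legInv_apply (f : H →ₐ[k] X) (x : H) :
    (legInv f).ofConv x = f (HopfAlgebra.antipode k x) := rfl

theorem leg_mul_leg_apply (f g : H →ₐ[k] X) (x : H) :
    (leg f * leg g).ofConv x = legs f g (Coalgebra.comul x) := rfl

@[simp] theorem legInv_mul_leg (f : H →ₐ[k] X) : legInv f * leg f = 1 := by
  have h := LinearMap.algHom_comp_convMul_distrib (C := H) f
    (toConv (HopfAlgebra.antipode k)) (toConv LinearMap.id)
  rw [LinearMap.antipode_mul_id] at h
  refine WithConv.ext (Eq.trans h.symm ?_)
  ext; simp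

@[simp] theorem leg_mul_legInv (f : H →ₐ[k] X) : leg f * legInv f = 1 := by
  have h := LinearMap.algHom_comp_convMul_distrib (C := H) f
    (toConv LinearMap.id) (toConv (HopfAlgebra.antipode k))
  rw [LinearMap.id_mul_antipode] at h
  refine WithConv.ext (Eq.trans h.symm ?_)
  ext; simp

@[simp] theorem legInv_mul_leg_mul (f : H →ₐ[k] X) (F : WithConv (H →ₗ[k] X)) :
    legInv f * (leg f * F) = F := by rw [← mul_assoc, legInv_mul_leg, one_mul]

/-- A constant commutes with a leg whose values commute with it. -/
theorem constFun_mul_leg {x : X} {f : H →ₐ[k] X} (h : ∀ y, Commute x (f y)) :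
    constFun H x * leg f = leg f * constFun H x := by
  ext y
  rw [constFun_mul_apply, mul_constFun_apply]
  exact (h y).eq

/-- The relation `R (Δ h) = (Δᶜᵒᵖ h) R` for the universal `h`. -/
theorem IsQuasitriangular.constFun_mul {R : H ⊗[k] H}
    (hR : IsQuasitriangular Coalgebra.comul R) {f g : H →ₐ[k] X} (h : CommutingLegs f g) :
    constFun H (legs f g R) * (leg f * leg g) = leg g * leg f * constFun H (legs f g R) := by
  ext y
  rw [constFun_mul_apply, mul_constFun_apply, leg_mul_leg_apply, leg_mul_leg_apply]
  exact hR.legs_swap_mul h y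

end Hopf

/-! ### Quasitriangular structures: opposite coproducts and tensor products -/

section Structures

variable {k K X : Type*} [Field k] [Ring K] [Algebra k K] [Ring X] [Algebra k X]
  {Δ : K →ₗ[k] K ⊗[k] K} {R : K ⊗[k] K}

theorem commutingLegs_of_apply {δ : K → K ⊗[k] K} {f g p h : K →ₐ[k] X}
    (hp : ∀ x, p x = legs f g (δ x))
    (hfh : CommutingLegs f h) (hgh : CommutingLegs g h) : CommutingLegs p h := fun x y => by
  rw [hp]
  exact commute_legs (fun u => hfh u y) (fun u => hgh u y) _

/-- A left and a right inverse of the same element agree. -/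
theorem eq_of_mul_eq_one {a b c : K} (h : a * b = 1) (h' : b * c = 1) : a = c := by
  rw [← mul_one a, ← h', ← mul_assoc, h, one_mul]

/-- `(Δ ⊗ id) R⁻¹ = R₂₃⁻¹ R₁₃⁻¹`, with the legs `f`, `g`, `h`. -/
theorem IsQuasitriangular.legs_left_inverse (hR : IsQuasitriangular Δ R) {f g h p : K →ₐ[k] X}
    (hp : ∀ x, p x = legs f g (Δ x)) (hfg : CommutingLegs f g) (hfh : CommutingLegs f h)
    (hgh : CommutingLegs g h) :
    legs p h (Ring.inverse R) = legs g h (Ring.inverse R) * legs f h (Ring.inverse R) := by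
  refine eq_of_mul_eq_one
    (legs_inverse_mul (commutingLegs_of_apply hp hfh hgh) hR.isUnit) ?_
  rw [hR.legs_left hp hfg hfh hgh, mul_assoc, ← mul_assoc (legs g h R),
    legs_mul_inverse hgh hR.isUnit, one_mul, legs_mul_inverse hfh hR.isUnit]

/-- `(id ⊗ Δ) R⁻¹ = R₁₂⁻¹ R₁₃⁻¹`, with the legs `h`, `f`, `g`. -/
theorem IsQuasitriangular.legs_right_inverse (hR : IsQuasitriangular Δ R) {f g h p : K →ₐ[k] X}
    (hp : ∀ x, p x = legs f g (Δ x)) (hfg : CommutingLegs f g) (hhf : CommutingLegs h f)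
    (hhg : CommutingLegs h g) :
    legs h p (Ring.inverse R) = legs h f (Ring.inverse R) * legs h g (Ring.inverse R) := by
  refine eq_of_mul_eq_one
    (legs_inverse_mul (commutingLegs_of_apply hp hhf.symm hhg.symm).symm hR.isUnit) ?_
  rw [hR.legs_right hp hfg hhf hhg, mul_assoc, ← mul_assoc (legs h f R),
    legs_mul_inverse hhf hR.isUnit, one_mul, legs_mul_inverse hhg hR.isUnit]

variable (k K) in
/-- The first leg of `K ⊗ (K ⊗ K)`. -/
abbrev fst₃ : K →ₐ[k] K ⊗[k] (K ⊗[k] K) := incl k K (K ⊗[k] K)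

variable (k K) in
/-- The second leg of `K ⊗ (K ⊗ K)`. -/
abbrev snd₃ : K →ₐ[k] K ⊗[k] (K ⊗[k] K) := (incr k K (K ⊗[k] K)).comp (incl k K K)

variable (k K) in
/-- The third leg of `K ⊗ (K ⊗ K)`. -/
abbrev trd₃ : K →ₐ[k] K ⊗[k] (K ⊗[k] K) := (incr k K (K ⊗[k] K)).comp (incr k K K)

theorem comm₁₂ : CommutingLegs (fst₃ k K) (snd₃ k K) := fun x y => by
  simp [Commute, SemiconjBy]

theorem comm₁₃ : CommutingLegs (fst₃ k K) (trd₃ k K) := fun x y => by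
  simp [Commute, SemiconjBy]

theorem comm₂₃ : CommutingLegs (snd₃ k K) (trd₃ k K) := fun x y => by
  simp [Commute, SemiconjBy]

/-- `x ↦ Δ x ⊗ 1`. -/
def comulFirst (Δ : K →ₐ[k] K ⊗[k] K) : K →ₐ[k] K ⊗[k] (K ⊗[k] K) :=
  (Algebra.TensorProduct.assoc k k k K K K).toAlgHom.comp ((incl k (K ⊗[k] K) K).comp Δ)

theorem comulFirst_apply (Δ : K →ₐ[k] K ⊗[k] K) (x : K) :
    comulFirst Δ x = legs (fst₃ k K) (snd₃ k K) (Δ x) := by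
  simp only [comulFirst, AlgHom.comp_apply]
  induction Δ x with
  | zero => simp
  | add s t hs ht => simp only [map_add, hs, ht]
  | tmul x y => simp

theorem incr_comp_apply (Δ : K →ₐ[k] K ⊗[k] K) (x : K) :
    (incr k K (K ⊗[k] K)).comp Δ x = legs (snd₃ k K) (trd₃ k K) (Δ x) := by
  simp only [AlgHom.comp_apply]
  induction Δ x with
  | zero => simp
  | add s t hs ht => simp only [map_add, hs, ht]
  | tmul x y => simp

/-- `(Δ ⊗ id) t` as an element placed in two legs, the first of which is `x ↦ Δ x ⊗ 1`. -/
theorem assoc_rTensor_eq_legs (Δ : K →ₐ[k] K ⊗[k] K) (t : K ⊗[k] K) :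
    TensorProduct.assoc k K K K (Δ.toLinearMap.rTensor K t) =
      legs (comulFirst Δ) (trd₃ k K) t := by
  induction t with
  | zero => simp
  | add s t hs ht => simp only [map_add, hs, ht]
  | tmul x y =>
    rw [legs_tmul, comulFirst_apply, LinearMap.rTensor_tmul, AlgHom.toLinearMap_apply]
    induction Δ x with
    | zero => simp
    | add s t hs ht => simp only [map_add, add_mul, TensorProduct.add_tmul, hs, ht]
    | tmul u v => simp

/-- `(id ⊗ Δ) t` as an element placed in two legs, the second of which is `x ↦ 1 ⊗ Δ x`. -/
theorem lTensor_eq_legs (Δ : K →ₐ[k] K ⊗[k] K) (t : K ⊗[k] K) :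
    Δ.toLinearMap.lTensor K t = legs (fst₃ k K) ((incr k K (K ⊗[k] K)).comp Δ) t := by
  induction t with
  | zero => simp
  | add s t hs ht => simp only [map_add, hs, ht]
  | tmul x y => simp

/-- Quasitriangularity in terms of the three legs. -/
theorem isQuasitriangular_of_legs (Δ : K →ₐ[k] K ⊗[k] K) (hu : IsUnit R)
    (hl : ∀ p : K →ₐ[k] K ⊗[k] (K ⊗[k] K), (∀ x, p x = legs (fst₃ k K) (snd₃ k K) (Δ x)) →
      legs p (trd₃ k K) R = legs (fst₃ k K) (trd₃ k K) R * legs (snd₃ k K) (trd₃ k K) R)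
    (hr : ∀ p : K →ₐ[k] K ⊗[k] (K ⊗[k] K), (∀ x, p x = legs (snd₃ k K) (trd₃ k K) (Δ x)) →
      legs (fst₃ k K) p R = legs (fst₃ k K) (trd₃ k K) R * legs (fst₃ k K) (snd₃ k K) R)
    (hs : ∀ x, swap (Δ x) * R = R * Δ x) : IsQuasitriangular Δ.toLinearMap R where
  isUnit := hu
  comul_left := by
    rw [assoc_rTensor_eq_legs, hl _ (comulFirst_apply Δ), leg₁₃_eq, leg₂₃_eq]
  comul_right := by
    rw [lTensor_eq_legs, hr _ (incr_comp_apply Δ), leg₁₃_eq, leg₁₂_eq]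
  comul_swap x := by
    rw [AlgHom.toLinearMap_apply, ← hs, mul_assoc, Ring.mul_inverse_cancel R hu, mul_one]

/-- `R₂₁⁻¹` is a second quasitriangular structure. -/
theorem IsQuasitriangular.swap_inverse {Δ : K →ₐ[k] K ⊗[k] K}
    (hR : IsQuasitriangular Δ.toLinearMap R) :
    IsQuasitriangular Δ.toLinearMap (swap (Ring.inverse R)) := by
  refine isQuasitriangular_of_legs Δ (isUnit_swap hR.isUnit.ringInverse) (fun p hp => ?_)
    (fun p hp => ?_) (fun x => ?_)
  · rw [legs_swap (commutingLegs_of_apply hp comm₁₃ comm₂₃), legs_swap comm₁₃, legs_swap comm₂₃,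
      hR.legs_right_inverse hp comm₁₂ comm₁₃.symm comm₂₃.symm]
  · rw [legs_swap (commutingLegs_of_apply hp comm₁₂.symm comm₁₃.symm).symm, legs_swap comm₁₃,
      legs_swap comm₁₂, hR.legs_left_inverse hp comm₂₃ comm₁₂.symm comm₁₃.symm]
  · have h := hR.swap_mul_eq x
    have h2 : Δ x * Ring.inverse R = Ring.inverse R * swap (Δ x) := by
      have h3 := congrArg (fun t => Ring.inverse R * t * Ring.inverse R) h
      simp only [AlgHom.toLinearMap_apply] at h3
      rw [← mul_assoc, mul_assoc, Ring.mul_inverse_cancel R hR.isUnit, mul_one, ← mul_assoc,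
        Ring.inverse_mul_cancel R hR.isUnit, one_mul] at h3
      exact h3.symm
    rw [← swap_mul, h2, swap_mul, swap_swap]

/-- The opposite coproduct. -/
def copComul (Δ : K →ₐ[k] K ⊗[k] K) : K →ₐ[k] K ⊗[k] K :=
  (Algebra.TensorProduct.comm k K K).toAlgHom.comp Δ

theorem copComul_apply (Δ : K →ₐ[k] K ⊗[k] K) (x : K) : copComul Δ x = swap (Δ x) := rfl

/-- `R⁻¹` is a quasitriangular structure for the opposite coproduct. -/
theorem IsQuasitriangular.cop_inverse {Δ : K →ₐ[k] K ⊗[k] K}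
    (hR : IsQuasitriangular Δ.toLinearMap R) :
    IsQuasitriangular (copComul Δ).toLinearMap (Ring.inverse R) := by
  refine isQuasitriangular_of_legs (copComul Δ) hR.isUnit.ringInverse (fun p hp => ?_)
    (fun p hp => ?_) (fun x => ?_)
  · exact hR.legs_left_inverse (fun x => by rw [hp, copComul_apply, legs_swap comm₁₂]; rfl)
      comm₁₂.symm comm₂₃ comm₁₃
  · exact hR.legs_right_inverse (fun x => by rw [hp, copComul_apply, legs_swap comm₂₃]; rfl)
      comm₂₃.symm comm₁₃ comm₁₂
  · have h := hR.comul_swap x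
    simp only [AlgHom.toLinearMap_apply] at h
    rw [copComul_apply, swap_swap, h, ← mul_assoc, ← mul_assoc,
      Ring.inverse_mul_cancel R hR.isUnit, one_mul]

/-- `R₂₁` is a quasitriangular structure for the opposite coproduct. -/
theorem IsQuasitriangular.cop_swap {Δ : K →ₐ[k] K ⊗[k] K}
    (hR : IsQuasitriangular Δ.toLinearMap R) :
    IsQuasitriangular (copComul Δ).toLinearMap (swap R) := by
  have h := hR.swap_inverse.cop_inverse
  rwa [QuantumDouble.swap_inverse hR.isUnit.ringInverse, inverse_inverse hR.isUnit] at h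

theorem legs_quad₁₃ (f g : K ⊗[k] K →ₐ[k] X) (t : K ⊗[k] K) :
    legs f g (quad₁₃ t) = legs (f.comp (incl k K K)) (g.comp (incl k K K)) t := by
  simp only [quad₁₃]
  induction t with
  | zero => simp
  | add s t hs ht => simp only [map_add, hs, ht]
  | tmul x y => simp [inl]

theorem legs_quad₂₃ (f g : K ⊗[k] K →ₐ[k] X) (t : K ⊗[k] K) :
    legs f g (quad₂₃ t) = legs (f.comp (incr k K K)) (g.comp (incl k K K)) t := by
  simp only [quad₂₃]
  induction t with
  | zero => simp
  | add s t hs ht => simp only [map_add, hs, ht]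
  | tmul x y => simp [inl, inr]

theorem legs_quad₂₄ (f g : K ⊗[k] K →ₐ[k] X) (t : K ⊗[k] K) :
    legs f g (quad₂₄ t) = legs (f.comp (incr k K K)) (g.comp (incr k K K)) t := by
  simp only [quad₂₄]
  induction t with
  | zero => simp
  | add s t hs ht => simp only [map_add, hs, ht]
  | tmul x y => simp [inr]

theorem legs_incl_incr {L : Type*} [Ring L] [Algebra k L] (t : K ⊗[k] L) :
    legs (incl k K L) (incr k K L) t = t := by
  induction t with
  | zero => simp
  | add s t hs ht => simp only [map_add, hs, ht]
  | tmul x y => simp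

variable (k K) in
/-- The first leg of `(K ⊗ K) ⊗ (K ⊗ K)`. -/
abbrev quadFst : K →ₐ[k] (K ⊗[k] K) ⊗[k] (K ⊗[k] K) := (incl k _ _).comp (incl k K K)

variable (k K) in
/-- The second leg of `(K ⊗ K) ⊗ (K ⊗ K)`. -/
abbrev quadSnd : K →ₐ[k] (K ⊗[k] K) ⊗[k] (K ⊗[k] K) := (incl k _ _).comp (incr k K K)

variable (k K) in
/-- The third leg of `(K ⊗ K) ⊗ (K ⊗ K)`. -/
abbrev quadTrd : K →ₐ[k] (K ⊗[k] K) ⊗[k] (K ⊗[k] K) := (incr k _ _).comp (incl k K K)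

variable (k K) in
/-- The fourth leg of `(K ⊗ K) ⊗ (K ⊗ K)`. -/
abbrev quadFth : K →ₐ[k] (K ⊗[k] K) ⊗[k] (K ⊗[k] K) := (incr k _ _).comp (incr k K K)

theorem quad₁₃_eq (t : K ⊗[k] K) : quad₁₃ t = legs (quadFst k K) (quadTrd k K) t := by
  rw [← legs_quad₁₃, legs_incl_incr]

theorem quad₂₃_eq (t : K ⊗[k] K) : quad₂₃ t = legs (quadSnd k K) (quadTrd k K) t := by
  rw [← legs_quad₂₃, legs_incl_incr]

theorem quad₂₄_eq (t : K ⊗[k] K) : quad₂₄ t = legs (quadSnd k K) (quadFth k K) t := by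
  rw [← legs_quad₂₄, legs_incl_incr]

/-- The coproduct of the tensor product of two bialgebra structures on `K`. -/
def tensorComul (Δ₁ Δ₂ : K →ₐ[k] K ⊗[k] K) : K ⊗[k] K →ₐ[k] (K ⊗[k] K) ⊗[k] (K ⊗[k] K) :=
  (Algebra.TensorProduct.tensorTensorTensorComm k k k k K K K K).toAlgHom.comp
    (Algebra.TensorProduct.map Δ₁ Δ₂)

theorem tensorComul_tmul (Δ₁ Δ₂ : K →ₐ[k] K ⊗[k] K) (x y : K) :
    tensorComul Δ₁ Δ₂ (x ⊗ₜ y) = quad₁₃ (Δ₁ x) * quad₂₄ (Δ₂ y) := by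
  simp only [tensorComul, AlgHom.comp_apply, Algebra.TensorProduct.map_tmul]
  induction Δ₁ x with
  | zero => simp [quad₁₃]
  | add s t hs ht => simp only [quad₁₃, map_add, add_mul, TensorProduct.add_tmul] at *; rw [hs, ht]
  | tmul x x' =>
    induction Δ₂ y with
    | zero => simp [quad₂₄]
    | add s t hs ht =>
      simp only [quad₂₄, map_add, mul_add, TensorProduct.tmul_add] at *
      rw [hs, ht]
    | tmul y y' => simp [quad₁₃, quad₂₄, inl, inr]

theorem quad₁₃_one : quad₁₃ (1 : K ⊗[k] K) = 1 := by rw [quad₁₃_eq, legs_one]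

theorem quad₂₄_one : quad₂₄ (1 : K ⊗[k] K) = 1 := by rw [quad₂₄_eq, legs_one]

theorem tensorComul_incl (Δ₁ Δ₂ : K →ₐ[k] K ⊗[k] K) (x : K) :
    tensorComul Δ₁ Δ₂ (incl k K K x) = quad₁₃ (Δ₁ x) := by
  rw [Algebra.TensorProduct.includeLeft_apply, tensorComul_tmul, map_one, quad₂₄_one, mul_one]

theorem tensorComul_incr (Δ₁ Δ₂ : K →ₐ[k] K ⊗[k] K) (x : K) :
    tensorComul Δ₁ Δ₂ (incr k K K x) = quad₂₄ (Δ₂ x) := by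
  rw [Algebra.TensorProduct.includeRight_apply, tensorComul_tmul, map_one, quad₁₃_one, one_mul]

theorem quad₁₃_mul (s t : K ⊗[k] K) : quad₁₃ (s * t) = quad₁₃ s * quad₁₃ t := by
  simp only [quad₁₃_eq]
  exact legs_mul (commutingLegs_incl_incr.comp _ _) s t

theorem quad₂₄_mul (s t : K ⊗[k] K) : quad₂₄ (s * t) = quad₂₄ s * quad₂₄ t := by
  simp only [quad₂₄_eq]
  exact legs_mul (commutingLegs_incl_incr.comp _ _) s t

theorem commute_quad₁₃_quad₂₄ (s t : K ⊗[k] K) : Commute (quad₁₃ s) (quad₂₄ t) := by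
  rw [quad₁₃_eq, quad₂₄_eq]
  exact commute_legs_legs (commutingLegs_incl_incr.map _) (commutingLegs_incl_incr.comp _ _)
    (commutingLegs_incl_incr.symm.comp _ _) (commutingLegs_incl_incr.map _) s t

theorem isUnit_quad₁₃ {t : K ⊗[k] K} (h : IsUnit t) : IsUnit (quad₁₃ t) := by
  rw [quad₁₃_eq, ← lift_eq_legs _ _ (commutingLegs_incl_incr.comp _ _)]
  exact h.map _

theorem isUnit_quad₂₃ {t : K ⊗[k] K} (h : IsUnit t) : IsUnit (quad₂₃ t) := by
  rw [quad₂₃_eq, ← lift_eq_legs _ _ (commutingLegs_incl_incr.comp _ _)]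
  exact h.map _

theorem isUnit_quad₂₄ {t : K ⊗[k] K} (h : IsUnit t) : IsUnit (quad₂₄ t) := by
  rw [quad₂₄_eq, ← lift_eq_legs _ _ (commutingLegs_incl_incr.comp _ _)]
  exact h.map _

theorem swap_quad₁₃ (t : K ⊗[k] K) : swap (quad₁₃ t) = quad₁₃ (swap t) := by
  simp only [swap, quad₁₃]
  induction t with
  | zero => simp
  | add s t hs ht => simp only [map_add, hs, ht]
  | tmul x y => simp

theorem swap_quad₂₄ (t : K ⊗[k] K) : swap (quad₂₄ t) = quad₂₄ (swap t) := by
  simp only [swap, quad₂₄]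
  induction t with
  | zero => simp
  | add s t hs ht => simp only [map_add, hs, ht]
  | tmul x y => simp

/-- The tensor product of two quasitriangular structures. -/
theorem IsQuasitriangular.tensor {Δ₁ Δ₂ : K →ₐ[k] K ⊗[k] K} {u v : K ⊗[k] K}
    (hu : IsQuasitriangular Δ₁.toLinearMap u) (hv : IsQuasitriangular Δ₂.toLinearMap v) :
    IsQuasitriangular (tensorComul Δ₁ Δ₂).toLinearMap (quad₁₃ u * quad₂₄ v) := by
  have hi : CommutingLegs (incl k K K) (incr k K K) := commutingLegs_incl_incr
  refine isQuasitriangular_of_legs _ ((isUnit_quad₁₃ hu.isUnit).mul (isUnit_quad₂₄ hv.isUnit))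
    (fun p hp => ?_) (fun p hp => ?_) (fun x => ?_)
  · have hp₁ : ∀ x, p.comp (incl k K K) x = legs ((fst₃ k (K ⊗[k] K)).comp (incl k K K))
        ((snd₃ k (K ⊗[k] K)).comp (incl k K K)) (Δ₁ x) := fun x => by
      rw [AlgHom.comp_apply, hp, tensorComul_incl, legs_quad₁₃]
    have hp₂ : ∀ x, p.comp (incr k K K) x = legs ((fst₃ k (K ⊗[k] K)).comp (incr k K K))
        ((snd₃ k (K ⊗[k] K)).comp (incr k K K)) (Δ₂ x) := fun x => by
      rw [AlgHom.comp_apply, hp, tensorComul_incr, legs_quad₂₄]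
    rw [legs_mul (commutingLegs_of_apply hp comm₁₃ comm₂₃), legs_mul comm₁₃, legs_mul comm₂₃]
    simp only [legs_quad₁₃, legs_quad₂₄]
    rw [hu.legs_left hp₁ (comm₁₂.comp _ _) (comm₁₃.comp _ _) (comm₂₃.comp _ _),
      hv.legs_left hp₂ (comm₁₂.comp _ _) (comm₁₃.comp _ _) (comm₂₃.comp _ _)]
    refine Commute.mul_mul_mul_comm ?_ _ _
    exact commute_legs_legs (comm₁₂.symm.comp _ _) (comm₂₃.comp _ _) (comm₁₃.symm.comp _ _)
      (hi.map _) _ _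
  · have hp₁ : ∀ x, p.comp (incl k K K) x = legs ((snd₃ k (K ⊗[k] K)).comp (incl k K K))
        ((trd₃ k (K ⊗[k] K)).comp (incl k K K)) (Δ₁ x) := fun x => by
      rw [AlgHom.comp_apply, hp, tensorComul_incl, legs_quad₁₃]
    have hp₂ : ∀ x, p.comp (incr k K K) x = legs ((snd₃ k (K ⊗[k] K)).comp (incr k K K))
        ((trd₃ k (K ⊗[k] K)).comp (incr k K K)) (Δ₂ x) := fun x => by
      rw [AlgHom.comp_apply, hp, tensorComul_incr, legs_quad₂₄]
    rw [legs_mul (commutingLegs_of_apply hp comm₁₂.symm comm₁₃.symm).symm, legs_mul comm₁₃,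
      legs_mul comm₁₂]
    simp only [legs_quad₁₃, legs_quad₂₄]
    rw [hu.legs_right hp₁ (comm₂₃.comp _ _) (comm₁₂.comp _ _) (comm₁₃.comp _ _),
      hv.legs_right hp₂ (comm₂₃.comp _ _) (comm₁₂.comp _ _) (comm₁₃.comp _ _)]
    refine Commute.mul_mul_mul_comm ?_ _ _
    exact commute_legs_legs (hi.map _) (comm₁₃.comp _ _) (comm₁₂.symm.comp _ _)
      (comm₂₃.comp _ _) _ _
  · induction x with
    | zero => simp [swap]
    | add s t hs ht => simp only [swap, map_add, mul_add, add_mul] at *; rw [hs, ht]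
    | tmul x y =>
      have h₁ := hu.swap_mul_eq x
      have h₂ := hv.swap_mul_eq y
      simp only [AlgHom.toLinearMap_apply] at h₁ h₂
      rw [tensorComul_tmul, swap_mul, swap_quad₁₃, swap_quad₂₄,
        (commute_quad₁₃_quad₂₄ u (swap (Δ₂ y))).symm.mul_mul_mul_comm, ← quad₁₃_mul, ← quad₂₄_mul,
        h₁, h₂, quad₁₃_mul, quad₂₄_mul,
        (commute_quad₁₃_quad₂₄ (Δ₁ x) v).mul_mul_mul_comm]

end Structures

/-! ### Antipodes, and finiteness under factorisability -/

section Antipode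

variable {k H X : Type*} [Field k] [Ring H] [HopfAlgebra k H] [Ring X] [Algebra k X]
  {R : H ⊗[k] H}

local notation "S" => HopfAlgebra.antipode k

theorem IsQuasitriangular.comulAlgHom (hR : IsQuasitriangular Coalgebra.comul R) :
    IsQuasitriangular (Bialgebra.comulAlgHom k H).toLinearMap R := by
  have : (Bialgebra.comulAlgHom k H).toLinearMap = Coalgebra.comul := LinearMap.ext fun _ => rfl
  rwa [this]

theorem IsQuasitriangular.comul_swap_inverse (hR : IsQuasitriangular Coalgebra.comul R) :
    IsQuasitriangular (Coalgebra.comul (R := k) (A := H)) (swap (Ring.inverse R)) := by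
  have : (Bialgebra.comulAlgHom k H).toLinearMap = Coalgebra.comul := LinearMap.ext fun _ => rfl
  exact this ▸ hR.comulAlgHom.swap_inverse

variable (k H X) in
/-- The trivial leg `h ↦ ε(h) 1`. -/
def trivLeg : H →ₐ[k] X := (Algebra.ofId k X).comp (Bialgebra.counitAlgHom k H)

theorem trivLeg_apply (x : H) : trivLeg k H X x = algebraMap k X (Coalgebra.counit x) := rfl

theorem legs_trivLeg_left (g : H →ₐ[k] X) (t : H ⊗[k] H) : legs (trivLeg k H X) g t =
    g (TensorProduct.lid k H (Coalgebra.counit.rTensor H t)) := by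
  induction t with
  | zero => simp
  | add s t hs ht => simp only [map_add, hs, ht]
  | tmul x y => simp [trivLeg_apply, Algebra.smul_def]

/-- `(ε ⊗ id) R = 1`: with a trivial leg, `(Δ ⊗ id) R = R₁₃ R₂₃` reads `R = ((ε ⊗ id) R)₂ R`, and
`R` is invertible. -/
theorem IsQuasitriangular.counit_left (hR : IsQuasitriangular Coalgebra.comul R) :
    TensorProduct.lid k H (Coalgebra.counit.rTensor H R) = 1 := by
  have hc : CommutingLegs (incl k H H) (incr k H H) := commutingLegs_incl_incr
  have hp : ∀ x, incl k H H x = legs (trivLeg k H _) (incl k H H) (Coalgebra.comul x) := fun x => by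
    rw [legs_trivLeg_left, Coalgebra.rTensor_counit_comul]; simp
  have ht : ∀ {f : H →ₐ[k] H ⊗[k] H}, CommutingLegs (trivLeg k H _) f := fun {f} x y => by
    rw [trivLeg_apply]
    exact Algebra.commute_algebraMap_left _ _
  have h := hR.legs_left hp ht ht hc
  have h2 : legs (trivLeg k H _) (incr k H H) R = 1 := by
    have h3 := congrArg (fun t => t * Ring.inverse R) h
    simp only [legs_incl_incr, mul_assoc, Ring.mul_inverse_cancel R hR.isUnit, mul_one] at h3
    exact h3.symm
  rw [legs_trivLeg_left] at h2
  have h4 := congrArg (fun t => TensorProduct.lid k H (Coalgebra.counit.rTensor H t)) h2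
  simpa [Algebra.TensorProduct.one_def] using h4

/-- `(S ⊗ id) R = R⁻¹`. -/
theorem IsQuasitriangular.antipode_left (hR : IsQuasitriangular Coalgebra.comul R) :
    (S).rTensor H R = Ring.inverse R := by
  let m : H ⊗[k] (H ⊗[k] H) →ₗ[k] H ⊗[k] H :=
    (LinearMap.mul' k H ∘ₗ (S).rTensor H).rTensor H ∘ₗ
      (TensorProduct.assoc k H H H).symm.toLinearMap
  have h1 : ∀ s t : H ⊗[k] H, m (leg₁₃ s * leg₂₃ t) = (S).rTensor H s * t := by
    intro s t
    induction s with
    | zero => simp [leg₁₃]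
    | add s s' hs hs' => simp only [leg₁₃, map_add, add_mul] at *; rw [hs, hs']
    | tmul x y =>
      induction t with
      | zero => simp [leg₂₃]
      | add s t hs ht => simp only [leg₂₃, map_add, mul_add] at *; rw [hs, ht]
      | tmul u v => simp [m, leg₁₃, leg₂₃, inr]
  have h2 := congrArg m hR.comul_left
  rw [h1] at h2
  simp only [m, LinearMap.comp_apply, LinearEquiv.coe_coe, LinearEquiv.symm_apply_apply] at h2
  rw [← LinearMap.rTensor_comp_apply, LinearMap.comp_assoc,
    HopfAlgebra.mul_antipode_rTensor_comul] at h2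
  have h3 : ∀ t : H ⊗[k] H, (Algebra.linearMap k H ∘ₗ Coalgebra.counit).rTensor H t =
      1 ⊗ₜ (TensorProduct.lid k H (Coalgebra.counit.rTensor H t)) := by
    intro t
    induction t with
    | zero => simp
    | add s t hs ht => simp only [map_add, TensorProduct.tmul_add, hs, ht]
    | tmul x y => simp [Algebra.algebraMap_eq_smul_one, TensorProduct.smul_tmul]
  rw [h3, hR.counit_left] at h2
  exact (ring_inverse_eq_of_mul_eq_one h2.symm hR.isUnit).symm

theorem rTensor_swap (f : H →ₗ[k] H) (t : H ⊗[k] H) :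
    f.rTensor H (swap t) = swap (f.lTensor H t) := by
  simp only [swap]
  induction t with
  | zero => simp
  | add s t hs ht => simp only [map_add, hs, ht]
  | tmul x y => simp

/-- `(id ⊗ S) R⁻¹ = R`. -/
theorem IsQuasitriangular.antipode_right (hR : IsQuasitriangular Coalgebra.comul R) :
    (S).lTensor H (Ring.inverse R) = R := by
  have h := hR.comul_swap_inverse.antipode_left
  rw [rTensor_swap, QuantumDouble.swap_inverse hR.isUnit.ringInverse,
    inverse_inverse hR.isUnit] at h
  simpa using congrArg swap h

theorem map_antipode_mul (s t : H ⊗[k] H) : TensorProduct.map (S) (S) (s * t) =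
    TensorProduct.map (S) (S) t * TensorProduct.map (S) (S) s := by
  induction s with
  | zero => simp
  | add s s' hs hs' => simp only [map_add, add_mul, mul_add, hs, hs']
  | tmul x y =>
    induction t with
    | zero => simp
    | add s t hs ht => simp only [map_add, add_mul, mul_add, hs, ht]
    | tmul u v => simp [HopfAlgebra.antipode_mul_antidistrib]

/-- `(S ⊗ S) R = R`. -/
theorem IsQuasitriangular.map_antipode (hR : IsQuasitriangular Coalgebra.comul R) :
    TensorProduct.map (S) (S) R = R := by
  rw [← LinearMap.lTensor_comp_rTensor, LinearMap.comp_apply, hR.antipode_left, hR.antipode_right]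

theorem map_swap (f g : H →ₗ[k] H) (t : H ⊗[k] H) :
    TensorProduct.map f g (swap t) = swap (TensorProduct.map g f t) := by
  simp only [swap]
  induction t with
  | zero => simp
  | add s t hs ht => simp only [map_add, hs, ht]
  | tmul x y => simp

/-- `(S ⊗ S) Q = Q₂₁`. -/
theorem IsQuasitriangular.map_antipode_quantumKilling
    (hR : IsQuasitriangular Coalgebra.comul R) :
    TensorProduct.map (S) (S) (quantumKilling R) = swap (quantumKilling R) := by
  rw [quantumKilling, map_antipode_mul, map_swap, hR.map_antipode, swap_mul, swap_swap]

end Antipode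

section Factorisable

variable {k H A : Type*} [Field k] [Ring H] [HopfAlgebra k H] [Ring A] [HopfAlgebra k A]
  (P : HopfPairing k H A) {R : H ⊗[k] H}

theorem contractLeft_apply (t : H ⊗[k] H) (a : A) : contractLeft P t a =
    TensorProduct.lid k H ((P.form a).rTensor H t) := rfl

theorem contractRight_apply (t : H ⊗[k] H) (a : A) : contractRight P t a =
    TensorProduct.rid k H ((P.form a).lTensor H t) := rfl

theorem contractRight_eq (t : H ⊗[k] H) (a : A) :
    contractRight P t a = contractLeft P (swap t) a := by
  rw [contractRight_apply, contractLeft_apply, swap]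
  induction t with
  | zero => simp
  | add s t hs ht => simp only [map_add, hs, ht]
  | tmul x y => simp

/-- The left and the right contraction of `t` are transposes of each other. -/
theorem form_contractRight (t : H ⊗[k] H) (a b : A) :
    P.form b (contractRight P t a) = P.form a (contractLeft P t b) := by
  rw [contractRight_apply, contractLeft_apply]
  induction t with
  | zero => simp
  | add s t hs ht => simp only [map_add, hs, ht]
  | tmul x y => simp [mul_comm]

/-- Conjugating a contraction by the antipodes applies `S ⊗ S` to the contracted tensor. -/
theorem contractLeft_antipode (t : H ⊗[k] H) (a : A) :
    HopfAlgebra.antipode k (contractLeft P t (HopfAlgebra.antipode k a)) =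
      contractLeft P (TensorProduct.map (HopfAlgebra.antipode k) (HopfAlgebra.antipode k) t) a := by
  rw [contractLeft_apply, contractLeft_apply]
  induction t with
  | zero => simp
  | add s t hs ht => simp only [map_add, hs, ht]
  | tmul x y => simp [P.antipode_right]

/-- A contraction of a tensor has finite rank. -/
theorem exists_finite_contractLeft_mem (t : H ⊗[k] H) :
    ∃ W : Submodule k H, Module.Finite k W ∧ ∀ a, contractLeft P t a ∈ W := by
  induction t with
  | zero => exact ⟨⊥, inferInstance, fun a => by simp [contractLeft_apply]⟩
  | add s t hs ht =>
    obtain ⟨U, hU, hs⟩ := hs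
    obtain ⟨V, hV, ht⟩ := ht
    refine ⟨U ⊔ V, Submodule.finite_sup U V, fun a => ?_⟩
    have : contractLeft P (s + t) a = contractLeft P s a + contractLeft P t a := by
      simp [contractLeft_apply]
    rw [this]
    exact Submodule.add_mem_sup (hs a) (ht a)
  | tmul x y =>
    exact ⟨Submodule.span k {y}, inferInstance, fun a => by
      simpa [contractLeft_apply] using
        Submodule.smul_mem _ _ (Submodule.mem_span_singleton_self y)⟩

variable {P} (hP : P.form.Nondegenerate) (hR : IsQuasitriangular Coalgebra.comul R)
  (hQ : Function.Bijective (killingMap P R))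

include hQ in
/-- Factorisability forces `H` to be finite-dimensional: the map `Q` is onto and of finite rank. -/
theorem finite_of_factorisable : Module.Finite k H := by
  obtain ⟨W, hW, h⟩ := exists_finite_contractLeft_mem P (quantumKilling R)
  have : W = ⊤ := eq_top_iff.mpr fun x _ => by
    obtain ⟨a, rfl⟩ := hQ.surjective x
    exact h a
  subst this
  exact Module.Finite.equiv Submodule.topEquiv

include hP hQ in
/-- The transpose `a ↦ Q¹ ⟨a, Q²⟩` of the map `Q` is bijective. -/
theorem bijective_contractRight_quantumKilling :
    Function.Bijective (contractRight P (quantumKilling R)) := by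
  have := finite_of_factorisable hQ
  let e := LinearEquiv.ofBijective (killingMap P R) hQ
  have : Module.Finite k A := Module.Finite.equiv e.symm
  have h1 : Function.Injective (contractRight P (quantumKilling R)) := by
    refine (injective_iff_map_eq_zero _).mpr fun a ha => hP.1 a fun h => ?_
    obtain ⟨b, rfl⟩ := hQ.surjective h
    have := form_contractRight P (quantumKilling R) a b
    rw [ha, map_zero] at this
    exact this.symm
  exact ⟨h1, (LinearMap.injective_iff_surjective_of_finrank_eq_finrank e.finrank_eq).mp h1⟩

include hR in
/-- `S ∘ Q ∘ S` is the transpose of `Q`, because `(S ⊗ S) Q = Q₂₁`. -/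
theorem antipode_killingMap_antipode (a : A) :
    HopfAlgebra.antipode k (killingMap P R (HopfAlgebra.antipode k a)) =
      contractRight P (quantumKilling R) a := by
  rw [killingMap, contractLeft_antipode, hR.map_antipode_quantumKilling, contractRight_eq]

include hP hR hQ in
/-- The antipode of `H` is onto, since the bijective transpose of `Q` factors through it, hence
bijective in finite dimension. -/
theorem bijective_antipode : Function.Bijective (HopfAlgebra.antipode k (A := H)) := by
  have := finite_of_factorisable hQ
  have h := bijective_contractRight_quantumKilling hP hQ
  have hs : Function.Surjective (HopfAlgebra.antipode k (A := H)) := fun x => by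
    obtain ⟨a, rfl⟩ := h.surjective x
    exact ⟨_, antipode_killingMap_antipode hR a⟩
  exact ⟨LinearMap.injective_iff_surjective.mpr hs, hs⟩

include hP hR hQ in
/-- The antipode of `A` is one-to-one, since the bijective transpose of `Q` factors through it,
hence bijective in finite dimension. -/
theorem bijective_antipode_dual : Function.Bijective (HopfAlgebra.antipode k (A := A)) := by
  have := finite_of_factorisable hQ
  have : Module.Finite k A := Module.Finite.equiv (LinearEquiv.ofBijective (killingMap P R) hQ).symm
  have h := bijective_contractRight_quantumKilling hP hQ
  have hs : Function.Injective (HopfAlgebra.antipode k (A := A)) := fun a b hab => h.injective <| by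
    rw [← antipode_killingMap_antipode hR, hab, antipode_killingMap_antipode hR]
  exact ⟨hs, LinearMap.injective_iff_surjective.mp hs⟩

end Factorisable

/-! ### Isomorphisms and twists of Hopf algebras and covariant systems -/

section Transport

variable {k K L : Type*} [Field k] [Ring K] [Algebra k K] [Ring L] [Algebra k L]

/-- `θ ⊗ θ` as an algebra map. -/
abbrev mapTwo (θ : K ≃ₐ[k] L) : K ⊗[k] K →ₐ[k] L ⊗[k] L :=
  Algebra.TensorProduct.map θ.toAlgHom θ.toAlgHom

/-- `θ ⊗ θ ⊗ θ` as an algebra map. -/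
abbrev mapThree (θ : K ≃ₐ[k] L) : K ⊗[k] (K ⊗[k] K) →ₐ[k] L ⊗[k] (L ⊗[k] L) :=
  Algebra.TensorProduct.map θ.toAlgHom (mapTwo θ)

theorem mapTwo_eq (θ : K ≃ₐ[k] L) (t : K ⊗[k] K) :
    TensorProduct.map θ.toLinearMap θ.toLinearMap t = mapTwo θ t := rfl

theorem mapThree_leg₁₂ (θ : K ≃ₐ[k] L) (t : K ⊗[k] K) :
    mapThree θ (leg₁₂ t) = leg₁₂ (mapTwo θ t) := by
  simp only [leg₁₂]
  induction t with
  | zero => simp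
  | add s t hs ht => simp only [map_add, hs, ht]
  | tmul x y => simp [inl]

theorem mapThree_leg₁₃ (θ : K ≃ₐ[k] L) (t : K ⊗[k] K) :
    mapThree θ (leg₁₃ t) = leg₁₃ (mapTwo θ t) := by
  simp only [leg₁₃]
  induction t with
  | zero => simp
  | add s t hs ht => simp only [map_add, hs, ht]
  | tmul x y => simp [inr]

theorem mapThree_leg₂₃ (θ : K ≃ₐ[k] L) (t : K ⊗[k] K) :
    mapThree θ (leg₂₃ t) = leg₂₃ (mapTwo θ t) := by
  simp [leg₂₃]

theorem mapTwo_swap (θ : K ≃ₐ[k] L) (t : K ⊗[k] K) :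
    swap (mapTwo θ t) = mapTwo θ (swap t) := by
  simp only [swap]
  induction t with
  | zero => simp
  | add s t hs ht => simp only [map_add, hs, ht]
  | tmul x y => simp

theorem map_inverse {M N : Type*} [Ring M] [Algebra k M] [Ring N] [Algebra k N] (φ : M →ₐ[k] N)
    {x : M} (hx : IsUnit x) : Ring.inverse (φ x) = φ (Ring.inverse x) :=
  ring_inverse_eq_of_mul_eq_one (by rw [← map_mul, Ring.inverse_mul_cancel x hx, map_one])
    (hx.map φ)

variable {Δ : K →ₗ[k] K ⊗[k] K} {ε : K →ₗ[k] k} {Δ' : L →ₗ[k] L ⊗[k] L} {ε' : L →ₗ[k] k}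
  {θ : K ≃ₐ[k] L}

theorem mapThree_rTensor (hΔ : ∀ x, mapTwo θ (Δ x) = Δ' (θ x)) (t : K ⊗[k] K) :
    TensorProduct.assoc k L L L (Δ'.rTensor L (mapTwo θ t)) =
      mapThree θ (TensorProduct.assoc k K K K (Δ.rTensor K t)) := by
  induction t with
  | zero => simp
  | add s t hs ht => simp only [map_add, hs, ht]
  | tmul x y =>
    simp only [Algebra.TensorProduct.map_tmul, LinearMap.rTensor_tmul, AlgEquiv.toAlgHom_apply,
      ← hΔ]
    induction Δ x with
    | zero => simp
    | add s t hs ht => simp only [map_add, TensorProduct.add_tmul, hs, ht]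
    | tmul u v => simp

theorem mapThree_lTensor (hΔ : ∀ x, mapTwo θ (Δ x) = Δ' (θ x)) (t : K ⊗[k] K) :
    Δ'.lTensor L (mapTwo θ t) = mapThree θ (Δ.lTensor K t) := by
  induction t with
  | zero => simp
  | add s t hs ht => simp only [map_add, hs, ht]
  | tmul x y => simp [← hΔ]

theorem rTensor_counit_mapTwo (hε : ∀ x, ε' (θ x) = ε x) (t : K ⊗[k] K) :
    TensorProduct.lid k L (ε'.rTensor L (mapTwo θ t)) =
      θ (TensorProduct.lid k K (ε.rTensor K t)) := by
  induction t with
  | zero => simp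
  | add s t hs ht => simp only [map_add, hs, ht]
  | tmul x y => simp [hε]

theorem lTensor_counit_mapTwo (hε : ∀ x, ε' (θ x) = ε x) (t : K ⊗[k] K) :
    TensorProduct.rid k L (ε'.lTensor L (mapTwo θ t)) =
      θ (TensorProduct.rid k K (ε.lTensor K t)) := by
  induction t with
  | zero => simp
  | add s t hs ht => simp only [map_add, hs, ht]
  | tmul x y => simp [hε]

/-- Antipodes are carried over by isomorphisms of bialgebras. -/
theorem IsAntipode.transport (hΔ : ∀ x, mapTwo θ (Δ x) = Δ' (θ x)) (hε : ∀ x, ε' (θ x) = ε x)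
    {S : K →ₗ[k] K} (hS : IsAntipode Δ ε S) :
    IsAntipode Δ' ε' (θ.toLinearMap ∘ₗ S ∘ₗ θ.symm.toLinearMap) where
  left := by
    ext y
    obtain ⟨x, rfl⟩ := θ.surjective y
    have h1 : ∀ t : K ⊗[k] K, LinearMap.mul' k L
        ((θ.toLinearMap ∘ₗ S ∘ₗ θ.symm.toLinearMap).rTensor L (mapTwo θ t)) =
        θ (LinearMap.mul' k K (S.rTensor K t)) := by
      intro t
      induction t with
      | zero => simp
      | add s t hs ht => simp only [map_add, hs, ht]
      | tmul x y => simp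
    have h2 := LinearMap.congr_fun hS.left x
    simp only [LinearMap.comp_apply] at h2 ⊢
    rw [← hΔ, h1, h2, hε]
    simp
  right := by
    ext y
    obtain ⟨x, rfl⟩ := θ.surjective y
    have h1 : ∀ t : K ⊗[k] K, LinearMap.mul' k L
        ((θ.toLinearMap ∘ₗ S ∘ₗ θ.symm.toLinearMap).lTensor L (mapTwo θ t)) =
        θ (LinearMap.mul' k K (S.lTensor K t)) := by
      intro t
      induction t with
      | zero => simp
      | add s t hs ht => simp only [map_add, hs, ht]
      | tmul x y => simp
    have h2 := LinearMap.congr_fun hS.right x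
    simp only [LinearMap.comp_apply] at h2 ⊢
    rw [← hΔ, h1, h2, hε]
    simp

/-- Hopf algebra structures are carried over by isomorphisms. -/
theorem IsHopfAlgebra.transport (hΔ : ∀ x, mapTwo θ (Δ x) = Δ' (θ x))
    (hε : ∀ x, ε' (θ x) = ε x) (h : IsHopfAlgebra Δ ε) : IsHopfAlgebra Δ' ε' where
  coassoc := by
    ext y
    obtain ⟨x, rfl⟩ := θ.surjective y
    have h2 := LinearMap.congr_fun h.coassoc x
    simp only [LinearMap.comp_apply, LinearEquiv.coe_coe] at h2 ⊢
    rw [← hΔ, mapThree_rTensor hΔ, mapThree_lTensor hΔ, h2]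
  rTensor_counit := by
    ext y
    obtain ⟨x, rfl⟩ := θ.surjective y
    have h2 := LinearMap.congr_fun h.rTensor_counit x
    apply (TensorProduct.lid k L).injective
    simp only [LinearMap.comp_apply] at h2 ⊢
    rw [← hΔ, rTensor_counit_mapTwo hε, h2]
    simp
  lTensor_counit := by
    ext y
    obtain ⟨x, rfl⟩ := θ.surjective y
    have h2 := LinearMap.congr_fun h.lTensor_counit x
    apply (TensorProduct.rid k L).injective
    simp only [LinearMap.comp_apply] at h2 ⊢
    rw [← hΔ, lTensor_counit_mapTwo hε, h2]
    simp
  comul_one := by rw [← map_one θ, ← hΔ, h.comul_one, map_one]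
  comul_mul y z := by
    obtain ⟨x, rfl⟩ := θ.surjective y
    obtain ⟨w, rfl⟩ := θ.surjective z
    rw [← map_mul, ← hΔ, ← hΔ, ← hΔ, h.comul_mul, map_mul]
  counit_one := by rw [← map_one θ, hε, h.counit_one]
  counit_mul y z := by
    obtain ⟨x, rfl⟩ := θ.surjective y
    obtain ⟨w, rfl⟩ := θ.surjective z
    rw [← map_mul, hε, hε, hε, h.counit_mul]
  antipode := by
    obtain ⟨S, hS⟩ := h.antipode
    exact ⟨_, hS.transport hΔ hε⟩

/-- Quasitriangular structures are carried over by isomorphisms. -/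
theorem IsQuasitriangular.transport (hΔ : ∀ x, mapTwo θ (Δ x) = Δ' (θ x)) {R : K ⊗[k] K}
    (h : IsQuasitriangular Δ R) : IsQuasitriangular Δ' (mapTwo θ R) where
  isUnit := h.isUnit.map _
  comul_left := by
    rw [mapThree_rTensor hΔ, h.comul_left, map_mul, mapThree_leg₁₃, mapThree_leg₂₃]
  comul_right := by
    rw [mapThree_lTensor hΔ, h.comul_right, map_mul, mapThree_leg₁₃, mapThree_leg₁₂]
  comul_swap y := by
    obtain ⟨x, rfl⟩ := θ.surjective y
    rw [← hΔ, mapTwo_swap, h.comul_swap, map_mul, map_mul, map_inverse _ h.isUnit]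

/-- Twisting cocycles are carried over by isomorphisms. -/
theorem IsTwistingCocycle.transport (hΔ : ∀ x, mapTwo θ (Δ x) = Δ' (θ x))
    (hε : ∀ x, ε' (θ x) = ε x) {χ : K ⊗[k] K} (h : IsTwistingCocycle Δ ε χ) :
    IsTwistingCocycle Δ' ε' (mapTwo θ χ) where
  isUnit := h.isUnit.map _
  cocycle := by
    rw [mapThree_rTensor hΔ, mapThree_lTensor hΔ, ← mapThree_leg₁₂, ← mapThree_leg₂₃, ← map_mul,
      h.cocycle, map_mul]
  counit := by rw [rTensor_counit_mapTwo hε, h.counit, map_one]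

namespace CovariantData

variable {V W U M : Type*} [AddCommGroup V] [Module k V] [AddCommGroup W] [Module k W]
  [AddCommGroup U] [Module k U] [Ring M] [Algebra k M]
  {C : CovariantData k K V} {D : CovariantData k L W} {f : V ≃ₗ[k] W}

@[simp] theorem act₂_tmul_tmul (C : CovariantData k K V) (x y : K) (v w : V) :
    C.act₂ (x ⊗ₜ y) (v ⊗ₜ w) = C.act x v ⊗ₜ C.act y w := rfl

theorem IsIso.symm (h : C.IsIso D θ f) : D.IsIso C θ.symm f.symm where
  comul y := by
    obtain ⟨x, rfl⟩ := θ.surjective y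
    rw [← h.comul, AlgEquiv.symm_apply_apply]
    generalize C.comul x = t
    induction t with
    | zero => simp
    | add s t hs ht => simp only [map_add, hs, ht]
    | tmul x y => simp
  counit y := by
    obtain ⟨x, rfl⟩ := θ.surjective y
    rw [h.counit, AlgEquiv.symm_apply_apply]
  mul v w := by
    obtain ⟨v, rfl⟩ := f.surjective v
    obtain ⟨w, rfl⟩ := f.surjective w
    rw [← h.mul]; simp
  one := by rw [← h.one]; simp
  act y w := by
    obtain ⟨x, rfl⟩ := θ.surjective y
    obtain ⟨w, rfl⟩ := f.surjective w
    rw [← h.act]; simp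

theorem IsIso.trans {E : CovariantData k M U} {θ' : L ≃ₐ[k] M} {f' : W ≃ₗ[k] U}
    (h : C.IsIso D θ f) (h' : D.IsIso E θ' f') :
    C.IsIso E (θ.trans θ') (f.trans f') where
  comul x := by
    rw [AlgEquiv.trans_apply, ← h'.comul, ← h.comul]
    generalize C.comul x = t
    induction t with
    | zero => simp
    | add s t hs ht => simp only [map_add, hs, ht]
    | tmul x y => simp
  counit x := by rw [AlgEquiv.trans_apply, h'.counit, h.counit]
  mul v w := by simp [h.mul, h'.mul]
  one := by simp [h.one, h'.one]
  act x v := by simp [h.act, h'.act]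

theorem IsIso.map_mul (h : C.IsIso D θ f) (t : V ⊗[k] V) :
    f (C.mul t) = D.mul (TensorProduct.map f.toLinearMap f.toLinearMap t) := by
  induction t with
  | zero => simp
  | add s t hs ht => simp only [map_add, hs, ht]
  | tmul x y => simp [h.mul]

theorem IsIso.map_act₂ (h : C.IsIso D θ f) (x : K ⊗[k] K) (t : V ⊗[k] V) :
    TensorProduct.map f.toLinearMap f.toLinearMap (C.act₂ x t) =
      D.act₂ (mapTwo θ x) (TensorProduct.map f.toLinearMap f.toLinearMap t) := by
  induction x with
  | zero => simp
  | add s t hs ht => simp only [map_add, LinearMap.add_apply, hs, ht]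
  | tmul x y =>
    induction t with
    | zero => simp
    | add s t hs ht => simp only [map_add, hs, ht]
    | tmul v w => simp [h.act]

/-- Isomorphisms carry covariant systems to covariant systems. -/
theorem IsCovariantSystem.transport (hC : C.IsCovariantSystem) (h : C.IsIso D θ f) :
    D.IsCovariantSystem where
  hopf := hC.hopf.transport h.comul h.counit
  mul_assoc := by
    ext u v w
    obtain ⟨u, rfl⟩ := f.surjective u
    obtain ⟨v, rfl⟩ := f.surjective v
    obtain ⟨w, rfl⟩ := f.surjective w
    have h2 := LinearMap.congr_fun hC.mul_assoc ((u ⊗ₜ v) ⊗ₜ w)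
    simp only [LinearMap.comp_apply, LinearMap.rTensor_tmul, LinearEquiv.coe_coe,
      TensorProduct.assoc_tmul, LinearMap.lTensor_tmul] at h2
    simp [← h.mul, h2]
  one_mul v := by
    obtain ⟨v, rfl⟩ := f.surjective v
    rw [← h.one, ← h.mul, hC.one_mul]
  mul_one v := by
    obtain ⟨v, rfl⟩ := f.surjective v
    rw [← h.one, ← h.mul, hC.mul_one]
  one_act v := by
    obtain ⟨v, rfl⟩ := f.surjective v
    rw [← map_one θ, ← h.act, hC.one_act]
  mul_act x y v := by
    obtain ⟨v, rfl⟩ := f.surjective v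
    obtain ⟨x, rfl⟩ := θ.surjective x
    obtain ⟨y, rfl⟩ := θ.surjective y
    rw [← _root_.map_mul, ← h.act, ← h.act, ← h.act, hC.mul_act]
  act_mul x t := by
    obtain ⟨x, rfl⟩ := θ.surjective x
    obtain ⟨t, rfl⟩ := (TensorProduct.congr f f).surjective t
    rw [show (TensorProduct.congr f f) t = TensorProduct.map f.toLinearMap f.toLinearMap t from rfl,
      ← h.map_mul, ← h.act, hC.act_mul, h.map_mul, h.map_act₂, ← h.comul]
    rfl
  act_one x := by
    obtain ⟨x, rfl⟩ := θ.surjective x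
    rw [← h.one, ← h.act, hC.act_one, h.counit, map_smul]

/-- Twisting is compatible with isomorphisms. -/
theorem IsIso.twist (h : C.IsIso D θ f) {χ : K ⊗[k] K} (hχ : IsUnit χ) :
    (C.twist χ).IsIso (D.twist (mapTwo θ χ)) θ f where
  comul x := by
    have := h.comul x
    rw [mapTwo_eq] at this ⊢
    simp [CovariantData.twist, ← this, map_inverse _ hχ]
  counit := h.counit
  mul v w := by
    simp only [CovariantData.twist, LinearMap.comp_apply]
    rw [h.map_mul, h.map_act₂, map_inverse _ hχ]
    simp
  one := h.one
  act := h.act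

end CovariantData
end Transport

section Twist

variable {k K V : Type*} [Field k] [Ring K] [Algebra k K] [AddCommGroup V] [Module k V]
  {Δ : K →ₗ[k] K ⊗[k] K} {ε : K →ₗ[k] k}

/-- The coproduct of a Hopf algebra as an algebra map. -/
def IsHopfAlgebra.comulHom (h : IsHopfAlgebra Δ ε) : K →ₐ[k] K ⊗[k] K :=
  AlgHom.ofLinearMap Δ h.comul_one h.comul_mul

theorem leg₁₂_mul (s t : K ⊗[k] K) : leg₁₂ (s * t) = leg₁₂ s * leg₁₂ t := by
  rw [leg₁₂_eq, leg₁₂_eq, leg₁₂_eq, legs_mul comm₁₂]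

theorem leg₂₃_mul (s t : K ⊗[k] K) : leg₂₃ (s * t) = leg₂₃ s * leg₂₃ t := by
  rw [leg₂₃_eq, leg₂₃_eq, leg₂₃_eq, legs_mul comm₂₃]

theorem leg₁₂_one : leg₁₂ (1 : K ⊗[k] K) = 1 := by rw [leg₁₂_eq, legs_one]

theorem leg₂₃_one : leg₂₃ (1 : K ⊗[k] K) = 1 := by rw [leg₂₃_eq, legs_one]

theorem assoc_tmul_eq (s : K ⊗[k] K) (y : K) :
    TensorProduct.assoc k K K K (s ⊗ₜ y) = leg₁₂ s * trd₃ k K y := by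
  simp only [leg₁₂]
  induction s with
  | zero => simp
  | add s t hs ht => simp only [map_add, add_mul, TensorProduct.add_tmul, hs, ht]
  | tmul u v => simp [inl]

theorem tmul_eq_mul (x : K) (s : K ⊗[k] K) : x ⊗ₜ s = fst₃ k K x * leg₂₃ s := by
  simp [leg₂₃]

theorem commute_leg₁₂ (s : K ⊗[k] K) (y : K) : Commute (leg₁₂ s) (trd₃ k K y) := by
  rw [leg₁₂_eq]
  exact commute_legs (f := fst₃ k K) (g := snd₃ k K) (fun x => comm₁₃ (k := k) (K := K) x y)
    (fun x => comm₂₃ (k := k) (K := K) x y) s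

theorem commute_leg₂₃ (s : K ⊗[k] K) (x : K) : Commute (leg₂₃ s) (fst₃ k K x) := by
  rw [leg₂₃_eq]
  exact commute_legs (f := snd₃ k K) (g := trd₃ k K)
    (fun y => (comm₁₂ (k := k) (K := K) x y).symm) (fun y => (comm₁₃ (k := k) (K := K) x y).symm) s

variable (Δ) in
/-- The coproduct `x ↦ u (Δ x) v`. -/
def conjComul (u v : K ⊗[k] K) : K →ₗ[k] K ⊗[k] K :=
  LinearMap.mulLeft k u ∘ₗ LinearMap.mulRight k v ∘ₗ Δ

theorem conjComul_apply (u v : K ⊗[k] K) (x : K) : conjComul Δ u v x = u * (Δ x * v) := rfl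

theorem rTensor_conjComul (u v t : K ⊗[k] K) :
    TensorProduct.assoc k K K K ((conjComul Δ u v).rTensor K t) =
      leg₁₂ u * TensorProduct.assoc k K K K (Δ.rTensor K t) * leg₁₂ v := by
  induction t with
  | zero => simp
  | add s t hs ht => simp only [map_add, mul_add, add_mul, hs, ht]
  | tmul x y =>
    rw [LinearMap.rTensor_tmul, LinearMap.rTensor_tmul, conjComul_apply, assoc_tmul_eq,
      assoc_tmul_eq, leg₁₂_mul, leg₁₂_mul, mul_assoc, mul_assoc, mul_assoc, mul_assoc,
      (commute_leg₁₂ v y).eq]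

theorem lTensor_conjComul (u v t : K ⊗[k] K) :
    (conjComul Δ u v).lTensor K t = leg₂₃ u * Δ.lTensor K t * leg₂₃ v := by
  induction t with
  | zero => simp
  | add s t hs ht => simp only [map_add, mul_add, add_mul, hs, ht]
  | tmul x y =>
    rw [LinearMap.lTensor_tmul, LinearMap.lTensor_tmul, conjComul_apply, tmul_eq_mul,
      tmul_eq_mul x (Δ y), leg₂₃_mul, leg₂₃_mul, ← mul_assoc, ← mul_assoc, ← mul_assoc,
      (commute_leg₂₃ u x).eq]

variable {χ : K ⊗[k] K}

theorem IsHopfAlgebra.assoc_rTensor_mul (h : IsHopfAlgebra Δ ε) (s t : K ⊗[k] K) :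
    TensorProduct.assoc k K K K (Δ.rTensor K (s * t)) =
      TensorProduct.assoc k K K K (Δ.rTensor K s) *
        TensorProduct.assoc k K K K (Δ.rTensor K t) := by
  have h1 := assoc_rTensor_eq_legs h.comulHom
  have h2 : h.comulHom.toLinearMap = Δ := LinearMap.ext fun _ => rfl
  simp only [h2] at h1
  have hc : CommutingLegs (comulFirst h.comulHom) (trd₃ k K) :=
    commutingLegs_of_apply (comulFirst_apply h.comulHom) comm₁₃ comm₂₃
  rw [h1, h1, h1, legs_mul hc]

theorem IsHopfAlgebra.lTensor_mul (h : IsHopfAlgebra Δ ε) (s t : K ⊗[k] K) :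
    Δ.lTensor K (s * t) = Δ.lTensor K s * Δ.lTensor K t := by
  have h1 := lTensor_eq_legs h.comulHom
  have h2 : h.comulHom.toLinearMap = Δ := LinearMap.ext fun _ => rfl
  simp only [h2] at h1
  have hc : CommutingLegs ((incr k K (K ⊗[k] K)).comp h.comulHom) (fst₃ k K) :=
    commutingLegs_of_apply (incr_comp_apply h.comulHom) comm₁₂.symm comm₁₃.symm
  rw [h1, h1, h1, legs_mul hc.symm]

theorem IsHopfAlgebra.assoc_rTensor_one (h : IsHopfAlgebra Δ ε) :
    TensorProduct.assoc k K K K (Δ.rTensor K 1) = 1 := by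
  simp [Algebra.TensorProduct.one_def, h.comul_one]

theorem IsHopfAlgebra.lTensor_one (h : IsHopfAlgebra Δ ε) : Δ.lTensor K 1 = 1 := by
  simp [Algebra.TensorProduct.one_def, h.comul_one]

/-- The cocycle identity for the inverse of a twisting cocycle. -/
theorem IsTwistingCocycle.cocycle_inverse (h : IsHopfAlgebra Δ ε)
    (hχ : IsTwistingCocycle Δ ε χ) :
    TensorProduct.assoc k K K K (Δ.rTensor K (Ring.inverse χ)) * leg₁₂ (Ring.inverse χ) =
      Δ.lTensor K (Ring.inverse χ) * leg₂₃ (Ring.inverse χ) := by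
  refine eq_of_mul_eq_one (b := leg₁₂ χ * TensorProduct.assoc k K K K (Δ.rTensor K χ)) ?_ ?_
  · rw [mul_assoc, ← mul_assoc (leg₁₂ _), ← leg₁₂_mul, Ring.inverse_mul_cancel χ hχ.isUnit,
      leg₁₂_one, one_mul, ← h.assoc_rTensor_mul, Ring.inverse_mul_cancel χ hχ.isUnit,
      h.assoc_rTensor_one]
  · rw [hχ.cocycle, mul_assoc, ← mul_assoc (Δ.lTensor K χ), ← h.lTensor_mul,
      Ring.mul_inverse_cancel χ hχ.isUnit, h.lTensor_one, one_mul, ← leg₂₃_mul,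
      Ring.mul_inverse_cancel χ hχ.isUnit, leg₂₃_one]

/-- `ε ⊗ id` is multiplicative. -/
theorem IsHopfAlgebra.lid_mul (h : IsHopfAlgebra Δ ε) (s t : K ⊗[k] K) :
    TensorProduct.lid k K (ε.rTensor K (s * t)) =
      TensorProduct.lid k K (ε.rTensor K s) * TensorProduct.lid k K (ε.rTensor K t) := by
  induction s with
  | zero => simp
  | add s s' hs hs' => simp only [map_add, add_mul, hs, hs']
  | tmul x y =>
    induction t with
    | zero => simp
    | add s t hs ht => simp only [map_add, mul_add, hs, ht]
    | tmul u v => simp [h.counit_mul, smul_smul, mul_comm]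

/-- `id ⊗ ε` is multiplicative. -/
theorem IsHopfAlgebra.rid_mul (h : IsHopfAlgebra Δ ε) (s t : K ⊗[k] K) :
    TensorProduct.rid k K (ε.lTensor K (s * t)) =
      TensorProduct.rid k K (ε.lTensor K s) * TensorProduct.rid k K (ε.lTensor K t) := by
  induction s with
  | zero => simp
  | add s s' hs hs' => simp only [map_add, add_mul, hs, hs']
  | tmul x y =>
    induction t with
    | zero => simp
    | add s t hs ht => simp only [map_add, mul_add, hs, ht]
    | tmul u v => simp [h.counit_mul, smul_smul, mul_comm]

theorem IsHopfAlgebra.lid_inverse (h : IsHopfAlgebra Δ ε) (hχ : IsUnit χ)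
    (h1 : TensorProduct.lid k K (ε.rTensor K χ) = 1) :
    TensorProduct.lid k K (ε.rTensor K (Ring.inverse χ)) = 1 := by
  have h2 := h.lid_mul χ (Ring.inverse χ)
  rw [Ring.mul_inverse_cancel χ hχ, h1, one_mul] at h2
  simpa [Algebra.TensorProduct.one_def, h.counit_one] using h2.symm

theorem IsHopfAlgebra.rid_inverse (h : IsHopfAlgebra Δ ε) (hχ : IsUnit χ)
    (h1 : TensorProduct.rid k K (ε.lTensor K χ) = 1) :
    TensorProduct.rid k K (ε.lTensor K (Ring.inverse χ)) = 1 := by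
  have h2 := h.rid_mul χ (Ring.inverse χ)
  rw [Ring.mul_inverse_cancel χ hχ, h1, one_mul] at h2
  simpa [Algebra.TensorProduct.one_def, h.counit_one] using h2.symm

/-- The twist of a Hopf algebra by a counital cocycle, given an antipode for the twisted
coproduct. -/
theorem IsHopfAlgebra.conj (h : IsHopfAlgebra Δ ε) (hχ : IsTwistingCocycle Δ ε χ)
    (hχ' : TensorProduct.rid k K (ε.lTensor K χ) = 1)
    (hS : ∃ S, IsAntipode (conjComul Δ χ (Ring.inverse χ)) ε S) :
    IsHopfAlgebra (conjComul Δ χ (Ring.inverse χ)) ε where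
  coassoc := by
    ext x
    have h2 := LinearMap.congr_fun h.coassoc x
    simp only [LinearMap.comp_apply, LinearEquiv.coe_coe] at h2 ⊢
    rw [rTensor_conjComul, lTensor_conjComul, conjComul_apply, h.assoc_rTensor_mul,
      h.assoc_rTensor_mul, h.lTensor_mul, h.lTensor_mul, h2]
    simp only [mul_assoc]
    rw [hχ.cocycle_inverse h, ← mul_assoc, hχ.cocycle]
    simp only [mul_assoc]
  rTensor_counit := by
    ext x
    apply (TensorProduct.lid k K).injective
    have h2 := LinearMap.congr_fun h.rTensor_counit x
    simp only [LinearMap.comp_apply] at h2 ⊢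
    rw [conjComul_apply, h.lid_mul, h.lid_mul, hχ.counit, h.lid_inverse hχ.isUnit hχ.counit, h2]
    simp
  lTensor_counit := by
    ext x
    apply (TensorProduct.rid k K).injective
    have h2 := LinearMap.congr_fun h.lTensor_counit x
    simp only [LinearMap.comp_apply] at h2 ⊢
    rw [conjComul_apply, h.rid_mul, h.rid_mul, hχ', h.rid_inverse hχ.isUnit hχ', h2]
    simp
  comul_one := by
    rw [conjComul_apply, h.comul_one, one_mul, Ring.mul_inverse_cancel χ hχ.isUnit]
  comul_mul x y := by
    simp only [conjComul_apply, h.comul_mul, mul_assoc]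
    rw [← mul_assoc (Ring.inverse χ) χ, Ring.inverse_mul_cancel χ hχ.isUnit, one_mul]
  counit_one := h.counit_one
  counit_mul := h.counit_mul
  antipode := hS

namespace CovariantData

variable {C : CovariantData k K V}

/-- The action of `K⊗³` on `V⊗³`. -/
def act₃ (C : CovariantData k K V) :
    K ⊗[k] (K ⊗[k] K) →ₗ[k] V ⊗[k] (V ⊗[k] V) →ₗ[k] V ⊗[k] (V ⊗[k] V) :=
  TensorProduct.homTensorHomMap (RingHom.id k) V (V ⊗[k] V) V (V ⊗[k] V) ∘ₗ
    TensorProduct.map C.act C.act₂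

@[simp] theorem act₃_tmul_tmul (C : CovariantData k K V) (x : K) (s : K ⊗[k] K) (v : V)
    (t : V ⊗[k] V) : C.act₃ (x ⊗ₜ s) (v ⊗ₜ t) = C.act x v ⊗ₜ C.act₂ s t := rfl

theorem IsCovariantSystem.act₂_mul (h : C.IsCovariantSystem) (s s' : K ⊗[k] K) (t : V ⊗[k] V) :
    C.act₂ (s * s') t = C.act₂ s (C.act₂ s' t) := by
  induction s with
  | zero => simp
  | add s t hs ht => simp only [map_add, add_mul, LinearMap.add_apply, hs, ht]
  | tmul x y =>
    induction s' with
    | zero => simp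
    | add s t hs ht => simp only [map_add, mul_add, LinearMap.add_apply, hs, ht]
    | tmul x' y' =>
      induction t with
      | zero => simp
      | add s t hs ht => simp only [map_add, hs, ht]
      | tmul v w => simp [h.mul_act]

theorem IsCovariantSystem.act₃_mul (h : C.IsCovariantSystem) (s s' : K ⊗[k] (K ⊗[k] K))
    (t : V ⊗[k] (V ⊗[k] V)) : C.act₃ (s * s') t = C.act₃ s (C.act₃ s' t) := by
  induction s with
  | zero => simp
  | add s t hs ht => simp only [map_add, add_mul, LinearMap.add_apply, hs, ht]
  | tmul x y =>
    induction s' with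
    | zero => simp
    | add s t hs ht => simp only [map_add, mul_add, LinearMap.add_apply, hs, ht]
    | tmul x' y' =>
      induction t with
      | zero => simp
      | add s t hs ht => simp only [map_add, hs, ht]
      | tmul v w => simp [h.mul_act, h.act₂_mul]

theorem IsCovariantSystem.act₂_one (h : C.IsCovariantSystem) (t : V ⊗[k] V) :
    C.act₂ 1 t = t := by
  rw [Algebra.TensorProduct.one_def]
  induction t with
  | zero => simp
  | add s t hs ht => simp only [map_add, hs, ht]
  | tmul v w => simp [h.one_act]

theorem act₃_leg₁₂ (h : C.IsCovariantSystem) (s : K ⊗[k] K) (t : V ⊗[k] V) (w : V) :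
    C.act₃ (leg₁₂ s) (TensorProduct.assoc k V V V (t ⊗ₜ w)) =
      TensorProduct.assoc k V V V (C.act₂ s t ⊗ₜ w) := by
  simp only [leg₁₂]
  induction s with
  | zero => simp
  | add s t hs ht => simp only [map_add, LinearMap.add_apply, TensorProduct.add_tmul, hs, ht]
  | tmul x y =>
    induction t with
    | zero => simp
    | add s t hs ht => simp only [map_add, TensorProduct.add_tmul, hs, ht]
    | tmul u v => simp [inl, h.one_act]

theorem act₃_leg₂₃ (h : C.IsCovariantSystem) (s : K ⊗[k] K) (t : V ⊗[k] V) (v : V) :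
    C.act₃ (leg₂₃ s) (v ⊗ₜ t) = v ⊗ₜ C.act₂ s t := by
  simp [leg₂₃, h.one_act]

/-- Covariance of the product, applied to the first two of three factors: the element `s` acts on
`(u v) ⊗ w` through `(Δ ⊗ id) s`. -/
theorem IsCovariantSystem.act₂_mul_rTensor (h : C.IsCovariantSystem) (s : K ⊗[k] K)
    (t : (V ⊗[k] V) ⊗[k] V) :
    C.act₂ s (C.mul.rTensor V t) = C.mul.rTensor V ((TensorProduct.assoc k V V V).symm
      (C.act₃ (TensorProduct.assoc k K K K (C.comul.rTensor K s))
        (TensorProduct.assoc k V V V t))) := by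
  induction t with
  | zero => simp
  | add s t hs ht => simp only [map_add, hs, ht]
  | tmul t w =>
    induction s with
    | zero => simp
    | add s t hs ht => simp only [map_add, LinearMap.add_apply, hs, ht]
    | tmul x y =>
      simp only [LinearMap.rTensor_tmul, act₂_tmul_tmul, h.act_mul]
      induction C.comul x with
      | zero => simp
      | add s t hs ht =>
        simp only [map_add, LinearMap.add_apply, TensorProduct.add_tmul, hs, ht]
      | tmul a b =>
        induction t with
        | zero => simp
        | add s t hs ht => simp only [map_add, TensorProduct.add_tmul, hs, ht]
        | tmul u v => simp

/-- Covariance of the product, applied to the last two of three factors: the element `s` acts on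
`u ⊗ (v w)` through `(id ⊗ Δ) s`. -/
theorem IsCovariantSystem.act₂_mul_lTensor (h : C.IsCovariantSystem) (s : K ⊗[k] K)
    (t : V ⊗[k] (V ⊗[k] V)) :
    C.act₂ s (C.mul.lTensor V t) = C.mul.lTensor V (C.act₃ (C.comul.lTensor K s) t) := by
  induction t with
  | zero => simp
  | add s t hs ht => simp only [map_add, hs, ht]
  | tmul w t =>
    induction s with
    | zero => simp
    | add s t hs ht => simp only [map_add, LinearMap.add_apply, hs, ht]
    | tmul x y => simp [h.act_mul]

theorem IsCovariantSystem.act₂_one_tmul (h : C.IsCovariantSystem) (s : K ⊗[k] K) (v : V) :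
    C.act₂ s (C.one ⊗ₜ v) = C.one ⊗ₜ C.act (TensorProduct.lid k K (C.counit.rTensor K s)) v := by
  induction s with
  | zero => simp
  | add s t hs ht =>
    simp only [map_add, LinearMap.add_apply, TensorProduct.tmul_add, hs, ht]
  | tmul x y => simp [h.act_one, TensorProduct.smul_tmul]

theorem IsCovariantSystem.act₂_tmul_one (h : C.IsCovariantSystem) (s : K ⊗[k] K) (v : V) :
    C.act₂ s (v ⊗ₜ C.one) = C.act (TensorProduct.rid k K (C.counit.lTensor K s)) v ⊗ₜ C.one := by
  induction s with
  | zero => simp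
  | add s t hs ht =>
    simp only [map_add, LinearMap.add_apply, TensorProduct.add_tmul, hs, ht]
  | tmul x y => simp [h.act_one, TensorProduct.smul_tmul]

/-- The twist of a covariant system by a counital cocycle is a covariant system, given an antipode
for the twisted coproduct. -/
theorem IsCovariantSystem.twist (h : C.IsCovariantSystem)
    (hχ : IsTwistingCocycle C.comul C.counit χ)
    (hχ' : TensorProduct.rid k K (C.counit.lTensor K χ) = 1)
    (hS : ∃ S, IsAntipode (C.twist χ).comul (C.twist χ).counit S) :
    (C.twist χ).IsCovariantSystem where
  hopf := h.hopf.conj hχ hχ' hS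
  mul_assoc := by
    ext u v w
    simp only [TensorProduct.AlgebraTensorModule.curry_apply, LinearMap.restrictScalars_self,
      TensorProduct.curry_apply, LinearMap.comp_apply, LinearMap.rTensor_tmul, CovariantData.twist,
      LinearEquiv.coe_coe, TensorProduct.assoc_tmul, LinearMap.lTensor_tmul]
    -- both sides become the action of one element of `K⊗³`, by the cocycle identity for `χ⁻¹`
    rw [← LinearMap.rTensor_tmul V C.mul, h.act₂_mul_rTensor, ← act₃_leg₁₂ h, ← h.act₃_mul,
      hχ.cocycle_inverse h.hopf, ← LinearMap.lTensor_tmul V C.mul, h.act₂_mul_lTensor,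
      ← act₃_leg₂₃ h, ← h.act₃_mul]
    have h2 := LinearMap.congr_fun h.mul_assoc
    simp only [LinearMap.comp_apply] at h2
    rw [h2]
    simp
  one_mul v := by
    simp only [CovariantData.twist, LinearMap.comp_apply]
    rw [h.act₂_one_tmul, h.hopf.lid_inverse hχ.isUnit hχ.counit, h.one_act, h.one_mul]
  mul_one v := by
    simp only [CovariantData.twist, LinearMap.comp_apply]
    rw [h.act₂_tmul_one, h.hopf.rid_inverse hχ.isUnit hχ', h.one_act, h.mul_one]
  one_act := h.one_act
  mul_act := h.mul_act
  act_mul x t := by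
    change C.act x (C.mul (C.act₂ (Ring.inverse χ) t)) =
      C.mul (C.act₂ (Ring.inverse χ) (C.act₂ (χ * (C.comul x * Ring.inverse χ)) t))
    rw [h.act_mul, ← h.act₂_mul, ← h.act₂_mul,
      ← _root_.mul_assoc, Ring.inverse_mul_cancel χ hχ.isUnit, _root_.one_mul]
  act_one := h.act_one

end CovariantData
end Twist

/-! ### Opposite and tensor product Hopf algebras -/

section TensorHopf

variable {k K X : Type*} [Field k] [Ring K] [Algebra k K] [Ring X] [Algebra k X]

/-- Coassociativity, with the legs `f`, `g`, `h`. -/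
theorem legs_coassoc {Δ : K →ₗ[k] K ⊗[k] K} {x : K}
    (hΔ : TensorProduct.assoc k K K K (Δ.rTensor K (Δ x)) = Δ.lTensor K (Δ x))
    {f g h p q : K →ₐ[k] X} (hp : ∀ x, p x = legs f g (Δ x)) (hq : ∀ x, q x = legs g h (Δ x)) :
    legs p h (Δ x) = legs f q (Δ x) := by
  rw [← legs₃_assoc_rTensor hp, hΔ, legs₃_lTensor hq]

variable {Δ Δ₁ Δ₂ : K →ₐ[k] K ⊗[k] K} {ε ε₁ ε₂ : K →ₗ[k] k} {ε' : K ⊗[k] K →ₗ[k] k}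

/-- The inverse of the antipode is an antipode for the opposite coproduct. -/
theorem IsAntipode.cop {Δ : K →ₐ[k] K ⊗[k] K} {ε : K →ₗ[k] k} {S S' : K →ₗ[k] K}
    (hS : IsAntipode Δ.toLinearMap ε S) (hm : ∀ x y, S (x * y) = S y * S x) (h1 : S 1 = 1)
    (hi : Function.Injective S) (hS' : ∀ x, S (S' x) = x) :
    IsAntipode (copComul Δ).toLinearMap ε S' := by
  have ha : ∀ r : k, S (algebraMap k K r) = algebraMap k K r := fun r => by
    rw [Algebra.algebraMap_eq_smul_one, map_smul, h1]
  refine ⟨?_, ?_⟩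
  · ext x
    have h2 : ∀ t : K ⊗[k] K, S (LinearMap.mul' k K (S'.rTensor K (swap t))) =
        LinearMap.mul' k K (S.rTensor K t) := by
      intro t
      simp only [swap]
      induction t with
      | zero => simp
      | add s t hs ht => simp only [map_add, hs, ht]
      | tmul x y => simp [hm, hS']
    have hx := LinearMap.congr_fun hS.left x
    simp only [LinearMap.comp_apply, AlgHom.toLinearMap_apply, Algebra.linearMap_apply] at hx ⊢
    apply hi
    rw [copComul_apply, h2, hx, ha]
  · ext x
    have h2 : ∀ t : K ⊗[k] K, S (LinearMap.mul' k K (S'.lTensor K (swap t))) =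
        LinearMap.mul' k K (S.lTensor K t) := by
      intro t
      simp only [swap]
      induction t with
      | zero => simp
      | add s t hs ht => simp only [map_add, hs, ht]
      | tmul x y => simp [hm, hS']
    have hx := LinearMap.congr_fun hS.right x
    simp only [LinearMap.comp_apply, AlgHom.toLinearMap_apply, Algebra.linearMap_apply] at hx ⊢
    apply hi
    rw [copComul_apply, h2, hx, ha]

/-- The opposite coproduct, given a right inverse of an injective antipode. -/
theorem IsHopfAlgebra.cop (h : IsHopfAlgebra Δ.toLinearMap ε) {S S' : K →ₗ[k] K}
    (hS : IsAntipode Δ.toLinearMap ε S) (hm : ∀ x y, S (x * y) = S y * S x) (h1 : S 1 = 1)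
    (hi : Function.Injective S) (hS' : ∀ x, S (S' x) = x) :
    IsHopfAlgebra (copComul Δ).toLinearMap ε where
  coassoc := by
    ext x
    have hx : TensorProduct.assoc k K K K (Δ.toLinearMap.rTensor K (Δ x)) =
      Δ.toLinearMap.lTensor K (Δ x) := LinearMap.congr_fun h.coassoc x
    have hp : ∀ x, comulFirst (copComul Δ) x =
        legs (snd₃ k K) (fst₃ k K) (Δ.toLinearMap x) := fun x => by
      rw [comulFirst_apply, copComul_apply, legs_swap comm₁₂]; rfl
    have hq : ∀ x, (incr k K (K ⊗[k] K)).comp (copComul Δ) x =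
        legs (trd₃ k K) (snd₃ k K) (Δ.toLinearMap x) := fun x => by
      rw [incr_comp_apply, copComul_apply, legs_swap comm₂₃]; rfl
    simp only [LinearMap.comp_apply, LinearEquiv.coe_coe, AlgHom.toLinearMap_apply]
    rw [assoc_rTensor_eq_legs, lTensor_eq_legs, copComul_apply,
      legs_swap (commutingLegs_of_apply hp comm₂₃ comm₁₃),
      legs_swap (commutingLegs_of_apply hq comm₁₃.symm comm₁₂.symm).symm]
    exact (legs_coassoc hx hq hp).symm
  rTensor_counit := by
    ext x
    have hx := LinearMap.congr_fun h.lTensor_counit x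
    simp only [LinearMap.comp_apply, AlgHom.toLinearMap_apply] at hx ⊢
    have h2 : ∀ t : K ⊗[k] K, ε.rTensor K (swap t) = TensorProduct.comm k K k (ε.lTensor K t) := by
      intro t
      simp only [swap]
      induction t with
      | zero => simp
      | add s t hs ht => simp only [map_add, hs, ht]
      | tmul x y => simp
    rw [copComul_apply, h2, hx]; simp
  lTensor_counit := by
    ext x
    have hx := LinearMap.congr_fun h.rTensor_counit x
    simp only [LinearMap.comp_apply, AlgHom.toLinearMap_apply] at hx ⊢
    have h2 : ∀ t : K ⊗[k] K, ε.lTensor K (swap t) = TensorProduct.comm k k K (ε.rTensor K t) := by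
      intro t
      simp only [swap]
      induction t with
      | zero => simp
      | add s t hs ht => simp only [map_add, hs, ht]
      | tmul x y => simp
    rw [copComul_apply, h2, hx]; simp
  comul_one := map_one (copComul Δ)
  comul_mul := map_mul (copComul Δ)
  counit_one := h.counit_one
  counit_mul := h.counit_mul
  antipode := ⟨S', hS.cop hm h1 hi hS'⟩

/-- Simultaneous induction on two tensors, for a property that is additive in each of them. -/
theorem quad_induction {M N M' N' : Type*} [AddCommGroup M] [Module k M] [AddCommGroup N]
    [Module k N] [AddCommGroup M'] [Module k M'] [AddCommGroup N'] [Module k N']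
    {p : (M ⊗[k] N) → (M' ⊗[k] N') → Prop}
    (h0 : ∀ t, p 0 t) (h0' : ∀ t, p t 0) (ha : ∀ s s' t, p s t → p s' t → p (s + s') t)
    (ha' : ∀ s t t', p s t → p s t' → p s (t + t')) (h : ∀ x x' y y', p (x ⊗ₜ x') (y ⊗ₜ y'))
    (s : M ⊗[k] N) (t : M' ⊗[k] N') : p s t := by
  induction s with
  | zero => exact h0 t
  | add s s' hs hs' => exact ha _ _ _ hs hs'
  | tmul x x' =>
    induction t with
    | zero => exact h0' _
    | add t t' ht ht' => exact ha' _ _ _ ht ht'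
    | tmul y y' => exact h x x' y y'

theorem quad₁₃_zero : quad₁₃ (0 : K ⊗[k] K) = 0 := map_zero (TensorProduct.map _ _)
theorem quad₂₄_zero : quad₂₄ (0 : K ⊗[k] K) = 0 := map_zero (TensorProduct.map _ _)
theorem quad₁₃_add (s t : K ⊗[k] K) : quad₁₃ (s + t) = quad₁₃ s + quad₁₃ t :=
  map_add (TensorProduct.map _ _) s t
theorem quad₂₄_add (s t : K ⊗[k] K) : quad₂₄ (s + t) = quad₂₄ s + quad₂₄ t :=
  map_add (TensorProduct.map _ _) s t
theorem quad₁₃_tmul (x y : K) : quad₁₃ (x ⊗ₜ[k] y) = (x ⊗ₜ 1) ⊗ₜ (y ⊗ₜ 1) := rfl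
theorem quad₂₃_tmul (x y : K) : quad₂₃ (x ⊗ₜ[k] y) = (1 ⊗ₜ x) ⊗ₜ (y ⊗ₜ 1) := rfl
theorem quad₂₄_tmul (x y : K) : quad₂₄ (x ⊗ₜ[k] y) = (1 ⊗ₜ x) ⊗ₜ (1 ⊗ₜ y) := rfl

/-- A linear map that agrees with `f` on the products `s₁₃ t₂₄` of elementary tensors agrees with
it on all of them. -/
theorem quad_ext {M : Type*} [AddCommGroup M] [Module k M]
    (F : (K ⊗[k] K) ⊗[k] (K ⊗[k] K) →ₗ[k] M) (G : K ⊗[k] K →ₗ[k] K ⊗[k] K →ₗ[k] M)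
    (h : ∀ x x' y y', F ((x ⊗ₜ y) ⊗ₜ (x' ⊗ₜ y')) = G (x ⊗ₜ x') (y ⊗ₜ y')) (s t : K ⊗[k] K) :
    F (quad₁₃ s * quad₂₄ t) = G s t := by
  induction s, t using quad_induction with
  | h0 t => simp [quad₁₃_zero]
  | h0' t => simp [quad₂₄_zero]
  | ha s s' t hs hs' => rw [quad₁₃_add, add_mul, map_add, hs, hs', map_add, LinearMap.add_apply]
  | ha' s t t' hs hs' => rw [quad₂₄_add, mul_add, map_add, hs, hs', map_add]
  | h x x' y y' => simp [quad₁₃_tmul, quad₂₄_tmul, h]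

/-- The tensor product of two antipodes is an antipode for the tensor product coproduct. -/
theorem IsAntipode.tensor {S₁ S₂ : K →ₗ[k] K} (hS₁ : IsAntipode Δ₁.toLinearMap ε₁ S₁)
    (hS₂ : IsAntipode Δ₂.toLinearMap ε₂ S₂) (hε : ∀ x y, ε' (x ⊗ₜ y) = ε₁ x * ε₂ y) :
    IsAntipode (tensorComul Δ₁ Δ₂).toLinearMap ε' (TensorProduct.map S₁ S₂) := by
  refine ⟨TensorProduct.ext' fun x y => ?_,
    TensorProduct.ext' fun x y => ?_⟩
  · have e₁ := LinearMap.congr_fun hS₁.left x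
    have e₂ := LinearMap.congr_fun hS₂.left y
    simp only [LinearMap.comp_apply, AlgHom.toLinearMap_apply] at e₁ e₂ ⊢
    have := quad_ext (LinearMap.mul' k _ ∘ₗ (TensorProduct.map S₁ S₂).rTensor (K ⊗[k] K))
      ((TensorProduct.mk k K K).compl₁₂ (LinearMap.mul' k K ∘ₗ S₁.rTensor K)
        (LinearMap.mul' k K ∘ₗ S₂.rTensor K)) (by intros; simp) (Δ₁ x) (Δ₂ y)
    simp only [LinearMap.comp_apply, LinearMap.compl₁₂_apply, e₁, e₂] at this
    rw [tensorComul_tmul, this, hε]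
    simp [Algebra.algebraMap_eq_smul_one, Algebra.TensorProduct.one_def,
      TensorProduct.smul_tmul', smul_smul, mul_comm]
  · have e₁ := LinearMap.congr_fun hS₁.right x
    have e₂ := LinearMap.congr_fun hS₂.right y
    simp only [LinearMap.comp_apply, AlgHom.toLinearMap_apply] at e₁ e₂ ⊢
    have := quad_ext (LinearMap.mul' k _ ∘ₗ (TensorProduct.map S₁ S₂).lTensor (K ⊗[k] K))
      ((TensorProduct.mk k K K).compl₁₂ (LinearMap.mul' k K ∘ₗ S₁.lTensor K)
        (LinearMap.mul' k K ∘ₗ S₂.lTensor K)) (by intros; simp) (Δ₁ x) (Δ₂ y)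
    simp only [LinearMap.comp_apply, LinearMap.compl₁₂_apply, e₁, e₂] at this
    rw [tensorComul_tmul, this, hε]
    simp [Algebra.algebraMap_eq_smul_one, Algebra.TensorProduct.one_def,
      TensorProduct.smul_tmul', smul_smul, mul_comm]

/-- The tensor product of two Hopf algebra structures. -/
theorem IsHopfAlgebra.tensor (h₁ : IsHopfAlgebra Δ₁.toLinearMap ε₁)
    (h₂ : IsHopfAlgebra Δ₂.toLinearMap ε₂) (hε : ∀ x y, ε' (x ⊗ₜ y) = ε₁ x * ε₂ y) :
    IsHopfAlgebra (tensorComul Δ₁ Δ₂).toLinearMap ε' where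
  coassoc := by
    have hp : ∀ x, comulFirst (tensorComul Δ₁ Δ₂) x = legs (fst₃ k (K ⊗[k] K))
      (snd₃ k (K ⊗[k] K)) (tensorComul Δ₁ Δ₂ x) := comulFirst_apply _
    have hq : ∀ x, (incr k (K ⊗[k] K) _).comp (tensorComul Δ₁ Δ₂) x = legs (snd₃ k (K ⊗[k] K))
      (trd₃ k (K ⊗[k] K)) (tensorComul Δ₁ Δ₂ x) := incr_comp_apply _
    have cp := commutingLegs_of_apply hp comm₁₃ comm₂₃
    have cq := (commutingLegs_of_apply hq comm₁₂.symm comm₁₃.symm).symm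
    have key₁ : ∀ x, legs (comulFirst (tensorComul Δ₁ Δ₂)) (trd₃ k (K ⊗[k] K)) (quad₁₃ (Δ₁ x)) =
        legs (fst₃ k (K ⊗[k] K)) ((incr k (K ⊗[k] K) _).comp (tensorComul Δ₁ Δ₂))
          (quad₁₃ (Δ₁ x)) := fun x => by
      rw [legs_quad₁₃, legs_quad₁₃]
      refine legs_coassoc (Δ := Δ₁.toLinearMap) (g := (snd₃ k (K ⊗[k] K)).comp (incl k K K))
        (LinearMap.congr_fun h₁.coassoc x) (fun x => ?_) (fun x => ?_)
      · rw [AlgHom.comp_apply, hp, tensorComul_incl, legs_quad₁₃]; rfl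
      · rw [AlgHom.comp_apply, hq, tensorComul_incl, legs_quad₁₃]; rfl
    have key₂ : ∀ x, legs (comulFirst (tensorComul Δ₁ Δ₂)) (trd₃ k (K ⊗[k] K)) (quad₂₄ (Δ₂ x)) =
        legs (fst₃ k (K ⊗[k] K)) ((incr k (K ⊗[k] K) _).comp (tensorComul Δ₁ Δ₂))
          (quad₂₄ (Δ₂ x)) := fun x => by
      rw [legs_quad₂₄, legs_quad₂₄]
      refine legs_coassoc (Δ := Δ₂.toLinearMap) (g := (snd₃ k (K ⊗[k] K)).comp (incr k K K))
        (LinearMap.congr_fun h₂.coassoc x) (fun x => ?_) (fun x => ?_)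
      · rw [AlgHom.comp_apply, hp, tensorComul_incr, legs_quad₂₄]; rfl
      · rw [AlgHom.comp_apply, hq, tensorComul_incr, legs_quad₂₄]; rfl
    refine TensorProduct.ext' fun x y => ?_
    simp only [LinearMap.comp_apply, LinearEquiv.coe_coe, AlgHom.toLinearMap_apply]
    rw [assoc_rTensor_eq_legs, lTensor_eq_legs, tensorComul_tmul, legs_mul cp, legs_mul cq,
      key₁, key₂]
  rTensor_counit := by
    refine TensorProduct.ext' fun x y => (TensorProduct.lid k _).injective ?_
    have e₁ := LinearMap.congr_fun h₁.rTensor_counit x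
    have e₂ := LinearMap.congr_fun h₂.rTensor_counit y
    simp only [LinearMap.comp_apply, AlgHom.toLinearMap_apply] at e₁ e₂ ⊢
    have := quad_ext ((TensorProduct.lid k _).toLinearMap ∘ₗ ε'.rTensor (K ⊗[k] K))
      ((TensorProduct.mk k K K).compl₁₂ ((TensorProduct.lid k _).toLinearMap ∘ₗ ε₁.rTensor K)
        ((TensorProduct.lid k _).toLinearMap ∘ₗ ε₂.rTensor K))
      (by intros; simp [hε, TensorProduct.smul_tmul', smul_smul, mul_comm])
      (Δ₁ x) (Δ₂ y)
    simp only [LinearMap.comp_apply, LinearMap.compl₁₂_apply, LinearEquiv.coe_coe, e₁, e₂] at this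
    rw [tensorComul_tmul, this]
    simp
  lTensor_counit := by
    refine TensorProduct.ext' fun x y => (TensorProduct.rid k _).injective ?_
    have e₁ := LinearMap.congr_fun h₁.lTensor_counit x
    have e₂ := LinearMap.congr_fun h₂.lTensor_counit y
    simp only [LinearMap.comp_apply, AlgHom.toLinearMap_apply] at e₁ e₂ ⊢
    have := quad_ext ((TensorProduct.rid k _).toLinearMap ∘ₗ ε'.lTensor (K ⊗[k] K))
      ((TensorProduct.mk k K K).compl₁₂ ((TensorProduct.rid k _).toLinearMap ∘ₗ ε₁.lTensor K)
        ((TensorProduct.rid k _).toLinearMap ∘ₗ ε₂.lTensor K))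
      (by intros; simp [hε, TensorProduct.smul_tmul', smul_smul, mul_comm])
      (Δ₁ x) (Δ₂ y)
    simp only [LinearMap.comp_apply, LinearMap.compl₁₂_apply, LinearEquiv.coe_coe, e₁, e₂] at this
    rw [tensorComul_tmul, this]
    simp
  comul_one := map_one (tensorComul Δ₁ Δ₂)
  comul_mul := map_mul (tensorComul Δ₁ Δ₂)
  counit_one := by
    rw [Algebra.TensorProduct.one_def, hε, h₁.counit_one, h₂.counit_one, mul_one]
  counit_mul s t := by
    induction s, t using quad_induction with
    | h0 t => simp
    | h0' t => simp
    | ha s s' t hs hs' => simp only [add_mul, map_add, hs, hs']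
    | ha' s t t' hs hs' => simp only [mul_add, map_add, hs, hs']
    | h x x' y y' =>
      rw [Algebra.TensorProduct.tmul_mul_tmul, hε, hε, hε, h₁.counit_mul, h₂.counit_mul,
        mul_mul_mul_comm]
  antipode := by
    obtain ⟨S₁, hS₁⟩ := h₁.antipode
    obtain ⟨S₂, hS₂⟩ := h₂.antipode
    exact ⟨_, hS₁.tensor hS₂ hε⟩

end TensorHopf

/-! ### The covariant system of the tensor product of `Hᶜᵒᵖ` and `H` -/

section TensorSystem

variable {k H A : Type*} [Field k] [Ring H] [HopfAlgebra k H] [Ring A] [HopfAlgebra k A]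
  (P : HopfPairing k H A)

local notation "S" => HopfAlgebra.antipode k

theorem isAntipode_antipode : IsAntipode (Bialgebra.comulAlgHom k H).toLinearMap
    (Coalgebra.counit (R := k) (A := H)) (HopfAlgebra.antipode k) where
  left := HopfAlgebra.mul_antipode_rTensor_comul
  right := HopfAlgebra.mul_antipode_lTensor_comul

variable (k H) in
theorem isHopfAlgebra_comul : IsHopfAlgebra (Bialgebra.comulAlgHom k H).toLinearMap
    (Coalgebra.counit (R := k) (A := H)) where
  coassoc := Coalgebra.coassoc
  rTensor_counit := Coalgebra.rTensor_counit_comp_comul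
  lTensor_counit := Coalgebra.lTensor_counit_comp_comul
  comul_one := Bialgebra.comul_one
  comul_mul := Bialgebra.comul_mul
  counit_one := Bialgebra.counit_one
  counit_mul := Bialgebra.counit_mul
  antipode := ⟨_, isAntipode_antipode⟩

variable (k H) in
/-- The coproduct of `Hᶜᵒᵖ ⊗ H`. -/
def comulE : H ⊗[k] H →ₐ[k] (H ⊗[k] H) ⊗[k] (H ⊗[k] H) :=
  tensorComul (copComul (Bialgebra.comulAlgHom k H)) (Bialgebra.comulAlgHom k H)

theorem comulE_tmul (x y : H) : comulE k H (x ⊗ₜ y) =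
    quad₁₃ (swap (Coalgebra.comul x)) * quad₂₄ (Coalgebra.comul y) :=
  tensorComul_tmul _ _ x y

/-- The algebra `H ⊗ H` with the coproduct of `Hᶜᵒᵖ ⊗ H`, acting on `A` by
`(φ ⊗ h) ▷ a = ⟨S φ, a₁⟩ a₂ ⟨h, a₃⟩`. -/
def tensorOnDual : CovariantData k (H ⊗[k] H) A where
  comul := (comulE k H).toLinearMap
  counit := Coalgebra.counit
  act := biEval P ∘ₗ (HopfAlgebra.antipode k).rTensor H
  mul := LinearMap.mul' k A
  one := 1

theorem tensorOnDual_act_tmul (x y : H) (a : A) : (tensorOnDual P).act (x ⊗ₜ y) a =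
    leftEval P (HopfAlgebra.antipode k x) (rightEval P y a) := rfl

theorem leftEval_one_left (a : A) : leftEval P 1 a = a := by
  have : P.form.flip 1 = Coalgebra.counit := LinearMap.ext P.one_right
  simp [leftEval_apply, this]

theorem rightEval_one_left (a : A) : rightEval P 1 a = a := by
  have : P.form.flip 1 = Coalgebra.counit := LinearMap.ext P.one_right
  simp [rightEval_apply, this]

/-- `a₁ ⟨h, a₂⟩` as a function of `a₁ ⊗ a₂` and `h`. -/
def evalSnd : A ⊗[k] A →ₗ[k] H →ₗ[k] A :=
  TensorProduct.lift (LinearMap.mk₂ k (fun u v => (P.form v).smulRight u)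
    (by intros; ext; simp) (by intros; ext; simp [smul_smul, mul_comm])
    (by intros; ext; simp [add_smul]) (by intros; ext; simp [mul_smul]))

/-- `⟨h, S a₁⟩ a₂` as a function of `a₁ ⊗ a₂` and `h`. -/
def evalFst : A ⊗[k] A →ₗ[k] H →ₗ[k] A :=
  TensorProduct.lift (LinearMap.mk₂ k (fun u v => (P.form (HopfAlgebra.antipode k u)).smulRight v)
    (by intros; ext; simp [add_smul]) (by intros; ext; simp [mul_smul])
    (by intros; ext; simp) (by intros; ext; simp [smul_smul, mul_comm]))

theorem rightEval_eq (h : H) (a : A) : rightEval P h a = evalSnd P (Coalgebra.comul a) h := by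
  rw [rightEval_apply]
  generalize (Coalgebra.comul a : A ⊗[k] A) = t
  induction t with
  | zero => simp
  | add s t hs ht => simp only [map_add, LinearMap.add_apply, hs, ht]
  | tmul u v => simp [evalSnd]

theorem leftEval_antipode_eq (h : H) (a : A) :
    leftEval P (HopfAlgebra.antipode k h) a = evalFst P (Coalgebra.comul a) h := by
  rw [leftEval_apply]
  generalize (Coalgebra.comul a : A ⊗[k] A) = t
  induction t with
  | zero => simp
  | add s t hs ht => simp only [map_add, LinearMap.add_apply, hs, ht]
  | tmul u v => simp [evalFst, P.antipode_right]

/-- The right evaluations make `A` a module algebra: `h ▷ (a b) = (h₁ ▷ a) (h₂ ▷ b)` for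
`h ▷ a = a₁ ⟨h, a₂⟩`. -/
theorem rightEval_mul_right (h : H) (a b : A) : rightEval P h (a * b) =
    LinearMap.mul' k A (TensorProduct.map ((rightEval P).flip a) ((rightEval P).flip b)
      (Coalgebra.comul h)) := by
  have key : ∀ s t : A ⊗[k] A, evalSnd P (s * t) h =
      LinearMap.mul' k A (TensorProduct.map (evalSnd P s) (evalSnd P t) (Coalgebra.comul h)) := by
    intro s t
    induction s, t using quad_induction with
    | h0 t => simp
    | h0' t => simp
    | ha s s' t hs hs' =>
      simp only [add_mul, map_add, LinearMap.add_apply, TensorProduct.map_add_left, hs, hs']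
    | ha' s t t' hs hs' =>
      simp only [mul_add, map_add, LinearMap.add_apply, TensorProduct.map_add_right, hs, hs']
    | h x x' y y' =>
      have h1 : evalSnd P ((x ⊗ₜ x') * (y ⊗ₜ y')) h = P.form (x' * y') h • (x * y) := by
        simp [evalSnd]
      rw [h1, P.mul_left]
      generalize (Coalgebra.comul h : H ⊗[k] H) = t
      induction t with
      | zero => simp
      | add s t hs ht => simp only [map_add, add_smul, hs, ht]
      | tmul u v => simp [evalSnd, smul_smul, mul_comm]
  have h1 : ∀ a, (rightEval P).flip a = evalSnd P (Coalgebra.comul a) := fun a =>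
    LinearMap.ext fun h => rightEval_eq P h a
  rw [rightEval_eq, Bialgebra.comul_mul, key, h1, h1]

/-- The left evaluations at `S h` make `A` a module algebra over `Hᶜᵒᵖ`, as `S` reverses the order.
-/
theorem leftEval_antipode_mul_right (h : H) (a b : A) :
    leftEval P (HopfAlgebra.antipode k h) (a * b) =
    LinearMap.mul' k A (TensorProduct.map ((leftEval P ∘ₗ HopfAlgebra.antipode k).flip a)
      ((leftEval P ∘ₗ HopfAlgebra.antipode k).flip b) (swap (Coalgebra.comul h))) := by
  have key : ∀ s t : A ⊗[k] A, evalFst P (s * t) h = LinearMap.mul' k A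
      (TensorProduct.map (evalFst P s) (evalFst P t) (swap (Coalgebra.comul h))) := by
    intro s t
    induction s, t using quad_induction with
    | h0 t => simp
    | h0' t => simp
    | ha s s' t hs hs' =>
      simp only [add_mul, map_add, LinearMap.add_apply, TensorProduct.map_add_left, hs, hs']
    | ha' s t t' hs hs' =>
      simp only [mul_add, map_add, LinearMap.add_apply, TensorProduct.map_add_right, hs, hs']
    | h x x' y y' =>
      have h1 : evalFst P ((x ⊗ₜ x') * (y ⊗ₜ y')) h =
        P.form (HopfAlgebra.antipode k (x * y)) h • (x' * y') := by simp [evalFst]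
      rw [h1, HopfAlgebra.antipode_mul_antidistrib, P.mul_left]
      simp only [swap]
      generalize (Coalgebra.comul h : H ⊗[k] H) = t
      induction t with
      | zero => simp
      | add s t hs ht => simp only [map_add, add_smul, hs, ht]
      | tmul u v => simp [evalFst, smul_smul]
  have h1 : ∀ a, (leftEval P ∘ₗ HopfAlgebra.antipode k).flip a = evalFst P (Coalgebra.comul a) :=
    fun a => LinearMap.ext fun h => leftEval_antipode_eq P h a
  rw [leftEval_antipode_eq, Bialgebra.comul_mul, key, h1, h1]

theorem tensorOnDual_mul_act (s t : H ⊗[k] H) (a : A) : (tensorOnDual P).act (s * t) a =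
    (tensorOnDual P).act s ((tensorOnDual P).act t a) := by
  induction s, t using quad_induction with
  | h0 t => simp
  | h0' t => simp
  | ha s s' t hs hs' => simp only [add_mul, map_add, LinearMap.add_apply, hs, hs']
  | ha' s t t' hs hs' => simp only [mul_add, map_add, LinearMap.add_apply, hs, hs']
  | h x x' y y' =>
    rw [Algebra.TensorProduct.tmul_mul_tmul, tensorOnDual_act_tmul, tensorOnDual_act_tmul,
      tensorOnDual_act_tmul, HopfAlgebra.antipode_mul_antidistrib, leftEval_mul, rightEval_mul,
      leftEval_rightEval P _ x']

theorem tensorOnDual_act_mul_tmul (x : H ⊗[k] H) (a b : A) : (tensorOnDual P).act x (a * b) =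
    LinearMap.mul' k A ((tensorOnDual P).act₂ (comulE k H x) (a ⊗ₜ b)) := by
  induction x with
  | zero => simp
  | add s t hs ht => simp only [map_add, LinearMap.add_apply, hs, ht]
  | tmul φ h =>
    rw [tensorOnDual_act_tmul, rightEval_mul_right, comulE_tmul]
    generalize (Coalgebra.comul h : H ⊗[k] H) = t
    induction t with
    | zero => simp [quad₂₄_zero]
    | add s t hs ht => simp only [map_add, quad₂₄_add, mul_add, LinearMap.add_apply, hs, ht]
    | tmul u v =>
      simp only [TensorProduct.map_tmul, LinearMap.mul'_apply, LinearMap.flip_apply]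
      rw [leftEval_antipode_mul_right]
      generalize swap (Coalgebra.comul φ : H ⊗[k] H) = s
      induction s with
      | zero => simp [quad₁₃_zero]
      | add s t hs ht => simp only [map_add, quad₁₃_add, add_mul, LinearMap.add_apply, hs, ht]
      | tmul w z => simp [quad₁₃_tmul, quad₂₄_tmul, tensorOnDual_act_tmul]

/-- `A` is a module algebra over the Hopf algebra `Hᶜᵒᵖ ⊗ H`. -/
theorem isCovariantSystem_tensorOnDual
    (hS : Function.Bijective (HopfAlgebra.antipode k (A := H))) :
    (tensorOnDual P).IsCovariantSystem where
  hopf := by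
    obtain ⟨S', hS'⟩ : ∃ S' : H →ₗ[k] H, ∀ x, HopfAlgebra.antipode k (S' x) = x :=
      ⟨(LinearEquiv.ofBijective _ hS).symm, fun x => LinearEquiv.apply_symm_apply
        (LinearEquiv.ofBijective _ hS) x⟩
    have hc := (isHopfAlgebra_comul k H).cop isAntipode_antipode
      HopfAlgebra.antipode_mul_antidistrib HopfAlgebra.antipode_one hS.injective hS'
    exact hc.tensor (isHopfAlgebra_comul k H) (fun x y => by simp [tensorOnDual, mul_comm])
  mul_assoc := by ext; simp [tensorOnDual, mul_assoc]
  one_mul v := by simp [tensorOnDual]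
  mul_one v := by simp [tensorOnDual]
  one_act v := by
    rw [Algebra.TensorProduct.one_def, tensorOnDual_act_tmul, HopfAlgebra.antipode_one,
      leftEval_one_left, rightEval_one_left]
  mul_act := tensorOnDual_mul_act P
  act_mul x t := by
    induction t with
    | zero => simp
    | add s t hs ht => simp only [map_add, hs, ht]
    | tmul a b => exact tensorOnDual_act_mul_tmul P x a b
  act_one x := by
    induction x with
    | zero => simp
    | add s t hs ht => simp only [map_add, LinearMap.add_apply, add_smul, hs, ht]
    | tmul φ h =>
      rw [tensorOnDual_act_tmul]
      simp [tensorOnDual, leftEval_apply, rightEval_apply, Algebra.TensorProduct.one_def,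
        P.one_left, smul_smul]

/-- The left coadjoint action of `H` on `A` is the action of `Δ h`. -/
theorem coadAct_eq (h : H) (b : A) :
    coadAct P h b = (tensorOnDual P).act (Coalgebra.comul h) b := by
  have h1 : coadAct P h b =
    TensorProduct.rid k A ((P.form.flip h).lTensor A (adCoact (k := k) b)) := rfl
  let ℛ := Coalgebra.Repr.arbitrary k h
  rw [h1, ← ℛ.eq, map_sum, LinearMap.sum_apply, adCoact]
  simp only [tensorOnDual_act_tmul, biEval_apply, LinearMap.comp_apply]
  generalize comul₃ k A b = t
  induction t with
  | zero => simp
  | add s t hs ht => simp only [map_add, Finset.sum_add_distrib, hs, ht]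
  | tmul u t =>
    induction t with
    | zero => simp
    | add s t hs ht =>
      simp only [map_add, TensorProduct.tmul_add, Finset.sum_add_distrib, hs, ht]
    | tmul v w =>
      simp only [LinearEquiv.coe_coe, TensorProduct.leftComm_tmul, LinearMap.lTensor_tmul,
        LinearMap.comp_apply, LinearMap.rTensor_tmul, LinearMap.mul'_apply,
        TensorProduct.rid_tmul, LinearMap.flip_apply, P.mul_left]
      rw [← ℛ.eq]
      simp [P.antipode_right, smul_smul, Finset.sum_smul, mul_comm]

end TensorSystem

/-! ### The bicrossproduct and the cocycle -/

section Bicrossproduct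

variable {k H A : Type*} [Field k] [Ring H] [HopfAlgebra k H] [Ring A] [HopfAlgebra k A]

theorem theta₁Inv_tmul (φ h : H) :
    theta₁Inv k H (φ ⊗ₜ h) = (φ ⊗ₜ 1) * Coalgebra.comul h := rfl

theorem theta₁Inv_tmul_one_mul (φ : H) (t : H ⊗[k] H) :
    theta₁Inv k H ((φ ⊗ₜ 1) * t) = (φ ⊗ₜ 1) * theta₁Inv k H t := by
  induction t with
  | zero => simp
  | add s t hs ht => simp only [map_add, mul_add, hs, ht]
  | tmul u v => simp [theta₁Inv_tmul, ← mul_assoc]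

theorem theta₁Inv_theta₁ (x : H ⊗[k] H) : theta₁Inv k H (theta₁ k H x) = x := by
  induction x with
  | zero => simp
  | add s t hs ht => simp only [map_add, hs, ht]
  | tmul φ h =>
    have h0 : theta₁ k H (φ ⊗ₜ h) =
      (φ ⊗ₜ[k] (1 : H)) * (HopfAlgebra.antipode k).rTensor H (Coalgebra.comul h) := rfl
    have h1 : ∀ t : H ⊗[k] H, theta₁Inv k H ((HopfAlgebra.antipode k).rTensor H t) =
        LinearMap.mul' k (H ⊗[k] H) (TensorProduct.map ((TensorProduct.mk k H H).flip 1 ∘ₗ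
          HopfAlgebra.antipode k) Coalgebra.comul t) := by
      intro t
      induction t with
      | zero => simp
      | add s t hs ht => simp only [map_add, hs, ht]
      | tmul u v => simp [theta₁Inv_tmul]
    rw [h0, theta₁Inv_tmul_one_mul, h1, antipode_comul_cancel]
    simp

variable (k H) in
/-- The inverse of `θ₁` as an isomorphism of algebras. -/
def thetaOneInvEquiv : Bicross k H ≃ₐ[k] H ⊗[k] H :=
  { toFun := fun x => theta₁Inv k H ((Bicross.of k H).symm x)
    invFun := fun x => thetaOne k H x
    left_inv := fun x => theta₁_theta₁Inv ((Bicross.of k H).symm x)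
    right_inv := fun x => theta₁Inv_theta₁ x
    map_mul' := fun x y => theta₁Inv_mul ((Bicross.of k H).symm x) ((Bicross.of k H).symm y)
    map_add' := fun x y => by simp only [map_add]
    commutes' := fun r => by
      rw [Algebra.algebraMap_eq_smul_one, Algebra.algebraMap_eq_smul_one, map_smul, map_smul]
      exact congrArg (r • ·) theta₁Inv_one }

theorem thetaOneInvEquiv_of (x : H ⊗[k] H) :
    thetaOneInvEquiv k H (Bicross.of k H x) = theta₁Inv k H x := rfl

theorem thetaOneInvEquiv_symm_apply (x : H ⊗[k] H) :
    (thetaOneInvEquiv k H).symm x = thetaOne k H x := rfl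

/-- A triple convolution product in terms of the iterated coproduct. -/
theorem conv_mul_mul_apply {X : Type*} [Ring X] [Algebra k X] (F G K : WithConv (H →ₗ[k] X))
    (x : H) : (F * (G * K)).ofConv x = LinearMap.mul' k X (TensorProduct.map F.ofConv
      (LinearMap.mul' k X ∘ₗ TensorProduct.map G.ofConv K.ofConv) (comul₃ k H x)) := by
  rw [LinearMap.convMul_apply, comul₃, LinearMap.comp_apply]
  generalize (Coalgebra.comul x : H ⊗[k] H) = t
  induction t with
  | zero => simp
  | add s t hs ht => simp only [map_add, hs, ht]
  | tmul u v => simp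

/-- `Δ` of `Hᶜᵒᵖ ⊗ H` at `Δ h`, as a convolution product of legs. -/
theorem comulE_comul (h : H) : comulE k H (Coalgebra.comul h) =
    ((leg (quadTrd k H) * leg (quadFst k H)) *
      (leg (quadSnd k H) * leg (quadFth k H))).ofConv h := by
  rw [LinearMap.convMul_apply]
  generalize (Coalgebra.comul h : H ⊗[k] H) = t
  induction t with
  | zero => simp
  | add s t hs ht => simp only [map_add, hs, ht]
  | tmul u v =>
    rw [comulE_tmul, TensorProduct.map_tmul, LinearMap.mul'_apply, leg_mul_leg_apply,
      leg_mul_leg_apply, quad₁₃_eq, quad₂₄_eq, legs_swap (commutingLegs_incl_incr.comp _ _)]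

variable (k H) in
/-- `h ↦ (1 ⊗ h₂) ⊗ (h₁ (S h₃) ⊗ h₄)`. -/
def bicrossComulRight : H →ₗ[k] (H ⊗[k] H) ⊗[k] (H ⊗[k] H) :=
  (inr k H).rTensor (H ⊗[k] H) ∘ₗ (TensorProduct.assoc k H H H).toLinearMap ∘ₗ
    (coadCoact k H).rTensor H ∘ₗ Coalgebra.comul

theorem bicrossComul_tmul (φ h : H) : bicrossComul k H (φ ⊗ₜ h) =
    quad₁₃ (swap (Coalgebra.comul φ)) * bicrossComulRight k H h := rfl

theorem map_theta₁Inv_quad₁₃_mul (s : H ⊗[k] H) (t : (H ⊗[k] H) ⊗[k] (H ⊗[k] H)) :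
    TensorProduct.map (theta₁Inv k H) (theta₁Inv k H) (quad₁₃ s * t) =
      quad₁₃ s * TensorProduct.map (theta₁Inv k H) (theta₁Inv k H) t := by
  induction s with
  | zero => simp [quad₁₃_zero]
  | add s t hs ht => simp only [quad₁₃_add, add_mul, map_add, hs, ht]
  | tmul x y =>
    induction t with
    | zero => simp
    | add s t hs ht => simp only [mul_add, map_add, hs, ht]
    | tmul u v => simp [quad₁₃_tmul, theta₁Inv_tmul_one_mul]

/-- `θ₁⁻¹ ⊗ θ₁⁻¹` maps `(1 ⊗ h₂) ⊗ (h₁ (S h₃) ⊗ h₄)` to `(h₂ ⊗ h₃) ⊗ (h₁ ⊗ h₄)`: in the last factor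
`θ₁⁻¹` multiplies by a further part of `h`, which cancels `S h₃`. -/
theorem map_theta₁Inv_bicrossComulRight (h : H) :
    TensorProduct.map (theta₁Inv k H) (theta₁Inv k H) (bicrossComulRight k H h) =
      comulE k H (Coalgebra.comul h) := by
  -- the left-hand side, with a cancelling pair `(S h₄) h₅` inserted in the third leg
  have e : (leg (quadTrd k H) * leg (quadFst k H)) * (leg (quadSnd k H) * leg (quadFth k H)) =
      (leg (quadTrd k H) * ((leg (quadFst k H) * leg (quadSnd k H)) * legInv (quadTrd k H))) *
        (leg (quadTrd k H) * leg (quadFth k H)) := by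
    simp only [mul_assoc, legInv_mul_leg_mul]
  rw [comulE_comul, e, LinearMap.convMul_apply, bicrossComulRight]
  simp only [LinearMap.comp_apply]
  generalize (Coalgebra.comul h : H ⊗[k] H) = t
  induction t with
  | zero => simp
  | add s t hs ht => simp only [map_add, hs, ht]
  | tmul x y =>
    rw [TensorProduct.map_tmul, conv_mul_mul_apply, leg_mul_leg_apply, LinearMap.rTensor_tmul,
      coadCoact]
    simp only [LinearMap.comp_apply]
    generalize comul₃ k H x = t
    induction t with
    | zero => simp
    | add s t hs ht => simp only [map_add, TensorProduct.add_tmul, hs, ht,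
        LinearMap.mul'_apply] at *
    | tmul x₁ t =>
      induction t with
      | zero => simp
      | add s t hs ht => simp only [map_add, TensorProduct.add_tmul, TensorProduct.tmul_add,
          hs, ht, LinearMap.mul'_apply] at *
      | tmul x₂ x₃ =>
        simp only [LinearEquiv.coe_coe, TensorProduct.leftComm_tmul, LinearMap.lTensor_tmul,
          LinearMap.comp_apply, LinearMap.mul'_apply, TensorProduct.assoc_tmul,
          LinearMap.rTensor_tmul, TensorProduct.map_tmul, leg_mul_leg_apply, theta₁Inv_tmul, inr,
          TensorProduct.mk_apply, leg_apply, legInv_apply]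
        generalize (Coalgebra.comul x₂ : H ⊗[k] H) = s
        generalize (Coalgebra.comul y : H ⊗[k] H) = t
        induction s, t using quad_induction with
        | h0 t => simp
        | h0' t => simp
        | ha s s' t hs hs' => simp only [map_add, mul_add, add_mul, TensorProduct.add_tmul, hs, hs']
        | ha' s t t' hs hs' => simp only [map_add, mul_add, TensorProduct.tmul_add, hs, hs']
        | h u u' v v' => simp [mul_assoc]

/-- `θ₁⁻¹` respects the coproducts. -/
theorem map_theta₁Inv_bicrossComul (x : H ⊗[k] H) :
    TensorProduct.map (theta₁Inv k H) (theta₁Inv k H) (bicrossComul k H x) =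
      comulE k H (theta₁Inv k H x) := by
  induction x with
  | zero => simp
  | add s t hs ht => simp only [map_add, hs, ht]
  | tmul φ h =>
    rw [bicrossComul_tmul, map_theta₁Inv_quad₁₃_mul, map_theta₁Inv_bicrossComulRight,
      theta₁Inv_tmul, map_mul, comulE_tmul, Bialgebra.comul_one, quad₂₄_one, mul_one]

theorem mapTwo_thetaOneInvEquiv (x : Bicross k H) :
    mapTwo (thetaOneInvEquiv k H) (Bicross.comul k H x) = comulE k H (thetaOneInvEquiv k H x) := by
  refine Eq.trans ?_ (map_theta₁Inv_bicrossComul ((Bicross.of k H).symm x))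
  have : Bicross.comul k H x = TensorProduct.map (Bicross.of k H).toLinearMap
    (Bicross.of k H).toLinearMap (bicrossComul k H ((Bicross.of k H).symm x)) := rfl
  rw [this]
  generalize bicrossComul k H ((Bicross.of k H).symm x) = t
  induction t with
  | zero => simp
  | add s t hs ht => simp only [map_add, hs, ht]
  | tmul u v => rfl

theorem counit_theta₁Inv (x : H ⊗[k] H) :
    Coalgebra.counit (R := k) (theta₁Inv k H x) = Coalgebra.counit (R := k) x := by
  induction x with
  | zero => simp
  | add s t hs ht => simp only [map_add, hs, ht]
  | tmul φ h =>
    have h1 : ∀ t : H ⊗[k] H, Coalgebra.counit (R := k) ((φ ⊗ₜ[k] 1) * t) =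
        Coalgebra.counit (R := k) φ * Coalgebra.counit (R := k)
          (TensorProduct.lid k H (Coalgebra.counit.rTensor H t)) := by
      intro t
      induction t with
      | zero => simp
      | add s t hs ht => simp only [map_add, mul_add, hs, ht]
      | tmul u v => simp [mul_comm, mul_left_comm]
    rw [theta₁Inv_tmul, h1, Coalgebra.rTensor_counit_comul]
    simp [mul_comm]

variable (P : HopfPairing k H A)

/-- `B` acts on `A` through `θ₁⁻¹` and the action of `Hᶜᵒᵖ ⊗ H`. -/
theorem mirrorOnDual_act (x : Bicross k H) (a : A) :
    (mirrorOnDual P).act x a = (tensorOnDual P).act (thetaOneInvEquiv k H x) a := by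
  obtain ⟨x, rfl⟩ := (Bicross.of k H).surjective x
  rw [thetaOneInvEquiv_of]
  induction x with
  | zero => simp
  | add s t hs ht => simp only [map_add, LinearMap.add_apply, hs, ht]
  | tmul φ h =>
    rw [theta₁Inv_tmul]
    have h1 : (mirrorOnDual P).act (Bicross.of k H (φ ⊗ₜ h)) a =
      biEval P (((LinearMap.mul k H).flip (HopfAlgebra.antipode k φ) ∘ₗ
      HopfAlgebra.antipode k).rTensor H (Coalgebra.comul h)) a := rfl
    rw [h1]
    generalize (Coalgebra.comul h : H ⊗[k] H) = t
    induction t with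
    | zero => simp
    | add s t hs ht => simp only [map_add, mul_add, LinearMap.add_apply, hs, ht]
    | tmul u v =>
      rw [Algebra.TensorProduct.tmul_mul_tmul, tensorOnDual_act_tmul,
        HopfAlgebra.antipode_mul_antidistrib, one_mul]
      rfl

/-- `(θ₁⁻¹, id)` is an isomorphism from `(B, A)` to `(Hᶜᵒᵖ ⊗ H, A)`. -/
theorem isIso_mirrorOnDual_tensorOnDual :
    (mirrorOnDual P).IsIso (tensorOnDual P) (thetaOneInvEquiv k H) (LinearEquiv.refl k A) where
  comul := mapTwo_thetaOneInvEquiv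
  counit x := counit_theta₁Inv ((Bicross.of k H).symm x)
  mul _ _ := rfl
  one := rfl
  act := mirrorOnDual_act P

/-- `(θ₁, id)` is an isomorphism from `(Hᶜᵒᵖ ⊗ H, A)` to `(B, A)`. -/
theorem isIso_tensorOnDual_mirrorOnDual :
    (tensorOnDual P).IsIso (mirrorOnDual P) (thetaOneInvEquiv k H).symm (LinearEquiv.refl k A) :=
  (isIso_mirrorOnDual_tensorOnDual P).symm

end Bicrossproduct

section Cocycle

variable {k H X : Type*} [Field k] [Ring H] [HopfAlgebra k H] [Ring X] [Algebra k X]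
  {R : H ⊗[k] H}

/-- The Yang-Baxter equation for `R⁻¹`. -/
theorem IsQuasitriangular.yangBaxter_inverse (hR : IsQuasitriangular Coalgebra.comul R)
    {f g h : H →ₐ[k] X} (hfg : CommutingLegs f g) (hfh : CommutingLegs f h)
    (hgh : CommutingLegs g h) :
    legs f g (Ring.inverse R) * legs f h (Ring.inverse R) * legs g h (Ring.inverse R) =
      legs g h (Ring.inverse R) * legs f h (Ring.inverse R) * legs f g (Ring.inverse R) := by
  have cancel_left {u v : H →ₐ[k] X} (h : CommutingLegs u v) (x : X) :
      legs u v (Ring.inverse R) * (legs u v R * x) = x := by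
    rw [← mul_assoc, legs_inverse_mul h hR.isUnit, one_mul]
  have cancel_right {u v : H →ₐ[k] X} (h : CommutingLegs u v) (x : X) :
      legs u v R * (legs u v (Ring.inverse R) * x) = x := by
    rw [← mul_assoc, legs_mul_inverse h hR.isUnit, one_mul]
  refine eq_of_mul_eq_one (b := legs g h R * legs f h R * legs f g R) ?_ ?_
  · simp only [mul_assoc]
    rw [cancel_left hgh, cancel_left hfh, legs_inverse_mul hfg hR.isUnit]
  · rw [← hR.yangBaxter hfg hfh hgh]
    simp only [mul_assoc]
    rw [cancel_right hgh, cancel_right hfh, legs_mul_inverse hfg hR.isUnit]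

/-- `χ = (Δ ⊗ id) R⁻¹`, with the second factor in the third of the four legs. -/
theorem chi_eq_legs (hR : IsQuasitriangular Coalgebra.comul R) : chi R =
    legs ((incl k (H ⊗[k] H) _).comp (Bialgebra.comulAlgHom k H)) (quadTrd k H)
      (Ring.inverse R) := by
  have hp : ∀ x, (incl k (H ⊗[k] H) (H ⊗[k] H)).comp (Bialgebra.comulAlgHom k H) x =
      legs (quadFst k H) (quadSnd k H) (Coalgebra.comul x) := fun x => by
    rw [← map_legs, legs_incl_incr]; rfl
  rw [hR.legs_left_inverse hp (commutingLegs_incl_incr.map _) (commutingLegs_incl_incr.comp _ _)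
    (commutingLegs_incl_incr.comp _ _), chi, quad₂₃_eq, quad₁₃_eq]

theorem isUnit_chi (hR : IsQuasitriangular Coalgebra.comul R) : IsUnit (chi R) :=
  (isUnit_quad₂₃ hR.isUnit.ringInverse).mul (isUnit_quad₁₃ hR.isUnit.ringInverse)

/-- `χ⁻¹ = (Δ ⊗ id) R`, with the second factor in the third of the four legs. -/
theorem chi_inverse (hR : IsQuasitriangular Coalgebra.comul R) : Ring.inverse (chi R) =
    legs ((incl k (H ⊗[k] H) _).comp (Bialgebra.comulAlgHom k H)) (quadTrd k H) R :=
  ring_inverse_eq_of_mul_eq_one (by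
    rw [chi_eq_legs hR, legs_mul_inverse (commutingLegs_incl_incr.comp _ _) hR.isUnit])
    (isUnit_chi hR)

/-- `θ₁ ⊗ θ₁` carries `R₂₃⁻¹ R₁₃⁻¹ = (Δ ⊗ id) R⁻¹` to `R₂₃⁻¹`. -/
theorem mapTwo_thetaOne_chi (hR : IsQuasitriangular Coalgebra.comul R) :
    mapTwo (thetaOneInvEquiv k H).symm (chi R) = chiMirror R := by
  have h1 : ∀ x : H, (thetaOneInvEquiv k H).symm (Coalgebra.comul x) =
      Bicross.of k H (1 ⊗ₜ x) := fun x => by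
    rw [AlgEquiv.symm_apply_eq, thetaOneInvEquiv_of, theta₁Inv_tmul,
      ← Algebra.TensorProduct.one_def, one_mul]
  have h2 : ∀ x : H, (thetaOneInvEquiv k H).symm (x ⊗ₜ 1) = Bicross.of k H (x ⊗ₜ 1) := fun x => by
    rw [AlgEquiv.symm_apply_eq, thetaOneInvEquiv_of, theta₁Inv_tmul, Bialgebra.comul_one, mul_one]
  rw [chi_eq_legs hR, chiMirror, quad₂₃]
  generalize Ring.inverse R = t
  induction t with
  | zero => simp
  | add s t hs ht => simp only [map_add, hs, ht]
  | tmul x y => simp [h1, h2, inl, inr]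

theorem lid_quad₁₃ (t : H ⊗[k] H) : TensorProduct.lid k (H ⊗[k] H)
    ((Coalgebra.counit (R := k) (A := H ⊗[k] H)).rTensor (H ⊗[k] H) (quad₁₃ t)) =
      (TensorProduct.lid k H (Coalgebra.counit.rTensor H t)) ⊗ₜ 1 := by
  induction t with
  | zero => simp [quad₁₃_zero]
  | add s t hs ht => simp only [quad₁₃_add, map_add, TensorProduct.add_tmul, hs, ht]
  | tmul x y => simp [quad₁₃_tmul, TensorProduct.smul_tmul']

theorem lid_quad₂₃ (t : H ⊗[k] H) : TensorProduct.lid k (H ⊗[k] H)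
    ((Coalgebra.counit (R := k) (A := H ⊗[k] H)).rTensor (H ⊗[k] H) (quad₂₃ t)) =
      (TensorProduct.lid k H (Coalgebra.counit.rTensor H t)) ⊗ₜ 1 := by
  induction t with
  | zero => simp [quad₂₃]
  | add s t hs ht =>
    simp only [quad₂₃, map_add, TensorProduct.add_tmul] at *
    rw [hs, ht]
  | tmul x y => simp [quad₂₃_tmul, TensorProduct.smul_tmul']

theorem rid_quad₁₃ (t : H ⊗[k] H) : TensorProduct.rid k (H ⊗[k] H)
    ((Coalgebra.counit (R := k) (A := H ⊗[k] H)).lTensor (H ⊗[k] H) (quad₁₃ t)) =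
      (TensorProduct.rid k H (Coalgebra.counit.lTensor H t)) ⊗ₜ 1 := by
  induction t with
  | zero => simp [quad₁₃_zero]
  | add s t hs ht => simp only [quad₁₃_add, map_add, TensorProduct.add_tmul, hs, ht]
  | tmul x y => simp [quad₁₃_tmul, TensorProduct.smul_tmul']

theorem rid_quad₂₃ (t : H ⊗[k] H) : TensorProduct.rid k (H ⊗[k] H)
    ((Coalgebra.counit (R := k) (A := H ⊗[k] H)).lTensor (H ⊗[k] H) (quad₂₃ t)) =
      1 ⊗ₜ (TensorProduct.rid k H (Coalgebra.counit.lTensor H t)) := by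
  induction t with
  | zero => simp [quad₂₃]
  | add s t hs ht =>
    simp only [quad₂₃, map_add, TensorProduct.tmul_add] at *
    rw [hs, ht]
  | tmul x y => simp [quad₂₃_tmul]

theorem IsQuasitriangular.counit_left_inverse (hR : IsQuasitriangular Coalgebra.comul R) :
    TensorProduct.lid k H (Coalgebra.counit.rTensor H (Ring.inverse R)) = 1 :=
  (isHopfAlgebra_comul k H).lid_inverse hR.isUnit hR.counit_left

theorem IsQuasitriangular.counit_right_inverse (hR : IsQuasitriangular Coalgebra.comul R) :
    TensorProduct.rid k H (Coalgebra.counit.lTensor H (Ring.inverse R)) = 1 := by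
  have h := hR.comul_swap_inverse.counit_left
  rw [← h]
  simp only [swap]
  generalize Ring.inverse R = t
  induction t with
  | zero => simp
  | add s t hs ht => simp only [map_add, hs, ht]
  | tmul x y => simp

/-- `(id ⊗ ε) χ = 1`, which complements the condition `(ε ⊗ id) χ = 1` of a twisting cocycle. -/
theorem rid_chi (hR : IsQuasitriangular Coalgebra.comul R)
    (hE : IsHopfAlgebra (comulE k H).toLinearMap (Coalgebra.counit (R := k))) :
    TensorProduct.rid k (H ⊗[k] H) (Coalgebra.counit.lTensor (H ⊗[k] H) (chi R)) = 1 := by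
  rw [chi, hE.rid_mul, rid_quad₁₃, rid_quad₂₃, hR.counit_right_inverse,
    ← Algebra.TensorProduct.one_def, one_mul]

/-- The reordering behind the cocycle identity for `χ`: three commutation relations and two
Yang-Baxter relations. -/
theorem cocycle_word {p q w r s u : X} (h₁ : Commute p w) (h₂ : Commute q w) (h₃ : Commute q r)
    (h₄ : q * s * u = u * s * q) (h₅ : p * r * u = u * r * p) :
    p * q * (w * r * (s * u)) = w * u * (r * p * (s * q)) := calc
  _ = p * (q * w) * r * s * u := by simp only [mul_assoc]
  _ = (p * w) * (q * r) * s * u := by rw [h₂.eq]; simp only [mul_assoc]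
  _ = w * p * r * (q * s * u) := by rw [h₁.eq, h₃.eq]; simp only [mul_assoc]
  _ = w * (p * r * u) * s * q := by rw [h₄]; simp only [mul_assoc]
  _ = _ := by rw [h₅]; simp only [mul_assoc]

/-- `R₂₃⁻¹ R₁₃⁻¹` is a twisting cocycle of `Hᶜᵒᵖ ⊗ H`. -/
theorem isTwistingCocycle_chi (hR : IsQuasitriangular Coalgebra.comul R)
    (hE : IsHopfAlgebra (comulE k H).toLinearMap (Coalgebra.counit (R := k))) :
    IsTwistingCocycle (comulE k H).toLinearMap (Coalgebra.counit (R := k)) (chi R) where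
  isUnit := isUnit_chi hR
  cocycle := by
    have hi : CommutingLegs (incl k H H) (incr k H H) := commutingLegs_incl_incr
    have c₁₂ : CommutingLegs (fst₃ k (H ⊗[k] H)) (snd₃ k (H ⊗[k] H)) := comm₁₂
    have c₁₃ : CommutingLegs (fst₃ k (H ⊗[k] H)) (trd₃ k (H ⊗[k] H)) := comm₁₃
    have c₂₃ : CommutingLegs (snd₃ k (H ⊗[k] H)) (trd₃ k (H ⊗[k] H)) := comm₂₃
    have cp := commutingLegs_of_apply (comulFirst_apply (comulE k H)) c₁₃ c₂₃
    have cq := (commutingLegs_of_apply (incr_comp_apply (comulE k H)) c₁₂.symm c₁₃.symm).symm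
    have hp₁ : ∀ x, (comulFirst (comulE k H)).comp (incl k H H) x =
        legs ((snd₃ k (H ⊗[k] H)).comp (incl k H H)) ((fst₃ k (H ⊗[k] H)).comp (incl k H H))
          (Coalgebra.comul x) := fun x => by
      rw [AlgHom.comp_apply, comulFirst_apply, comulE, tensorComul_incl, legs_quad₁₃,
        copComul_apply, legs_swap (c₁₂.comp _ _)]
      rfl
    have hp₂ : ∀ x, (comulFirst (comulE k H)).comp (incr k H H) x =
        legs ((fst₃ k (H ⊗[k] H)).comp (incr k H H)) ((snd₃ k (H ⊗[k] H)).comp (incr k H H))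
          (Coalgebra.comul x) := fun x => by
      rw [AlgHom.comp_apply, comulFirst_apply, comulE, tensorComul_incr, legs_quad₂₄]
      rfl
    have hq : ∀ x, ((incr k (H ⊗[k] H) _).comp (comulE k H)).comp (incl k H H) x =
        legs ((trd₃ k (H ⊗[k] H)).comp (incl k H H)) ((snd₃ k (H ⊗[k] H)).comp (incl k H H))
          (Coalgebra.comul x) := fun x => by
      rw [AlgHom.comp_apply, incr_comp_apply, comulE, tensorComul_incl, legs_quad₁₃,
        copComul_apply, legs_swap (c₂₃.comp _ _)]
      rfl
    rw [assoc_rTensor_eq_legs, lTensor_eq_legs, leg₁₂_eq, leg₂₃_eq, chi, legs_mul c₁₂, legs_mul cp,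
      legs_mul c₂₃, legs_mul cq]
    simp only [legs_quad₁₃, legs_quad₂₃]
    rw [hR.legs_left_inverse hp₁ (c₁₂.symm.comp _ _) (c₂₃.comp _ _) (c₁₃.comp _ _),
      hR.legs_left_inverse hp₂ (c₁₂.comp _ _) (c₁₃.comp _ _) (c₂₃.comp _ _),
      hR.legs_right_inverse hq (c₂₃.symm.comp _ _) (c₁₃.comp _ _) (c₁₂.comp _ _),
      hR.legs_right_inverse hq (c₂₃.symm.comp _ _) (c₁₃.comp _ _) (c₁₂.comp _ _)]
    -- with the six legs of `(H ⊗ H)⊗³` written `a₁, b₁, a₂, b₂, a₃, b₃`: the Yang-Baxter equation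
    -- in `a₁, a₂, a₃` and in `b₁, a₂, a₃`; elements in the legs `b₁ a₂` and `b₂ a₃`, in `a₁ a₂`
    -- and `b₂ a₃`, in `a₁ a₂` and `b₁ a₃` commute
    have y₁ := hR.yangBaxter_inverse (c₁₂.comp (incl k H H) (incl k H H))
      (c₁₃.comp (incl k H H) (incl k H H)) (c₂₃.comp (incl k H H) (incl k H H))
    have y₂ := hR.yangBaxter_inverse (c₁₂.comp (incr k H H) (incl k H H))
      (c₁₃.comp (incr k H H) (incl k H H)) (c₂₃.comp (incl k H H) (incl k H H))
    have m₁ := commute_legs_legs (c₁₂.comp (incr k H H) (incr k H H))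
      (c₁₃.comp (incr k H H) (incl k H H)) (hi.map (snd₃ k (H ⊗[k] H)))
      (c₂₃.comp (incl k H H) (incl k H H)) (Ring.inverse R) (Ring.inverse R)
    have m₂ := commute_legs_legs (c₁₂.comp (incl k H H) (incr k H H))
      (c₁₃.comp (incl k H H) (incl k H H)) (hi.map (snd₃ k (H ⊗[k] H)))
      (c₂₃.comp (incl k H H) (incl k H H)) (Ring.inverse R) (Ring.inverse R)
    have m₃ := commute_legs_legs (hi.map (fst₃ k (H ⊗[k] H)))
      (c₁₃.comp (incl k H H) (incl k H H)) (c₁₂.symm.comp (incl k H H) (incr k H H))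
      (c₂₃.comp (incl k H H) (incl k H H)) (Ring.inverse R) (Ring.inverse R)
    exact cocycle_word m₁ m₂ m₃ y₁ y₂
  counit := by
    rw [chi, hE.lid_mul, lid_quad₁₃, lid_quad₂₃, hR.counit_left_inverse,
      ← Algebra.TensorProduct.one_def, one_mul]

end Cocycle

/-! ### Evaluation of the last leg, and `θ₂` on the dual factor -/

section EvalLast

variable {k H A X Y : Type*} [Field k] [Ring H] [HopfAlgebra k H] [Ring A] [HopfAlgebra k A]
  [Ring X] [Algebra k X] [Ring Y] [Algebra k Y] (P : HopfPairing k H A)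

/-- `x ⊗ h, a ↦ ⟨a, h⟩ x`: evaluation of the last leg against `a`. -/
def evalLast : X ⊗[k] H →ₗ[k] A →ₗ[k] X :=
  TensorProduct.lift (LinearMap.mk₂ k (fun x h => (P.form.flip h).smulRight x)
    (by intros; ext; simp) (by intros; ext; simp [smul_smul, mul_comm])
    (by intros; ext; simp [add_smul]) (by intros; ext; simp [mul_smul]))

@[simp] theorem evalLast_tmul (x : X) (h : H) (a : A) :
    evalLast P (x ⊗ₜ h) a = P.form a h • x := rfl

/-- Evaluation of the last leg turns products into convolution products. -/
theorem evalLast_mul (s t : X ⊗[k] H) (a : A) : evalLast P (s * t) a =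
    LinearMap.mul' k X (TensorProduct.map (evalLast P s) (evalLast P t) (Coalgebra.comul a)) := by
  induction s, t using quad_induction with
  | h0 t => simp
  | h0' t => simp
  | ha s s' t hs hs' =>
    simp only [add_mul, map_add, LinearMap.add_apply, TensorProduct.map_add_left, hs, hs']
  | ha' s t t' hs hs' =>
    simp only [mul_add, map_add, LinearMap.add_apply, TensorProduct.map_add_right, hs, hs']
  | h x x' y y' =>
    rw [Algebra.TensorProduct.tmul_mul_tmul, evalLast_tmul, P.mul_right]
    generalize (Coalgebra.comul a : A ⊗[k] A) = t
    induction t with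
    | zero => simp
    | add s t hs ht => simp only [map_add, add_smul, hs, ht]
    | tmul u v => simp [smul_smul, mul_comm]

theorem evalLast_incl_mul (x : X) (t : X ⊗[k] H) (a : A) :
    evalLast P (incl k X H x * t) a = x * evalLast P t a := by
  induction t with
  | zero => simp
  | add s t hs ht => simp only [mul_add, map_add, LinearMap.add_apply, hs, ht]
  | tmul u v => simp

theorem evalLast_mul_incl (x : X) (t : X ⊗[k] H) (a : A) :
    evalLast P (t * incl k X H x) a = evalLast P t a * x := by
  induction t with
  | zero => simp
  | add s t hs ht => simp only [add_mul, map_add, LinearMap.add_apply, hs, ht]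
  | tmul u v => simp

theorem form_leftEval (x z : H) (b : A) : P.form (leftEval P x b) z = P.form b (x * z) := by
  rw [P.mul_right, leftEval_apply]
  generalize (Coalgebra.comul b : A ⊗[k] A) = t
  induction t with
  | zero => simp
  | add s t hs ht => simp only [map_add, LinearMap.add_apply, hs, ht]
  | tmul u v => simp

theorem form_rightEval (y z : H) (b : A) : P.form (rightEval P y b) z = P.form b (z * y) := by
  rw [P.mul_right, rightEval_apply]
  generalize (Coalgebra.comul b : A ⊗[k] A) = t
  induction t with
  | zero => simp
  | add s t hs ht => simp only [map_add, LinearMap.add_apply, hs, ht]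
  | tmul u v => simp [mul_comm]

/-- Multiplying the last leg by `x` from the left and by `y` from the right amounts to evaluating
it against `⟨x, a₁⟩ a₂ ⟨y, a₃⟩`. -/
theorem evalLast_incr_mul_mul (x y : H) (t : X ⊗[k] H) (a : A) :
    evalLast P (incr k X H x * t * incr k X H y) a = evalLast P t (biEval P (x ⊗ₜ y) a) := by
  induction t with
  | zero => simp
  | add s t hs ht => simp only [add_mul, mul_add, map_add, LinearMap.add_apply, hs, ht]
  | tmul u v => simp [biEval_tmul, form_leftEval, form_rightEval]

theorem map_evalLast (φ : X →ₐ[k] Y) (t : X ⊗[k] H) (a : A) :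
    φ (evalLast P t a) = evalLast P (Algebra.TensorProduct.map φ (AlgHom.id k H) t) a := by
  induction t with
  | zero => simp
  | add s t hs ht => simp only [map_add, LinearMap.add_apply, hs, ht]
  | tmul u v => simp

/-- A corepresentation `t`, `(id ⊗ Δ) t = t₁₃ t₁₂`, evaluates to an antimultiplicative map. -/
theorem evalLast_mul_right {t : X ⊗[k] H}
    (h : Algebra.TensorProduct.map (AlgHom.id k X) (Bialgebra.comulAlgHom k H) t =
      legs (incl k X (H ⊗[k] H)) ((incr k X _).comp (incr k H H)) t *
        legs (incl k X (H ⊗[k] H)) ((incr k X _).comp (incl k H H)) t) (a b : A) :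
    evalLast P t (a * b) = evalLast P t b * evalLast P t a := by
  let E : X ⊗[k] (H ⊗[k] H) →ₗ[k] X := (TensorProduct.rid k X).toLinearMap ∘ₗ
    (LinearMap.mul' k k ∘ₗ TensorProduct.map (P.form a) (P.form b)).lTensor X
  have h1 : ∀ t : X ⊗[k] H, evalLast P t (a * b) =
      E (Algebra.TensorProduct.map (AlgHom.id k X) (Bialgebra.comulAlgHom k H) t) := by
    intro t
    induction t with
    | zero => simp
    | add s t hs ht => simp only [map_add, LinearMap.add_apply, hs, ht]
    | tmul x y =>
      simp only [evalLast_tmul, P.mul_left, Algebra.TensorProduct.map_tmul, AlgHom.id_apply,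
        Bialgebra.comulAlgHom_apply]
      generalize (Coalgebra.comul y : H ⊗[k] H) = t
      induction t with
      | zero => simp
      | add s t hs ht => simp only [map_add, TensorProduct.tmul_add, add_smul, hs, ht]
      | tmul u v => simp [E]
  have h2 : ∀ s t : X ⊗[k] H, E (legs (incl k X (H ⊗[k] H)) ((incr k X _).comp (incr k H H)) s *
      legs (incl k X (H ⊗[k] H)) ((incr k X _).comp (incl k H H)) t) =
        evalLast P s b * evalLast P t a := by
    intro s t
    induction s, t using quad_induction with
    | h0 t => simp
    | h0' t => simp
    | ha s s' t hs hs' => simp only [add_mul, map_add, LinearMap.add_apply, hs, hs']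
    | ha' s t t' hs hs' => simp only [mul_add, map_add, LinearMap.add_apply, hs, hs']
    | h x x' y y' => simp [E, smul_smul]
  rw [h1, h, h2]

end EvalLast

section ThetaTwo

variable {k H A : Type*} [Field k] [Ring H] [HopfAlgebra k H] [Ring A] [HopfAlgebra k A]
  (P : HopfPairing k H A) {R : H ⊗[k] H}

local notation "S" => HopfAlgebra.antipode k

variable (k H) in
/-- The first leg of `(H ⊗ H) ⊗ H`. -/
abbrev tripFst : H →ₐ[k] (H ⊗[k] H) ⊗[k] H := (incl k (H ⊗[k] H) H).comp (incl k H H)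

variable (k H) in
/-- The second leg of `(H ⊗ H) ⊗ H`. -/
abbrev tripSnd : H →ₐ[k] (H ⊗[k] H) ⊗[k] H := (incl k (H ⊗[k] H) H).comp (incr k H H)

variable (k H) in
/-- The third leg of `(H ⊗ H) ⊗ H`. -/
abbrev tripTrd : H →ₐ[k] (H ⊗[k] H) ⊗[k] H := incr k (H ⊗[k] H) H

theorem commTrip₁₂ : CommutingLegs (tripFst k H) (tripSnd k H) :=
  CommutingLegs.map commutingLegs_incl_incr _

theorem commTrip₁₃ : CommutingLegs (tripFst k H) (tripTrd k H) := fun x y =>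
  (commutingLegs_incl_incr : CommutingLegs (incl k (H ⊗[k] H) H) (incr k (H ⊗[k] H) H))
    (incl k H H x) y

theorem commTrip₂₃ : CommutingLegs (tripSnd k H) (tripTrd k H) := fun x y =>
  (commutingLegs_incl_incr : CommutingLegs (incl k (H ⊗[k] H) H) (incr k (H ⊗[k] H) H))
    (incr k H H x) y

theorem contractThird_leg_mul_leg (s t : H ⊗[k] H) (a : A) :
    contractThird P (leg₁₃ s * leg₂₃ t) a = evalLast P
      (legs (tripFst k H) (tripTrd k H) s * legs (tripSnd k H) (tripTrd k H) t) a := by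
  have h1 : ∀ t : H ⊗[k] (H ⊗[k] H), contractThird P t a =
    ((TensorProduct.rid k H).toLinearMap ∘ₗ (P.form a).lTensor H).lTensor H t := fun _ => rfl
  induction s with
  | zero => simp [leg₁₃, h1]
  | add s s' hs hs' =>
    simp only [h1, leg₁₃, map_add, add_mul, LinearMap.add_apply] at *
    rw [hs, hs']
  | tmul x y =>
    induction t with
    | zero => simp [leg₂₃, h1]
    | add s t hs ht =>
      simp only [h1, leg₂₃, map_add, mul_add, LinearMap.add_apply] at *
      rw [hs, ht]
    | tmul u v => simp [leg₁₃, leg₂₃, inr, h1]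

/-- `R₃₁⁻¹ R₂₃` in `(H ⊗ H) ⊗ H`. -/
def doubleLeg (R : H ⊗[k] H) : (H ⊗[k] H) ⊗[k] H :=
  legs (tripTrd k H) (tripFst k H) (Ring.inverse R) * legs (tripSnd k H) (tripTrd k H) R

/-- `R₃₁⁻¹ R₂₃` with the first two legs placed by `f` and the third by `g`. -/
theorem legs_doubleLeg {Y : Type*} [Ring Y] [Algebra k Y] {f : H ⊗[k] H →ₐ[k] Y} {g : H →ₐ[k] Y}
    (h : CommutingLegs f g) : legs f g (doubleLeg R) =
      legs g (f.comp (incl k H H)) (Ring.inverse R) * legs (f.comp (incr k H H)) g R := by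
  have h₁ : (Algebra.TensorProduct.lift f g h).comp (tripFst k H) = f.comp (incl k H H) :=
    AlgHom.ext fun x => by rw [AlgHom.comp_apply, lift_eq_legs]; simp
  have h₂ : (Algebra.TensorProduct.lift f g h).comp (tripSnd k H) = f.comp (incr k H H) :=
    AlgHom.ext fun x => by rw [AlgHom.comp_apply, lift_eq_legs]; simp
  have h₃ : (Algebra.TensorProduct.lift f g h).comp (tripTrd k H) = g :=
    AlgHom.ext fun x => by rw [AlgHom.comp_apply, lift_eq_legs]; simp
  rw [← lift_eq_legs _ _ h, doubleLeg, map_mul, map_legs, map_legs, h₁, h₂, h₃]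

/-- The value of `θ₂` on `1 ⊗ a`. -/
def thetaTwoDual (R : H ⊗[k] H) : A →ₗ[k] H ⊗[k] H := evalLast P (doubleLeg R)

theorem thetaTwo_of (h : H) (a : A) : thetaTwo P R (Double.of P (h ⊗ₜ a)) =
    Coalgebra.comul h * thetaTwoDual P R a := by
  have h1 : thetaTwo P R (Double.of P (h ⊗ₜ a)) = Coalgebra.comul h *
    contractThird P (leg₁₃ (swap (Ring.inverse R)) * leg₂₃ R) a := rfl
  rw [h1, contractThird_leg_mul_leg, legs_swap (commTrip₁₃ (k := k) (H := H))]
  rfl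

/-- `θ₂` is antimultiplicative on the dual factor. -/
theorem thetaTwoDual_mul (hR : IsQuasitriangular Coalgebra.comul R) (a b : A) :
    thetaTwoDual P R (a * b) = thetaTwoDual P R b * thetaTwoDual P R a := by
  refine evalLast_mul_right P ?_ a b
  have hi : CommutingLegs (incl k H H) (incr k H H) := commutingLegs_incl_incr
  have hX : CommutingLegs (incl k (H ⊗[k] H) (H ⊗[k] H)) (incr k (H ⊗[k] H) (H ⊗[k] H)) :=
    commutingLegs_incl_incr
  have q₁ : (Algebra.TensorProduct.map (AlgHom.id k (H ⊗[k] H)) (Bialgebra.comulAlgHom k H)).comp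
      (tripFst k H) = quadFst k H := by ext; simp [Algebra.TensorProduct.one_def]
  have q₂ : (Algebra.TensorProduct.map (AlgHom.id k (H ⊗[k] H)) (Bialgebra.comulAlgHom k H)).comp
      (tripSnd k H) = quadSnd k H := by ext; simp [Algebra.TensorProduct.one_def]
  have q₃ : ∀ x, (Algebra.TensorProduct.map (AlgHom.id k (H ⊗[k] H))
      (Bialgebra.comulAlgHom k H)).comp (tripTrd k H) x =
        legs (quadTrd k H) (quadFth k H) (Coalgebra.comul x) := fun x => by
    rw [← map_legs, legs_incl_incr]; simp
  have e₁ := legs_doubleLeg (R := R) (f := incl k (H ⊗[k] H) (H ⊗[k] H))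
    (g := quadFth k H) (hX.comp (AlgHom.id k _) (incr k H H))
  have e₂ := legs_doubleLeg (R := R) (f := incl k (H ⊗[k] H) (H ⊗[k] H))
    (g := quadTrd k H) (hX.comp (AlgHom.id k _) (incl k H H))
  rw [e₁, e₂, doubleLeg, map_mul, map_legs, map_legs, q₁, q₂,
    hR.legs_left_inverse q₃ (hi.map _) (hX.comp _ _).symm (hX.comp _ _).symm,
    hR.legs_right q₃ (hi.map _) (hX.comp _ _) (hX.comp _ _)]
  -- `R₄₁⁻¹` and `R₂₃` commute, having no leg in common
  have m := commute_legs_legs (hX.comp (incr k H H) (incl k H H)).symm (hi.map (incr k _ _))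
    (hi.map (incl k _ _)) (hX.comp (incl k H H) (incr k H H)) (Ring.inverse R) R
  simp only [mul_assoc]
  rw [← mul_assoc (legs (quadTrd k H) (quadFst k H) (Ring.inverse R)), m.eq, mul_assoc]

end ThetaTwo

/-! ### `θ₂` is an isomorphism of algebras -/

section ThetaTwoHom

variable {k H A : Type*} [Field k] [Ring H] [HopfAlgebra k H] [Ring A] [HopfAlgebra k A]
  (P : HopfPairing k H A) {R : H ⊗[k] H}

/-- `θ₂` on the ordinary product `(h ⊗ b) t` of `H ⊗ A`, in terms of which the product of `D(H)` is
defined. -/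
theorem thetaTwo_mul_right (h : H) (b : A) (hR : IsQuasitriangular Coalgebra.comul R)
    (t : H ⊗[k] A) : thetaTwo P R (Double.of P ((h ⊗ₜ b) * t)) =
      Coalgebra.comul h * thetaTwo P R (Double.of P t) * thetaTwoDual P R b := by
  induction t with
  | zero => simp
  | add s t hs ht => simp only [mul_add, map_add, add_mul, hs, ht]
  | tmul g a =>
    rw [Algebra.TensorProduct.tmul_mul_tmul, thetaTwo_of, thetaTwo_of, Bialgebra.comul_mul,
      thetaTwoDual_mul P hR]
    simp only [mul_assoc]

variable (k H) in
/-- `Δ` in the first two legs of `(H ⊗ H) ⊗ H`. -/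
abbrev tripComul : H →ₐ[k] (H ⊗[k] H) ⊗[k] H :=
  (incl k (H ⊗[k] H) H).comp (Bialgebra.comulAlgHom k H)

theorem tripComul_apply (x : H) : tripComul k H x =
    legs (tripFst k H) (tripSnd k H) (Coalgebra.comul x) := by
  rw [← map_legs, legs_incl_incr]; rfl

theorem leg_tripComul : leg (tripComul k H) = leg (tripFst k H) * leg (tripSnd k H) :=
  WithConv.ext (LinearMap.ext tripComul_apply)

/-- `R⁻¹` exchanges the coproduct and the opposite coproduct. -/
theorem IsQuasitriangular.constFun_inverse_mul {X : Type*} [Ring X] [Algebra k X]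
    (hR : IsQuasitriangular Coalgebra.comul R) {f g : H →ₐ[k] X} (h : CommutingLegs f g) :
    constFun H (legs f g (Ring.inverse R)) * (leg g * leg f) =
      leg f * leg g * constFun H (legs f g (Ring.inverse R)) := by
  ext y
  rw [constFun_mul_apply, mul_constFun_apply, leg_mul_leg_apply, leg_mul_leg_apply]
  have h1 := hR.legs_swap_mul h y
  rw [← one_mul (legs f g (Coalgebra.comul y)), ← legs_inverse_mul h hR.isUnit,
    mul_assoc (legs f g (Ring.inverse R)) (legs f g R), h1]
  simp only [mul_assoc]
  rw [legs_mul_inverse h hR.isUnit, mul_one]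

theorem constFun_mul {C X : Type*} [AddCommGroup C] [Module k C] [Coalgebra k C] [Ring X]
    [Algebra k X] (x y : X) :
    constFun (k := k) C (x * y) = constFun C x * constFun C y := by
  ext c
  rw [constFun_mul_apply]
  simp [constFun]

/-- `R₃₁⁻¹ R₂₃ (h₁ ⊗ h₂ ⊗ h₃) = (h₂ ⊗ h₃ ⊗ h₁) R₃₁⁻¹ R₂₃`. -/
theorem constFun_doubleLeg_mul (hR : IsQuasitriangular Coalgebra.comul R) :
    constFun H (doubleLeg R) * (leg (tripComul k H) * leg (tripTrd k H)) =
      leg (tripTrd k H) * leg (tripComul k H) * constFun H (doubleLeg R) := by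
  have c₁₂ : CommutingLegs (tripFst k H) (tripSnd k H) := commTrip₁₂
  have c₁₃ : CommutingLegs (tripFst k H) (tripTrd k H) := commTrip₁₃
  have c₂₃ : CommutingLegs (tripSnd k H) (tripTrd k H) := commTrip₂₃
  have e₁ := hR.constFun_inverse_mul c₁₃.symm
  have e₂ := hR.constFun_mul c₂₃
  have m₁ : constFun H (legs (tripTrd k H) (tripFst k H) (Ring.inverse R)) * leg (tripSnd k H) =
      leg (tripSnd k H) * constFun H (legs (tripTrd k H) (tripFst k H) (Ring.inverse R)) :=
    constFun_mul_leg fun y => commute_legs (fun x => (c₂₃ y x).symm) (fun x => c₁₂ x y) _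
  have m₂ : constFun H (legs (tripSnd k H) (tripTrd k H) R) * leg (tripFst k H) =
      leg (tripFst k H) * constFun H (legs (tripSnd k H) (tripTrd k H) R) :=
    constFun_mul_leg fun y => commute_legs (fun x => (c₁₂ y x).symm) (fun x => (c₁₃ y x).symm) _
  rw [leg_tripComul, doubleLeg, constFun_mul (k := k)]
  set r := constFun (k := k) H (legs (tripTrd k H) (tripFst k H) (Ring.inverse R))
  set s := constFun (k := k) H (legs (tripSnd k H) (tripTrd k H) R)
  calc r * s * (leg (tripFst k H) * leg (tripSnd k H) * leg (tripTrd k H))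
      = r * (s * leg (tripFst k H)) * leg (tripSnd k H) * leg (tripTrd k H) := by
        simp only [mul_assoc]
    _ = r * leg (tripFst k H) * (s * (leg (tripSnd k H) * leg (tripTrd k H))) := by
        rw [m₂]; simp only [mul_assoc]
    _ = (r * (leg (tripFst k H) * leg (tripTrd k H))) * leg (tripSnd k H) * s := by
        rw [e₂]; simp only [mul_assoc]
    _ = leg (tripTrd k H) * leg (tripFst k H) * (r * leg (tripSnd k H)) * s := by
        rw [e₁]; simp only [mul_assoc]
    _ = _ := by rw [m₁]; simp only [mul_assoc]

/-- `θ₂` respects the cross relations of `D(H)`. -/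
theorem thetaTwo_crossMap (hR : IsQuasitriangular Coalgebra.comul R) (a : A) (g : H) :
    thetaTwo P R (Double.of P (crossMap P a g)) =
      thetaTwoDual P R a * Coalgebra.comul g := by
  -- `constFun_doubleLeg_mul`, solved for the product with `Δ g` by the inverse of the third leg
  have e : leg (tripTrd k H) * ((leg (tripComul k H) * constFun H (doubleLeg R)) *
      legInv (tripTrd k H)) = constFun H (doubleLeg R) * leg (tripComul k H) := by
    rw [← mul_assoc, ← mul_assoc, ← constFun_doubleLeg_mul hR]
    simp only [mul_assoc, leg_mul_legInv, mul_one]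
  have e' := congrArg (fun F => evalLast P (F.ofConv g) a) e
  simp only [constFun_mul_apply, leg_apply] at e'
  have h1 : evalLast P (doubleLeg R * tripComul k H g) a =
      thetaTwoDual P R a * Coalgebra.comul g := evalLast_mul_incl P _ _ _
  rw [← h1, ← e', conv_mul_mul_apply, crossMap_apply]
  generalize comul₃ k H g = t
  induction t with
  | zero => simp
  | add s t hs ht => simp only [map_add, LinearMap.add_apply, hs, ht]
  | tmul x t =>
    induction t with
    | zero => simp
    | add s t hs ht => simp only [map_add, TensorProduct.tmul_add, LinearMap.add_apply, hs, ht]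
    | tmul y z =>
      simp only [TensorProduct.leftComm_tmul, LinearMap.lTensor_tmul, LinearMap.comp_apply,
        LinearMap.flip_apply, thetaTwo_of, TensorProduct.map_tmul, LinearMap.mul'_apply,
        mul_constFun_apply, leg_apply, legInv_apply]
      rw [← mul_assoc, evalLast_incr_mul_mul]
      exact (evalLast_incl_mul P _ _ _).symm

/-- `θ₂` is multiplicative. -/
theorem thetaTwo_mul (hR : IsQuasitriangular Coalgebra.comul R) (x y : Double P) :
    thetaTwo P R (x * y) = thetaTwo P R x * thetaTwo P R y := by
  obtain ⟨x, rfl⟩ := (Double.of P).surjective x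
  obtain ⟨y, rfl⟩ := (Double.of P).surjective y
  have h1 : ∀ s t, Double.of P s * Double.of P t = Double.of P (doubleMul P s t) := fun _ _ => rfl
  rw [h1]
  induction x, y using quad_induction with
  | h0 t => simp
  | h0' t => simp
  | ha s s' t hs hs' => simp only [add_mul, map_add, LinearMap.add_apply, hs, hs']
  | ha' s t t' hs hs' => simp only [mul_add, map_add, hs, hs']
  | h h a g b =>
    rw [doubleMul_tmul, thetaTwo_mul_right P h b hR, thetaTwo_crossMap P hR, thetaTwo_of,
      thetaTwo_of]
    simp only [mul_assoc]

theorem evalLast_legs_tripFst (t : H ⊗[k] H) (a : A) :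
    evalLast P (legs (tripTrd k H) (tripFst k H) t) a = contractLeft P t a ⊗ₜ 1 := by
  rw [contractLeft_apply]
  induction t with
  | zero => simp
  | add s t hs ht => simp only [map_add, LinearMap.add_apply, TensorProduct.add_tmul, hs, ht]
  | tmul x y => simp [TensorProduct.smul_tmul']

theorem evalLast_legs_tripSnd (t : H ⊗[k] H) (a : A) :
    evalLast P (legs (tripSnd k H) (tripTrd k H) t) a = 1 ⊗ₜ contractRight P t a := by
  rw [contractRight_apply]
  induction t with
  | zero => simp
  | add s t hs ht => simp only [map_add, LinearMap.add_apply, TensorProduct.tmul_add, hs, ht]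
  | tmul x y => simp

/-- `θ₂(1 ⊗ a) = ⟨a₁, R⁻¹⟩ R⁻² ⊗ R¹ ⟨a₂, R²⟩`. -/
theorem thetaTwoDual_apply (a : A) : thetaTwoDual P R a =
    TensorProduct.map (contractLeft P (Ring.inverse R)) (contractRight P R)
      (Coalgebra.comul a) := by
  rw [thetaTwoDual, doubleLeg, evalLast_mul]
  generalize (Coalgebra.comul a : A ⊗[k] A) = t
  induction t with
  | zero => simp
  | add s t hs ht => simp only [map_add, hs, ht]
  | tmul x y => simp [evalLast_legs_tripFst, evalLast_legs_tripSnd]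

theorem thetaTwoDual_one (hR : IsQuasitriangular Coalgebra.comul R) :
    thetaTwoDual P R 1 = 1 := by
  have h1 : P.form 1 = Coalgebra.counit := LinearMap.ext P.one_left
  rw [thetaTwoDual_apply, Bialgebra.comul_one, Algebra.TensorProduct.one_def,
    TensorProduct.map_tmul, contractLeft_apply, contractRight_apply, h1, hR.counit_left_inverse]
  have h3 := (isHopfAlgebra_comul k H).rid_inverse hR.isUnit.ringInverse hR.counit_right_inverse
  rw [inverse_inverse hR.isUnit] at h3
  rw [h3]; rfl

theorem counit_thetaTwoDual (hR : IsQuasitriangular Coalgebra.comul R) (a : A) :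
    Coalgebra.counit (R := k) (thetaTwoDual P R a) = Coalgebra.counit (R := k) a := by
  have h1 : ∀ t : H ⊗[k] H, TensorProduct.rid k H (Coalgebra.counit.lTensor H t) = 1 →
      ∀ a, Coalgebra.counit (R := k) (contractLeft P t a) = Coalgebra.counit (R := k) a := by
    intro t ht a
    rw [← P.one_right, ← ht, contractLeft_apply]
    generalize t = t
    induction t with
    | zero => simp
    | add s t hs ht => simp only [map_add, hs, ht]
    | tmul x y => simp [mul_comm]
  have h2 : ∀ t : H ⊗[k] H, TensorProduct.lid k H (Coalgebra.counit.rTensor H t) = 1 →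
      ∀ a, Coalgebra.counit (R := k) (contractRight P t a) = Coalgebra.counit (R := k) a := by
    intro t ht a
    rw [← P.one_right, ← ht, contractRight_apply]
    generalize t = t
    induction t with
    | zero => simp
    | add s t hs ht => simp only [map_add, hs, ht]
    | tmul x y => simp [mul_comm]
  have h3 : ∀ t : A ⊗[k] A, Coalgebra.counit (R := k) (TensorProduct.map
      (contractLeft P (Ring.inverse R)) (contractRight P R) t) =
      Coalgebra.counit (R := k) (TensorProduct.lid k A (Coalgebra.counit.rTensor A t)) := by
    intro t
    induction t with
    | zero => simp
    | add s t hs ht => simp only [map_add, hs, ht]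
    | tmul x y => simp [h1 _ hR.counit_right_inverse, h2 _ hR.counit_left, mul_comm]
  rw [thetaTwoDual_apply, h3, Coalgebra.rTensor_counit_comul]
  simp

theorem counit_thetaTwo (hR : IsQuasitriangular Coalgebra.comul R) (x : Double P) :
    Coalgebra.counit (R := k) (thetaTwo P R x) = Double.counit P x := by
  obtain ⟨x, rfl⟩ := (Double.of P).surjective x
  have h1 : Double.counit P (Double.of P x) = Coalgebra.counit (R := k) x := rfl
  rw [h1]
  clear h1
  induction x with
  | zero => simp
  | add s t hs ht => simp only [map_add, hs, ht]
  | tmul h a =>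
    have h2 : ∀ t : H ⊗[k] H, Coalgebra.counit (R := k) t =
      Coalgebra.counit (R := k) (TensorProduct.lid k H (Coalgebra.counit.rTensor H t)) := by
      intro t
      induction t with
      | zero => simp
      | add s t hs ht => simp only [map_add, hs, ht]
      | tmul x y => simp [mul_comm]
    rw [thetaTwo_of, Bialgebra.counit_mul, counit_thetaTwoDual P hR, h2,
      Coalgebra.rTensor_counit_comul]
    simp [mul_comm]

variable {P} (hP : P.form.Nondegenerate) (hR : IsQuasitriangular Coalgebra.comul R)
  (hQ : Function.Bijective (killingMap P R))

variable (P) in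
/-- `θ₂` maps `ρ(a₁) ⊗ a₂` to `1 ⊗ Q¹ ⟨a, Q²⟩`, where `ρ(a) = ⟨a, R¹⟩ R²`. -/
theorem thetaTwo_map_contractLeft (hR : IsQuasitriangular Coalgebra.comul R) (a : A) :
    thetaTwo P R (Double.of P ((contractLeft P R).rTensor A (Coalgebra.comul a))) =
      1 ⊗ₜ contractRight P (quantumKilling R) a := by
  have h1 : ∀ a : A, evalLast P (legs (tripTrd k H) (tripComul k H) R) a =
      Coalgebra.comul (contractLeft P R a) := by
    intro a
    rw [contractLeft_apply]
    generalize R = t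
    induction t with
    | zero => simp
    | add s t hs ht => simp only [map_add, LinearMap.add_apply, hs, ht]
    | tmul x y => simp
  have h2 : ∀ t : A ⊗[k] A, thetaTwo P R (Double.of P ((contractLeft P R).rTensor A t)) =
      LinearMap.mul' k _ (TensorProduct.map (evalLast P (legs (tripTrd k H) (tripComul k H) R))
        (evalLast P (doubleLeg R)) t) := by
    intro t
    induction t with
    | zero => simp
    | add s t hs ht => simp only [map_add, hs, ht]
    | tmul x y =>
      rw [LinearMap.rTensor_tmul, thetaTwo_of, TensorProduct.map_tmul, h1]; rfl
  have c₁₃ : CommutingLegs (tripFst k H) (tripTrd k H) := commTrip₁₃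
  have c₂₃ : CommutingLegs (tripSnd k H) (tripTrd k H) := commTrip₂₃
  rw [h2, ← evalLast_mul, hR.legs_right tripComul_apply commTrip₁₂ c₁₃.symm c₂₃.symm, doubleLeg,
    mul_assoc, ← mul_assoc (legs (tripTrd k H) (tripFst k H) R),
    legs_mul_inverse c₁₃.symm hR.isUnit, one_mul, ← legs_swap c₂₃, ← legs_mul c₂₃,
    evalLast_legs_tripSnd]
  rfl

include hP hR hQ in
/-- `θ₂` is onto: its image is a subalgebra that contains `1 ⊗ y`, by `thetaTwo_map_contractLeft`
and factorisability, and `Δ y`, hence also `y ⊗ 1`. -/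
theorem surjective_thetaTwo : Function.Surjective (thetaTwo P R) := by
  have hq := bijective_contractRight_quantumKilling hP hQ
  have h1 : ∀ y : H, ∃ x, thetaTwo P R x = 1 ⊗ₜ y := fun y => by
    obtain ⟨a, rfl⟩ := hq.surjective y
    exact ⟨_, thetaTwo_map_contractLeft P hR a⟩
  have h2 : ∀ y : H, ∃ x, thetaTwo P R x = Coalgebra.comul y := fun y =>
    ⟨Double.of P (y ⊗ₜ 1), by rw [thetaTwo_of, thetaTwoDual_one P hR, mul_one]⟩
  -- `h ⊗ 1 = Δ(h₁) (1 ⊗ S h₂)`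
  have h3 : ∀ y : H, ∃ x, thetaTwo P R x = y ⊗ₜ 1 := fun y => by
    have e : (leg (incl k H H) * leg (incr k H H)) * legInv (incr k H H) = leg (incl k H H) := by
      rw [mul_assoc, leg_mul_legInv, mul_one]
    have e' := congrArg (fun F => F.ofConv y) e
    have h4 : y ⊗ₜ[k] (1 : H) = (leg (incl k H H)).ofConv y := rfl
    rw [h4, ← e']
    rw [LinearMap.convMul_apply]
    generalize (Coalgebra.comul y : H ⊗[k] H) = t
    induction t with
    | zero => exact ⟨0, by simp⟩
    | add s t hs ht =>
      obtain ⟨u, hu⟩ := hs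
      obtain ⟨v, hv⟩ := ht
      exact ⟨u + v, by rw [map_add, hu, hv, map_add, map_add]⟩
    | tmul u v =>
      obtain ⟨p, hp⟩ := h2 u
      obtain ⟨q, hq⟩ := h1 (HopfAlgebra.antipode k v)
      refine ⟨p * q, ?_⟩
      rw [thetaTwo_mul P hR, hp, hq, TensorProduct.map_tmul, LinearMap.mul'_apply,
        leg_mul_leg_apply, legs_incl_incr]
      rfl
  intro z
  induction z with
  | zero => exact ⟨0, map_zero _⟩
  | add s t hs ht =>
    obtain ⟨u, hu⟩ := hs
    obtain ⟨v, hv⟩ := ht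
    exact ⟨u + v, by rw [map_add, hu, hv]⟩
  | tmul u v =>
    obtain ⟨p, hp⟩ := h3 u
    obtain ⟨q, hq⟩ := h1 v
    exact ⟨p * q, by rw [thetaTwo_mul P hR, hp, hq]; simp⟩

include hP hR hQ in
/-- `θ₂` is bijective, being onto between spaces of the same finite dimension. -/
theorem bijective_thetaTwo : Function.Bijective (thetaTwo P R) := by
  have hs := surjective_thetaTwo hP hR hQ
  have := finite_of_factorisable hQ
  let e := LinearEquiv.ofBijective (killingMap P R) hQ
  have : Module.Finite k A := Module.Finite.equiv e.symm
  have : Module.Finite k (Double P) := Module.Finite.equiv (Double.of P)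
  have h1 : Module.finrank k (Double P) = Module.finrank k (H ⊗[k] H) := by
    rw [← (Double.of P).finrank_eq, Module.finrank_tensorProduct, Module.finrank_tensorProduct,
      e.finrank_eq]
  exact ⟨(LinearMap.injective_iff_surjective_of_finrank_eq_finrank h1).mpr hs, hs⟩

/-- `θ₂` as an isomorphism of algebras. -/
def thetaTwoEquiv (hP : P.form.Nondegenerate) (hR : IsQuasitriangular Coalgebra.comul R)
    (hQ : Function.Bijective (killingMap P R)) : Double P ≃ₐ[k] H ⊗[k] H :=
  AlgEquiv.ofLinearEquiv (LinearEquiv.ofBijective (thetaTwo P R) (bijective_thetaTwo hP hR hQ))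
    (by
      have h1 : (1 : Double P) = Double.of P (1 ⊗ₜ 1) := rfl
      rw [LinearEquiv.ofBijective_apply, h1, thetaTwo_of, thetaTwoDual_one P hR,
        Bialgebra.comul_one, one_mul])
    (thetaTwo_mul P hR)

end ThetaTwoHom

/-! ### `θ₂` and the coproducts -/

section ThetaTwoComul

variable {k H A : Type*} [Field k] [Ring H] [HopfAlgebra k H] [Ring A] [HopfAlgebra k A]
  (P : HopfPairing k H A) {R : H ⊗[k] H}

/-- `χ` conjugates the coproduct of `Hᶜᵒᵖ ⊗ H` on the image of `Δ` to the
iterated coproduct. -/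
theorem chi_mul_comulE_comul (hR : IsQuasitriangular Coalgebra.comul R) (h : H) :
    chi R * comulE k H (Coalgebra.comul h) =
      TensorProduct.map Coalgebra.comul Coalgebra.comul (Coalgebra.comul h) * chi R := by
  have hX : CommutingLegs (incl k (H ⊗[k] H) (H ⊗[k] H)) (incr k (H ⊗[k] H) (H ⊗[k] H)) :=
    commutingLegs_incl_incr
  have hi : CommutingLegs (incl k H H) (incr k H H) := commutingLegs_incl_incr
  have c₁₂ : CommutingLegs (quadFst k H) (quadSnd k H) := hi.map _
  have c₁₃ : CommutingLegs (quadFst k H) (quadTrd k H) := hX.comp _ _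
  have c₂₃ : CommutingLegs (quadSnd k H) (quadTrd k H) := hX.comp _ _
  have c₁₄ : CommutingLegs (quadFst k H) (quadFth k H) := hX.comp _ _
  have c₂₄ : CommutingLegs (quadSnd k H) (quadFth k H) := hX.comp _ _
  have c₃₄ : CommutingLegs (quadTrd k H) (quadFth k H) := hi.map _
  have e : TensorProduct.map Coalgebra.comul Coalgebra.comul (Coalgebra.comul (R := k) h) =
      ((leg (quadFst k H) * leg (quadSnd k H)) *
        (leg (quadTrd k H) * leg (quadFth k H))).ofConv h := by
    rw [LinearMap.convMul_apply]
    generalize (Coalgebra.comul h : H ⊗[k] H) = t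
    induction t with
    | zero => simp
    | add s t hs ht => simp only [map_add, hs, ht]
    | tmul u v =>
      rw [TensorProduct.map_tmul, TensorProduct.map_tmul, LinearMap.mul'_apply,
        leg_mul_leg_apply, leg_mul_leg_apply, ← map_legs, ← map_legs, legs_incl_incr,
        legs_incl_incr]
      simp
  have r₁ := hR.constFun_inverse_mul c₁₃
  have r₂ := hR.constFun_inverse_mul c₂₃
  have m₁ : constFun H (legs (quadFst k H) (quadTrd k H) (Ring.inverse R)) * leg (quadSnd k H) =
      leg (quadSnd k H) * constFun H (legs (quadFst k H) (quadTrd k H) (Ring.inverse R)) :=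
    constFun_mul_leg fun y => commute_legs (fun x => c₁₂ x y) (fun x => (c₂₃ y x).symm) _
  have m₂ : constFun H (legs (quadFst k H) (quadTrd k H) (Ring.inverse R)) * leg (quadFth k H) =
      leg (quadFth k H) * constFun H (legs (quadFst k H) (quadTrd k H) (Ring.inverse R)) :=
    constFun_mul_leg fun y => commute_legs (fun x => c₁₄ x y) (fun x => c₃₄ x y) _
  have m₃ : constFun H (legs (quadSnd k H) (quadTrd k H) (Ring.inverse R)) * leg (quadFst k H) =
      leg (quadFst k H) * constFun H (legs (quadSnd k H) (quadTrd k H) (Ring.inverse R)) :=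
    constFun_mul_leg fun y => commute_legs (fun x => (c₁₂ y x).symm) (fun x => (c₁₃ y x).symm) _
  have m₄ : constFun H (legs (quadSnd k H) (quadTrd k H) (Ring.inverse R)) * leg (quadFth k H) =
      leg (quadFth k H) * constFun H (legs (quadSnd k H) (quadTrd k H) (Ring.inverse R)) :=
    constFun_mul_leg fun y => commute_legs (fun x => c₂₄ x y) (fun x => c₃₄ x y) _
  rw [comulE_comul, e, ← constFun_mul_apply, ← mul_constFun_apply, chi, quad₂₃_eq, quad₁₃_eq,
    constFun_mul (k := k)]
  set s := constFun (k := k) H (legs (quadSnd k H) (quadTrd k H) (Ring.inverse R))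
  set r := constFun (k := k) H (legs (quadFst k H) (quadTrd k H) (Ring.inverse R))
  refine congrArg (fun F : WithConv (H →ₗ[k] (H ⊗[k] H) ⊗[k] (H ⊗[k] H)) => F.ofConv h) ?_
  -- `R₁₃⁻¹` exchanges the legs `1` and `3`, then `R₂₃⁻¹` exchanges the legs `2` and `3`
  calc s * r * (leg (quadTrd k H) * leg (quadFst k H) * (leg (quadSnd k H) * leg (quadFth k H)))
      = s * (r * (leg (quadTrd k H) * leg (quadFst k H))) *
          (leg (quadSnd k H) * leg (quadFth k H)) := by simp only [mul_assoc]
    _ = s * leg (quadFst k H) * leg (quadTrd k H) * (r * leg (quadSnd k H)) *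
          leg (quadFth k H) := by rw [r₁]; simp only [mul_assoc]
    _ = leg (quadFst k H) * (s * (leg (quadTrd k H) * leg (quadSnd k H))) *
          (r * leg (quadFth k H)) := by rw [m₁, m₃]; simp only [mul_assoc]
    _ = leg (quadFst k H) * leg (quadSnd k H) * leg (quadTrd k H) * (s * leg (quadFth k H)) *
          r := by rw [r₂, m₂]; simp only [mul_assoc]
    _ = _ := by rw [m₄]; simp only [mul_assoc]

/-- A relation of Yang-Baxter type, solved for the inverses of two of its three factors. -/
theorem inverse_mul_inverse_mul_comm {X : Type*} [Ring X] {b u v u' v' : X}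
    (h : b * u * v = v * u * b) (h₁ : u' * u = 1) (h₂ : u * u' = 1) (h₃ : v' * v = 1)
    (h₄ : v * v' = 1) : u' * v' * b = b * v' * u' := calc
  _ = u' * v' * b * (u * (v * v') * u') := by rw [h₄, mul_one, h₂, mul_one]
  _ = u' * v' * (b * u * v) * v' * u' := by simp only [mul_assoc]
  _ = u' * ((v' * v) * u) * b * v' * u' := by rw [h]; simp only [mul_assoc]
  _ = _ := by rw [h₃, one_mul, h₁, one_mul]

/-- The reordering behind `chi_mul_comulE_thetaTwoDual`: four commutation relations and two
relations of Yang-Baxter type. -/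
theorem doubleLeg_word {X : Type*} [Ring X] {a b c d e f : X} (h₁ : Commute d e)
    (h₂ : Commute d f) (h₃ : Commute b f) (h₄ : Commute a e)
    (hb : e * c * b = b * c * e) (ha : f * c * a = a * c * f) :
    a * b * (c * d) * (e * f) = e * f * (c * a * (b * d)) := calc
  _ = a * b * c * (d * e) * f := by simp only [mul_assoc]
  _ = a * (b * c * e) * (d * f) := by rw [h₁.eq]; simp only [mul_assoc]
  _ = (a * e) * c * (b * f) * d := by rw [← hb, h₂.eq]; simp only [mul_assoc]
  _ = e * (a * c * f) * b * d := by rw [h₃.eq, h₄.eq]; simp only [mul_assoc]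
  _ = _ := by rw [← ha]; simp only [mul_assoc]

theorem map_doubleLeg {X : Type*} [Ring X] [Algebra k X] (f : H ⊗[k] H →ₐ[k] X) :
    Algebra.TensorProduct.map f (AlgHom.id k H) (doubleLeg R) =
      legs (incr k X H) ((incl k X H).comp (f.comp (incl k H H))) (Ring.inverse R) *
        legs ((incl k X H).comp (f.comp (incr k H H))) (incr k X H) R := by
  have p₁ : (Algebra.TensorProduct.map f (AlgHom.id k H)).comp (tripFst k H) =
    (incl k X H).comp (f.comp (incl k H H)) := by ext x; simp
  have p₂ : (Algebra.TensorProduct.map f (AlgHom.id k H)).comp (tripSnd k H) =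
    (incl k X H).comp (f.comp (incr k H H)) := by ext x; simp
  have p₃ : (Algebra.TensorProduct.map f (AlgHom.id k H)).comp (tripTrd k H) = incr k X H := by
    ext x; simp
  rw [doubleLeg, map_mul, map_legs, map_legs, p₁, p₂, p₃]

/-- `χ` conjugates the coproduct of `Hᶜᵒᵖ ⊗ H` on the values of `θ₂(1 ⊗ ·)` to the coproduct of
the dual. -/
theorem chi_mul_comulE_thetaTwoDual (hR : IsQuasitriangular Coalgebra.comul R) (a : A) :
    chi R * comulE k H (thetaTwoDual P R a) =
      TensorProduct.map (thetaTwoDual P R) (thetaTwoDual P R) (Coalgebra.comul a) * chi R := by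
  set X := (H ⊗[k] H) ⊗[k] (H ⊗[k] H)
  have hZ : CommutingLegs (incl k X H) (incr k X H) := commutingLegs_incl_incr
  have hX : CommutingLegs (incl k (H ⊗[k] H) (H ⊗[k] H)) (incr k (H ⊗[k] H) (H ⊗[k] H)) :=
    commutingLegs_incl_incr
  have hi : CommutingLegs (incl k H H) (incr k H H) := commutingLegs_incl_incr
  let l₁ := (incl k X H).comp (quadFst k H)
  let l₂ := (incl k X H).comp (quadSnd k H)
  let l₃ := (incl k X H).comp (quadTrd k H)
  let l₄ := (incl k X H).comp (quadFth k H)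
  let l₅ := incr k X H
  have c₁₂ : CommutingLegs l₁ l₂ := (hi.map _).map _
  have c₁₃ : CommutingLegs l₁ l₃ := (hX.comp _ _).map _
  have c₂₃ : CommutingLegs l₂ l₃ := (hX.comp _ _).map _
  have c₁₄ : CommutingLegs l₁ l₄ := (hX.comp _ _).map _
  have c₂₄ : CommutingLegs l₂ l₄ := (hX.comp _ _).map _
  have c₃₄ : CommutingLegs l₃ l₄ := (hi.map _).map _
  have c₁₅ : CommutingLegs l₁ l₅ := fun x y => hZ _ _
  have c₂₅ : CommutingLegs l₂ l₅ := fun x y => hZ _ _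
  have c₃₅ : CommutingLegs l₃ l₅ := fun x y => hZ _ _
  have c₄₅ : CommutingLegs l₄ l₅ := fun x y => hZ _ _
  -- the coproduct of `θ₂(1 ⊗ a)` is the evaluation of `(Δ ⊗ id)(R₃₁⁻¹ R₂₃)`
  have e₁ : comulE k H (thetaTwoDual P R a) = evalLast P
      (legs l₅ l₃ (Ring.inverse R) * legs l₅ l₁ (Ring.inverse R) *
        (legs l₂ l₅ R * legs l₄ l₅ R)) a := by
    have p₁ : ∀ x, (Algebra.TensorProduct.map (comulE k H) (AlgHom.id k H)).comp
        (tripFst k H) x = legs l₃ l₁ (Coalgebra.comul x) := fun x => by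
      have : (Algebra.TensorProduct.map (comulE k H) (AlgHom.id k H)).comp
        (tripFst k H) x = incl k X H (comulE k H (x ⊗ₜ 1)) := by simp [X]
      rw [this, comulE_tmul, Bialgebra.comul_one, quad₂₄_one, mul_one, quad₁₃_eq, legs_swap
        (hX.comp _ _), map_legs]
    have p₂ : ∀ x, (Algebra.TensorProduct.map (comulE k H) (AlgHom.id k H)).comp
        (tripSnd k H) x = legs l₂ l₄ (Coalgebra.comul x) := fun x => by
      have : (Algebra.TensorProduct.map (comulE k H) (AlgHom.id k H)).comp
        (tripSnd k H) x = incl k X H (comulE k H (1 ⊗ₜ x)) := by simp [X]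
      rw [this, comulE_tmul, Bialgebra.comul_one, swap_one, quad₁₃_one, one_mul, quad₂₄_eq,
        map_legs]
    have p₃ : (Algebra.TensorProduct.map (comulE k H) (AlgHom.id k H)).comp (tripTrd k H) = l₅ := by
      ext x; simp [l₅, X]
    rw [thetaTwoDual, map_evalLast, doubleLeg, map_mul, map_legs, map_legs, p₃,
      hR.legs_right_inverse p₁ c₁₃.symm c₃₅.symm c₁₅.symm, hR.legs_left p₂ c₂₄ c₂₅ c₄₅]
  -- `(θ₂ ⊗ θ₂)(Δ a)` is the evaluation of the product of two copies of `R₃₁⁻¹ R₂₃`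
  have e₂ : TensorProduct.map (thetaTwoDual P R) (thetaTwoDual P R) (Coalgebra.comul a) =
      evalLast P (legs l₅ l₁ (Ring.inverse R) * legs l₂ l₅ R *
        (legs l₅ l₃ (Ring.inverse R) * legs l₄ l₅ R)) a := by
    have e₃ : legs l₅ l₁ (Ring.inverse R) * legs l₂ l₅ R = Algebra.TensorProduct.map
      (incl k (H ⊗[k] H) (H ⊗[k] H)) (AlgHom.id k H) (doubleLeg R) := (map_doubleLeg _).symm
    have e₄ : legs l₅ l₃ (Ring.inverse R) * legs l₄ l₅ R = Algebra.TensorProduct.map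
      (incr k (H ⊗[k] H) (H ⊗[k] H)) (AlgHom.id k H) (doubleLeg R) := (map_doubleLeg _).symm
    rw [e₃, e₄, evalLast_mul]
    generalize (Coalgebra.comul a : A ⊗[k] A) = t
    induction t with
    | zero => simp
    | add s t hs ht => simp only [map_add, hs, ht]
    | tmul u v =>
      rw [TensorProduct.map_tmul, TensorProduct.map_tmul, ← map_evalLast, ← map_evalLast]
      exact (legs_incl_incr (_ ⊗ₜ _)).symm
  have e₃ : incl k X H (chi R) = legs l₂ l₃ (Ring.inverse R) * legs l₁ l₃ (Ring.inverse R) := by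
    rw [chi, map_mul, quad₂₃_eq, quad₁₃_eq, map_legs, map_legs]
  rw [e₁, e₂, ← evalLast_incl_mul, ← evalLast_mul_incl, e₃]
  have hb := inverse_mul_inverse_mul_comm (hR.yangBaxter c₂₅ c₂₃ c₃₅.symm)
    (legs_inverse_mul c₂₃ hR.isUnit) (legs_mul_inverse c₂₃ hR.isUnit)
    (legs_inverse_mul c₃₅.symm hR.isUnit) (legs_mul_inverse c₃₅.symm hR.isUnit)
  have key := doubleLeg_word (commute_legs_legs c₂₄.symm c₃₄.symm c₂₅.symm c₃₅.symm R
      (Ring.inverse R)) (commute_legs_legs c₁₄.symm c₃₄.symm c₁₅.symm c₃₅.symm R (Ring.inverse R))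
    (commute_legs_legs c₁₂.symm c₂₃ c₁₅.symm c₃₅.symm R (Ring.inverse R))
    (commute_legs_legs c₂₅.symm c₃₅.symm c₁₂ c₁₃ (Ring.inverse R) (Ring.inverse R)) hb
    (hR.yangBaxter_inverse c₁₅.symm c₃₅.symm c₁₃).symm
  rw [key]

end ThetaTwoComul

/-! ### `θ₂` as an isomorphism of covariant systems, and the antipode of the double -/

section ThetaTwoIso

variable {k H A : Type*} [Field k] [Ring H] [HopfAlgebra k H] [Ring A] [HopfAlgebra k A]
  (P : HopfPairing k H A) {R : H ⊗[k] H}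

theorem double_comul_tmul (h : H) (a : A) : Double.comul P (Double.of P (h ⊗ₜ a)) =
    TensorProduct.map (Double.of P).toLinearMap (Double.of P).toLinearMap
      (TensorProduct.tensorTensorTensorComm k H H A A (Coalgebra.comul h ⊗ₜ Coalgebra.comul a)) :=
  rfl

/-- `θ₂` carries the coproduct of `D(H)` to the coproduct of `Hᶜᵒᵖ ⊗ H` conjugated by `χ`. -/
theorem map_thetaTwo_comul (hR : IsQuasitriangular Coalgebra.comul R) (x : Double P) :
    TensorProduct.map (thetaTwo P R) (thetaTwo P R) (Double.comul P x) =
      chi R * (comulE k H (thetaTwo P R x) * Ring.inverse (chi R)) := by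
  obtain ⟨x, rfl⟩ := (Double.of P).surjective x
  induction x with
  | zero => simp
  | add s t hs ht => simp only [map_add, mul_add, add_mul, hs, ht]
  | tmul h a =>
    have h1 : ∀ (s : H ⊗[k] H) (t : A ⊗[k] A), TensorProduct.map (thetaTwo P R) (thetaTwo P R)
        (TensorProduct.map (Double.of P).toLinearMap (Double.of P).toLinearMap
          (TensorProduct.tensorTensorTensorComm k H H A A (s ⊗ₜ t))) =
        TensorProduct.map Coalgebra.comul Coalgebra.comul s *
          TensorProduct.map (thetaTwoDual P R) (thetaTwoDual P R) t := by
      intro s t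
      induction s, t using quad_induction with
      | h0 t => simp
      | h0' t => simp
      | ha s s' t hs hs' => simp only [TensorProduct.add_tmul, map_add, add_mul, hs, hs']
      | ha' s t t' hs hs' => simp only [TensorProduct.tmul_add, map_add, mul_add, hs, hs']
      | h x x' y y' => simp [thetaTwo_of]
    rw [double_comul_tmul, h1, thetaTwo_of, map_mul, ← mul_assoc, ← mul_assoc,
      chi_mul_comulE_comul hR, mul_assoc (TensorProduct.map Coalgebra.comul Coalgebra.comul _),
      chi_mul_comulE_thetaTwoDual P hR]
    simp only [mul_assoc]
    rw [Ring.mul_inverse_cancel _ (isUnit_chi hR), mul_one]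

/-- The element `θ₂(1 ⊗ a)` acts on `A` as `1 ⊗ a` does: the antipode in the action of `Hᶜᵒᵖ` turns
the `R⁻¹` in `θ₂` into `R`, by `(id ⊗ S) R⁻¹ = R`. -/
theorem tensorOnDual_act_thetaTwoDual (hR : IsQuasitriangular Coalgebra.comul R) (a b : A) :
    (tensorOnDual P).act (thetaTwoDual P R a) b = braidAct P R a b := by
  have h1 : ∀ c : A, HopfAlgebra.antipode k (contractLeft P (Ring.inverse R) c) =
      contractLeft P R c := by
    intro c
    conv_rhs => rw [← hR.antipode_right]
    rw [contractLeft_apply, contractLeft_apply]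
    generalize Ring.inverse R = t
    induction t with
    | zero => simp
    | add s t hs ht => simp only [map_add, hs, ht]
    | tmul x y => simp
  have h2 : braidAct P R a b = biEval P (TensorProduct.map (contractLeft P R) (contractRight P R)
    (Coalgebra.comul a)) b := rfl
  rw [thetaTwoDual_apply, h2]
  generalize (Coalgebra.comul a : A ⊗[k] A) = t
  induction t with
  | zero => simp
  | add s t hs ht => simp only [map_add, LinearMap.add_apply, hs, ht]
  | tmul x y =>
    rw [TensorProduct.map_tmul, TensorProduct.map_tmul, tensorOnDual_act_tmul, h1, biEval_tmul]

/-- `D(H)` acts on `A` through `θ₂` and the action of `Hᶜᵒᵖ ⊗ H`. -/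
theorem doubleOnDual_act_thetaTwo (hR : IsQuasitriangular Coalgebra.comul R) (x : Double P)
    (b : A) : (doubleOnDual P R).act x b = (tensorOnDual P).act (thetaTwo P R x) b := by
  obtain ⟨x, rfl⟩ := (Double.of P).surjective x
  induction x with
  | zero => simp
  | add s t hs ht => simp only [map_add, LinearMap.add_apply, hs, ht]
  | tmul h a =>
    rw [thetaTwo_of, tensorOnDual_mul_act, tensorOnDual_act_thetaTwoDual P hR, ← coadAct_eq]
    rfl

/-- The transmuted product is the product twisted by `χ`. -/
theorem transmutedMul_eq (hR : IsQuasitriangular Coalgebra.comul R) (a b : A) :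
    transmutedMul P R (a ⊗ₜ b) =
      LinearMap.mul' k A ((tensorOnDual P).act₂ (Ring.inverse (chi R)) (a ⊗ₜ b)) := by
  have h1 : transmutedMul P R (a ⊗ₜ b) = TensorProduct.rid k A
    (TensorProduct.map (LinearMap.mul' k A) (pairR P R ∘ₗ (HopfAlgebra.antipode k).lTensor A)
      (TensorProduct.tensorTensorTensorComm k A A A A
        (adCoact (k := k) a ⊗ₜ TensorProduct.comm k A A (Coalgebra.comul b)))) := rfl
  have h2 : ∀ c d : A, pairR P R (c ⊗ₜ d) = P.form d (contractLeft P R c) := fun _ _ => rfl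
  rw [h1, chi_inverse hR]
  -- `χ⁻¹ = (Δ ⊗ id) R` acts by the coadjoint action of the first leg of `R` on `a` and by the
  -- antipode of the second leg on `b`
  have key : ∀ t : H ⊗[k] H,
      (LinearMap.mul' k A ((tensorOnDual P).act₂ (legs ((incl k (H ⊗[k] H) _).comp
        (Bialgebra.comulAlgHom k H)) (quadTrd k H) t) (a ⊗ₜ b))) =
      LinearMap.mul' k A (TensorProduct.map ((coadAct P).flip a)
        ((leftEval P ∘ₗ HopfAlgebra.antipode k).flip b) t) := by
    intro t
    induction t with
    | zero => simp
    | add s t hs ht => simp only [map_add, LinearMap.add_apply, hs, ht]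
    | tmul x y =>
      have : legs ((incl k (H ⊗[k] H) (H ⊗[k] H)).comp (Bialgebra.comulAlgHom k H)) (quadTrd k H)
        (x ⊗ₜ y) = Coalgebra.comul x ⊗ₜ (y ⊗ₜ 1) := by simp
      rw [this, TensorProduct.map_tmul, LinearMap.flip_apply, coadAct_eq]
      simp [CovariantData.act₂, tensorOnDual_act_tmul, rightEval_one_left]
  rw [key]
  have h3 : ∀ x, coadAct P x a =
    TensorProduct.rid k A ((P.form.flip x).lTensor A (adCoact (k := k) a)) := fun _ => rfl
  have h4 : ∀ y, leftEval P (HopfAlgebra.antipode k y) b = evalFst P (Coalgebra.comul b) y :=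
    fun y => leftEval_antipode_eq P y b
  have h5 : (coadAct P).flip a = evalSnd P (adCoact (k := k) a) := by
    ext x
    rw [LinearMap.flip_apply, h3]
    generalize adCoact (k := k) a = t
    induction t with
    | zero => simp
    | add s t hs ht => simp only [map_add, LinearMap.add_apply, hs, ht]
    | tmul u v => simp [evalSnd]
  have h6 : (leftEval P ∘ₗ HopfAlgebra.antipode k).flip b = evalFst P (Coalgebra.comul b) := by
    ext y; exact h4 y
  rw [h5, h6]
  generalize adCoact (k := k) a = s
  generalize (Coalgebra.comul b : A ⊗[k] A) = t
  induction s, t using quad_induction with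
  | h0 t => simp
  | h0' t => simp
  | ha s s' t hs hs' =>
    simp only [TensorProduct.add_tmul, map_add, TensorProduct.map_add_left, LinearMap.add_apply,
      hs, hs']
  | ha' s t t' hs hs' =>
    simp only [TensorProduct.tmul_add, map_add, TensorProduct.map_add_right, LinearMap.add_apply,
      hs, hs']
  | h u u' v v' =>
    simp only [TensorProduct.comm_tmul, TensorProduct.tensorTensorTensorComm_tmul,
      TensorProduct.map_tmul, LinearMap.comp_apply, LinearMap.lTensor_tmul, h2,
      TensorProduct.rid_tmul, contractLeft_apply]
    clear h1 h2 key hR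
    induction R with
    | zero => simp
    | add s t hs ht => simp only [map_add, add_smul, hs, ht]
    | tmul x y => simp [evalSnd, evalFst, smul_smul, mul_comm]

variable {P} (hP : P.form.Nondegenerate) (hR : IsQuasitriangular Coalgebra.comul R)
  (hQ : Function.Bijective (killingMap P R))

/-- `(θ₂, id)` is an isomorphism from `(D(H), A)`, with the transmuted product, to the twist of
`(Hᶜᵒᵖ ⊗ H, A)` by `χ`. -/
theorem isIso_doubleOnDual_twist : (doubleOnDual P R).IsIso ((tensorOnDual P).twist (chi R))
    (thetaTwoEquiv hP hR hQ) (LinearEquiv.refl k A) where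
  comul := map_thetaTwo_comul P hR
  counit := counit_thetaTwo P hR
  mul := transmutedMul_eq P hR
  one := rfl
  act := doubleOnDual_act_thetaTwo P hR

theorem double_of_tmul (h : H) (a : A) : Double.of P (h ⊗ₜ a) =
    Double.of P (h ⊗ₜ 1) * Double.of P (1 ⊗ₜ a) := by
  have : Double.of P (h ⊗ₜ 1) * Double.of P (1 ⊗ₜ a) =
    Double.of P (doubleMul P (h ⊗ₜ 1) (1 ⊗ₜ a)) := rfl
  rw [this, doubleMul_tmul, crossMap_one_left]; simp

theorem double_of_mul_left (g h : H) : Double.of P (g ⊗ₜ (1 : A)) * Double.of P (h ⊗ₜ 1) =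
    Double.of P ((g * h) ⊗ₜ 1) := by
  have : Double.of P (g ⊗ₜ (1 : A)) * Double.of P (h ⊗ₜ 1) =
    Double.of P (doubleMul P (g ⊗ₜ 1) (h ⊗ₜ 1)) := rfl
  rw [this, doubleMul_tmul, crossMap_one_left]; simp

theorem double_of_mul_right (a b : A) : Double.of P ((1 : H) ⊗ₜ a) * Double.of P (1 ⊗ₜ b) =
    Double.of P (1 ⊗ₜ (b * a)) := by
  have : Double.of P ((1 : H) ⊗ₜ a) * Double.of P (1 ⊗ₜ b) =
    Double.of P (doubleMul P (1 ⊗ₜ a) (1 ⊗ₜ b)) := rfl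
  rw [this, doubleMul_tmul, crossMap_one_right]; simp

theorem double_of_one : Double.of P (1 ⊗ₜ 1) = 1 := rfl

/-- `S(h ⊗ a) = (1 ⊗ S⁻¹ a) (S h ⊗ 1)`, for a given linear map `S⁻¹` on `A`. -/
def doubleAntipode (P : HopfPairing k H A) (S' : A →ₗ[k] A) : Double P →ₗ[k] Double P :=
  TensorProduct.lift ((LinearMap.mul k (Double P)).flip.compl₁₂
    ((Double.of P).toLinearMap ∘ₗ (TensorProduct.mk k H A).flip 1 ∘ₗ HopfAlgebra.antipode k)
    ((Double.of P).toLinearMap ∘ₗ TensorProduct.mk k H A 1 ∘ₗ S')) ∘ₗ (Double.of P).symm.toLinearMap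

theorem doubleAntipode_of (S' : A →ₗ[k] A) (h : H) (a : A) :
    doubleAntipode P S' (Double.of P (h ⊗ₜ a)) =
      Double.of P (1 ⊗ₜ S' a) * Double.of P (HopfAlgebra.antipode k h ⊗ₜ 1) := rfl

/-- The antipode of `D(H)`, given a right inverse `S⁻¹` of the injective antipode of `A`. -/
theorem isAntipode_doubleAntipode {S' : A →ₗ[k] A}
    (hS : Function.Injective (HopfAlgebra.antipode k (A := A)))
    (hS' : ∀ a, HopfAlgebra.antipode k (S' a) = a) :
    IsAntipode (Double.comul P) (Double.counit P) (doubleAntipode P S') := by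
  have hA : IsAntipode (copComul (Bialgebra.comulAlgHom k A)).toLinearMap
    (Coalgebra.counit (R := k)) S' := isAntipode_antipode.cop
      HopfAlgebra.antipode_mul_antidistrib HopfAlgebra.antipode_one hS hS'
  refine ⟨(LinearEquiv.eq_comp_toLinearMap_iff (e₁₂ := Double.of P) _ _).mp
      (TensorProduct.ext' fun h a => ?_),
    (LinearEquiv.eq_comp_toLinearMap_iff (e₁₂ := Double.of P) _ _).mp
      (TensorProduct.ext' fun h a => ?_)⟩
  -- `(1 ⊗ S⁻¹ a₁) (S h₁ ⊗ 1) (h₂ ⊗ 1) (1 ⊗ a₂)`: the factors from `H` cancel first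
  · have h1 : ∀ (s : H ⊗[k] H) (t : A ⊗[k] A), LinearMap.mul' k (Double P)
        ((doubleAntipode P S').rTensor (Double P)
          (TensorProduct.map (Double.of P).toLinearMap (Double.of P).toLinearMap
            (TensorProduct.tensorTensorTensorComm k H H A A (s ⊗ₜ t)))) =
        LinearMap.mul' k (Double P) (TensorProduct.map
          ((Double.of P).toLinearMap ∘ₗ TensorProduct.mk k H A 1 ∘ₗ S')
          (LinearMap.mul k (Double P) (Double.of P (LinearMap.mul' k H
            ((HopfAlgebra.antipode k).rTensor H s) ⊗ₜ 1)) ∘ₗ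
              (Double.of P).toLinearMap ∘ₗ TensorProduct.mk k H A 1) t) := by
      intro s t
      induction s, t using quad_induction with
      | h0 t => simp
      | h0' t => simp
      | ha s s' t hs hs' => simp only [TensorProduct.add_tmul, map_add, LinearMap.add_comp,
          TensorProduct.map_add_right, LinearMap.add_apply, hs, hs']
      | ha' s t t' hs hs' => simp only [TensorProduct.tmul_add, map_add, hs, hs']
      | h x x' y y' =>
        simp only [TensorProduct.tensorTensorTensorComm_tmul, TensorProduct.map_tmul,
          LinearEquiv.coe_coe, LinearMap.rTensor_tmul, doubleAntipode_of, LinearMap.mul'_apply,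
          LinearMap.comp_apply, TensorProduct.mk_apply, LinearMap.mul_apply_apply]
        rw [double_of_tmul x', ← double_of_mul_left]
        simp only [mul_assoc]
    have h2 := LinearMap.congr_fun hA.right a
    have h3 : ∀ t : A ⊗[k] A, LinearMap.mul' k (Double P) (TensorProduct.map
        ((Double.of P).toLinearMap ∘ₗ TensorProduct.mk k H A 1 ∘ₗ S')
        ((Double.of P).toLinearMap ∘ₗ TensorProduct.mk k H A 1) t) =
        Double.of P (1 ⊗ₜ LinearMap.mul' k A (S'.lTensor A (swap t))) := by
      intro t
      simp only [swap]
      induction t with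
      | zero => simp
      | add s t hs ht => simp only [map_add, TensorProduct.tmul_add, hs, ht]
      | tmul u v => simp [double_of_mul_right]
    simp only [LinearMap.comp_apply, AlgHom.toLinearMap_apply, copComul_apply,
      Bialgebra.comulAlgHom_apply, Algebra.linearMap_apply, LinearEquiv.coe_coe] at h2 ⊢
    rw [double_comul_tmul, h1, HopfAlgebra.mul_antipode_rTensor_comul_apply,
      Algebra.algebraMap_eq_smul_one, ← TensorProduct.smul_tmul', map_smul, double_of_one,
      map_smul, LinearMap.smul_comp, TensorProduct.map_smul_right, LinearMap.smul_apply, map_smul]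
    have h4 : LinearMap.mul k (Double P) 1 = LinearMap.id := LinearMap.ext fun x => one_mul x
    rw [h4, LinearMap.id_comp, h3, h2, Algebra.algebraMap_eq_smul_one, TensorProduct.tmul_smul,
      map_smul, smul_smul, Algebra.algebraMap_eq_smul_one, double_of_one]
    congr 1
    exact mul_comm _ _
  -- `(h₁ ⊗ 1) (1 ⊗ a₁) (1 ⊗ S⁻¹ a₂) (S h₂ ⊗ 1)`: the factors from `A` cancel first
  · have h1 : ∀ (s : H ⊗[k] H) (t : A ⊗[k] A), LinearMap.mul' k (Double P)
        ((doubleAntipode P S').lTensor (Double P)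
          (TensorProduct.map (Double.of P).toLinearMap (Double.of P).toLinearMap
            (TensorProduct.tensorTensorTensorComm k H H A A (s ⊗ₜ t)))) =
        LinearMap.mul' k (Double P) (TensorProduct.map
          ((Double.of P).toLinearMap ∘ₗ (TensorProduct.mk k H A).flip 1)
          (LinearMap.mul k (Double P) (Double.of P (1 ⊗ₜ LinearMap.mul' k A
            (S'.rTensor A (swap t)))) ∘ₗ
              (Double.of P).toLinearMap ∘ₗ (TensorProduct.mk k H A).flip 1 ∘ₗ
                HopfAlgebra.antipode k) s) := by
      intro s t
      simp only [swap]
      induction s, t using quad_induction with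
      | h0 t => simp
      | h0' t => simp
      | ha s s' t hs hs' => simp only [TensorProduct.add_tmul, map_add, hs, hs']
      | ha' s t t' hs hs' => simp only [TensorProduct.tmul_add, map_add, LinearMap.add_comp,
          TensorProduct.map_add_right, LinearMap.add_apply, hs, hs']
      | h x x' y y' =>
        simp only [TensorProduct.tensorTensorTensorComm_tmul, TensorProduct.map_tmul,
          LinearEquiv.coe_coe, LinearMap.lTensor_tmul, doubleAntipode_of, LinearMap.mul'_apply,
          LinearMap.comp_apply, TensorProduct.mk_apply, LinearMap.mul_apply_apply,
          LinearMap.flip_apply, TensorProduct.comm_tmul, LinearMap.rTensor_tmul]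
        rw [double_of_tmul x, ← double_of_mul_right]
        simp only [mul_assoc]
    have h2 := LinearMap.congr_fun hA.left a
    have h3 : ∀ t : H ⊗[k] H, LinearMap.mul' k (Double P) (TensorProduct.map
        ((Double.of P).toLinearMap ∘ₗ (TensorProduct.mk k H A).flip 1)
        ((Double.of P).toLinearMap ∘ₗ (TensorProduct.mk k H A).flip 1 ∘ₗ
          HopfAlgebra.antipode k) t) =
        Double.of P (LinearMap.mul' k H ((HopfAlgebra.antipode k).lTensor H t) ⊗ₜ 1) := by
      intro t
      induction t with
      | zero => simp
      | add s t hs ht => simp only [map_add, TensorProduct.add_tmul, hs, ht]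
      | tmul u v => simp [double_of_mul_left]
    simp only [LinearMap.comp_apply, AlgHom.toLinearMap_apply, copComul_apply,
      Bialgebra.comulAlgHom_apply, Algebra.linearMap_apply, LinearEquiv.coe_coe] at h2 ⊢
    rw [double_comul_tmul, h1, h2, Algebra.algebraMap_eq_smul_one, TensorProduct.tmul_smul,
      map_smul, double_of_one, map_smul, LinearMap.smul_comp, TensorProduct.map_smul_right,
      LinearMap.smul_apply, map_smul]
    have h4 : LinearMap.mul k (Double P) 1 = LinearMap.id := LinearMap.ext fun x => one_mul x
    rw [h4, LinearMap.id_comp, h3, HopfAlgebra.mul_antipode_lTensor_comul_apply,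
      Algebra.algebraMap_eq_smul_one, ← TensorProduct.smul_tmul', map_smul, smul_smul,
      Algebra.algebraMap_eq_smul_one, double_of_one]
    congr 1

end ThetaTwoIso

/-! ### Covariant systems by transport and twisting -/

section CovariantSystems

variable {k H A : Type*} [Field k] [Ring H] [HopfAlgebra k H] [Ring A] [HopfAlgebra k A]
  {P : HopfPairing k H A} {R : H ⊗[k] H} (hP : P.form.Nondegenerate)
  (hR : IsQuasitriangular Coalgebra.comul R) (hQ : Function.Bijective (killingMap P R))

include hP hR hQ in
/-- The twist of `Hᶜᵒᵖ ⊗ H` by `χ` has an antipode, namely the one of `D(H)` carried over by `θ₂`.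
-/
theorem exists_antipode_twist_chi : ∃ S, IsAntipode ((tensorOnDual P).twist (chi R)).comul
    ((tensorOnDual P).twist (chi R)).counit S := by
  have h := bijective_antipode_dual hP hR hQ
  obtain ⟨S', hS'⟩ : ∃ S' : A →ₗ[k] A, ∀ a, HopfAlgebra.antipode k (S' a) = a :=
    ⟨(LinearEquiv.ofBijective _ h).symm, LinearEquiv.apply_symm_apply
      (LinearEquiv.ofBijective (HopfAlgebra.antipode k) h)⟩
  obtain ⟨θ, hθ⟩ : ∃ θ, (doubleOnDual P R).IsIso ((tensorOnDual P).twist (chi R)) θ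
    (LinearEquiv.refl k A) := ⟨_, isIso_doubleOnDual_twist hP hR hQ⟩
  have h1 : IsAntipode (doubleOnDual P R).comul (doubleOnDual P R).counit
    (doubleAntipode P S') := isAntipode_doubleAntipode h.injective hS'
  exact ⟨_, h1.transport hθ.comul hθ.counit⟩

include hP hR hQ in
theorem isCovariantSystem_twist_chi : ((tensorOnDual P).twist (chi R)).IsCovariantSystem := by
  have hE := isCovariantSystem_tensorOnDual P (bijective_antipode hP hR hQ)
  exact hE.twist (isTwistingCocycle_chi hR hE.hopf) (rid_chi hR hE.hopf)
    (exists_antipode_twist_chi hP hR hQ)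

include hP hR hQ in
theorem isCovariantSystem_doubleOnDual : (doubleOnDual P R).IsCovariantSystem :=
  (isCovariantSystem_twist_chi hP hR hQ).transport (isIso_doubleOnDual_twist hP hR hQ).symm

include hP hR hQ in
theorem isCovariantSystem_mirrorOnDual : (mirrorOnDual P).IsCovariantSystem :=
  (isCovariantSystem_tensorOnDual P (bijective_antipode hP hR hQ)).transport
    (isIso_tensorOnDual_mirrorOnDual P)

include hR in
variable (P) in
theorem isIso_twist_chi_twist_chiMirror : ((tensorOnDual P).twist (chi R)).IsIso
    ((mirrorOnDual P).twist (chiMirror R)) (thetaOneInvEquiv k H).symm (LinearEquiv.refl k A) := by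
  rw [← mapTwo_thetaOne_chi hR]
  exact (isIso_tensorOnDual_mirrorOnDual P).twist (isUnit_chi hR)

include hP hR hQ in
theorem isCovariantSystem_twist_chiMirror :
    ((mirrorOnDual P).twist (chiMirror R)).IsCovariantSystem :=
  (isCovariantSystem_twist_chi hP hR hQ).transport (isIso_twist_chi_twist_chiMirror P hR)

end CovariantSystems

/-! ### The map `Q` -/

section KillingMap

variable {k H A : Type*} [Field k] [Ring H] [HopfAlgebra k H] [Ring A] [HopfAlgebra k A]
  (P : HopfPairing k H A) {R : H ⊗[k] H}

local notation "S" => HopfAlgebra.antipode k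

theorem contractLeft_eq_evalLast (t : H ⊗[k] H) (a : A) :
    contractLeft P t a = evalLast P (swap t) a := by
  rw [contractLeft_apply, swap]
  induction t with
  | zero => simp
  | add s t hs ht => simp only [map_add, LinearMap.add_apply, hs, ht]
  | tmul x y => simp

theorem contractLeft_biEval (t : H ⊗[k] H) (x y : H) (b : A) :
    contractLeft P t (biEval P (x ⊗ₜ y) b) =
      evalLast P (incr k H H x * swap t * incr k H H y) b := by
  rw [contractLeft_eq_evalLast, evalLast_incr_mul_mul]

/-- The values of the coproduct commute with `Q`. -/
theorem constFun_quantumKilling_mul (hR : IsQuasitriangular Coalgebra.comul R) :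
    constFun H (swap (quantumKilling R)) * (leg (incr k H H) * leg (incl k H H)) =
      leg (incr k H H) * leg (incl k H H) * constFun H (swap (quantumKilling R)) := by
  have hi : CommutingLegs (incl k H H) (incr k H H) := commutingLegs_incl_incr
  have e₁ := hR.constFun_mul hi
  have e₂ := hR.constFun_mul hi.symm
  rw [← legs_swap hi, legs_incl_incr] at e₂
  rw [legs_incl_incr] at e₁
  rw [quantumKilling, swap_mul, swap_swap, constFun_mul (k := k), mul_assoc, e₂, ← mul_assoc, e₁,
    mul_assoc]

/-- `Q` intertwines the coadjoint and the adjoint action. -/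
theorem killingMap_coadAct (hR : IsQuasitriangular Coalgebra.comul R) (h : H) (b : A) :
    killingMap P R (coadAct P h b) = adAct k H h (killingMap P R b) := by
  -- the previous lemma, multiplied by the convolution inverses of both legs
  have e : legInv (incr k H H) * (constFun H (swap (quantumKilling R)) * leg (incr k H H)) =
      leg (incl k H H) * (constFun H (swap (quantumKilling R)) * legInv (incl k H H)) := by
    have h1 := congrArg (fun F => legInv (incr k H H) * F * legInv (incl k H H))
      (constFun_quantumKilling_mul hR)
    simpa only [mul_assoc, leg_mul_legInv, legInv_mul_leg_mul, mul_one] using h1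
  have e' := congrArg (fun F => evalLast P (F.ofConv h) b) e
  simp only [LinearMap.convMul_apply] at e'
  rw [coadAct_eq, adAct_apply, killingMap]
  refine Eq.trans ?_ (e'.trans ?_)
  · generalize (Coalgebra.comul h : H ⊗[k] H) = t
    induction t with
    | zero => simp
    | add s t hs ht => simp only [map_add, LinearMap.add_apply, hs, ht]
    | tmul x y =>
      rw [TensorProduct.map_tmul, LinearMap.mul'_apply, constFun_mul_apply, ← mul_assoc,
        tensorOnDual_act_tmul, ← biEval_tmul, contractLeft_biEval]
      rfl
  · generalize (Coalgebra.comul h : H ⊗[k] H) = t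
    induction t with
    | zero => simp
    | add s t hs ht => simp only [map_add, LinearMap.add_apply, hs, ht]
    | tmul x y =>
      rw [TensorProduct.map_tmul, LinearMap.mul'_apply, constFun_mul_apply, leg_apply,
        legInv_apply, evalLast_incl_mul, evalLast_mul_incl, ← contractLeft_eq_evalLast]
      simp [mul_assoc]

theorem legs_quantumKilling {X : Type*} [Ring X] [Algebra k X] {f g : H →ₐ[k] X}
    (h : CommutingLegs f g) : legs f g (quantumKilling R) = legs g f R * legs f g R := by
  rw [quantumKilling, legs_mul h, legs_swap h]

/-- `Q(R(a₁ ⊗ b₁) b₂ R(b₃ ⊗ a₂)) = ⟨a, Q(b)₁⟩ Q(b)₂`, which is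
`(id ⊗ Δ) Q = R₂₁ Q₁₃ R₁₂`. -/
theorem killingMap_braidAct (hR : IsQuasitriangular Coalgebra.comul R) (a b : A) :
    killingMap P R (braidAct P R a b) = leftEval P.flip a (killingMap P R b) := by
  let E : H ⊗[k] (H ⊗[k] H) →ₗ[k] H := (TensorProduct.lid k H).toLinearMap ∘ₗ
    TensorProduct.map (P.form b) ((TensorProduct.lid k H).toLinearMap ∘ₗ (P.form a).rTensor H)
  have h1 : ∀ t : H ⊗[k] H, leftEval P.flip a (contractLeft P t b) =
      E (Coalgebra.comul.lTensor H t) := by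
    intro t
    rw [contractLeft_apply]
    induction t with
    | zero => simp
    | add s t hs ht => simp only [map_add, hs, ht]
    | tmul x y =>
      simp [E, leftEval_apply, HopfPairing.flip]
  have c₁₂ : CommutingLegs (fst₃ k H) (snd₃ k H) := comm₁₂
  have c₁₃ : CommutingLegs (fst₃ k H) (trd₃ k H) := comm₁₃
  have c₂₃ : CommutingLegs (snd₃ k H) (trd₃ k H) := comm₂₃
  have hp : ∀ x, (incr k H (H ⊗[k] H)).comp (Bialgebra.comulAlgHom k H) x =
    legs (snd₃ k H) (trd₃ k H) (Coalgebra.comul x) := incr_comp_apply (Bialgebra.comulAlgHom k H)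
  -- `(id ⊗ Δ) Q = R₂₁ Q₁₃ R₁₂`
  have h2 : Coalgebra.comul.lTensor H (quantumKilling R) = legs (snd₃ k H) (fst₃ k H) R *
      legs (fst₃ k H) (trd₃ k H) (quantumKilling R) * legs (fst₃ k H) (snd₃ k H) R := by
    have : Coalgebra.comul.lTensor H (quantumKilling R) =
      (Bialgebra.comulAlgHom k H).toLinearMap.lTensor H (quantumKilling R) := rfl
    rw [this, lTensor_eq_legs, legs_quantumKilling
      (commutingLegs_of_apply hp c₁₂.symm c₁₃.symm).symm, hR.legs_left hp c₂₃ c₁₂.symm c₁₃.symm,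
      hR.legs_right hp c₂₃ c₁₂ c₁₃, legs_quantumKilling c₁₃]
    simp only [mul_assoc]
  have h3 : ∀ r q s : H ⊗[k] H, E (legs (snd₃ k H) (fst₃ k H) r * legs (fst₃ k H) (trd₃ k H) q *
      legs (fst₃ k H) (snd₃ k H) s) = contractLeft P q (biEval P (TensorProduct.map
        (contractLeft P r) (contractRight P s) (Coalgebra.comul a)) b) := by
    intro r q s
    have hr : ∀ r r' c, contractLeft P (r + r') c = contractLeft P r c + contractLeft P r' c := by
      intros; simp [contractLeft_apply]
    have hr' : ∀ r r', contractLeft P (r + r') = contractLeft P r + contractLeft P r' :=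
      fun r r' => LinearMap.ext (hr r r')
    have hs' : ∀ s s', contractRight P (s + s') = contractRight P s + contractRight P s' :=
      fun r r' => LinearMap.ext fun c => by simp [contractRight_apply]
    have hr0 : contractLeft P (0 : H ⊗[k] H) = 0 := by ext; simp [contractLeft_apply]
    have hs0 : contractRight P (0 : H ⊗[k] H) = 0 := by ext; simp [contractRight_apply]
    induction r, s using quad_induction with
    | h0 t => simp [hr0]
    | h0' t => simp [hs0]
    | ha s s' t h h' => simp only [map_add, add_mul, hr', TensorProduct.map_add_left,
        LinearMap.add_apply, h, h']
    | ha' s t t' h h' => simp only [map_add, mul_add, hs', TensorProduct.map_add_right,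
        LinearMap.add_apply, h, h']
    | h r₁ r₂ s₁ s₂ =>
      induction q with
      | zero => simp [hr0]
      | add s t hs ht => simp only [map_add, mul_add, add_mul, hr, hs, ht]
      | tmul x y =>
        have h4 : E (legs (snd₃ k H) (fst₃ k H) (r₁ ⊗ₜ r₂) * legs (fst₃ k H) (trd₃ k H) (x ⊗ₜ y) *
          legs (fst₃ k H) (snd₃ k H) (s₁ ⊗ₜ s₂)) =
            P.form a (r₁ * s₂) • P.form b (r₂ * x * s₁) • y := by
          simp [E, smul_smul]
        rw [h4, P.mul_right a]
        generalize (Coalgebra.comul a : A ⊗[k] A) = t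
        induction t with
        | zero => simp
        | add s t hs ht => simp only [map_add, add_smul, LinearMap.add_apply, hs, ht]
        | tmul u v =>
          have h5 : contractLeft P (r₁ ⊗ₜ r₂) u = P.form u r₁ • r₂ := by simp [contractLeft_apply]
          have h6 : contractRight P (s₁ ⊗ₜ s₂) v = P.form v s₂ • s₁ := by
            simp [contractRight_apply]
          simp only [TensorProduct.map_tmul, h5, h6, ← TensorProduct.smul_tmul',
            TensorProduct.tmul_smul, map_smul, LinearMap.smul_apply, contractLeft_biEval]
          simp [smul_smul, mul_assoc]
          rw [mul_left_comm]
  have h4 : killingMap P R (braidAct P R a b) = contractLeft P (quantumKilling R) (biEval P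
    (TensorProduct.map (contractLeft P R) (contractRight P R) (Coalgebra.comul a)) b) := rfl
  rw [h4, ← h3, ← h2, ← h1]
  rfl

/-- `Q(ab) = ⟨b, ·⟩` of the second leg of `R (Q(a) ⊗ 1) R₂₁`. -/
theorem killingMap_mul (hR : IsQuasitriangular Coalgebra.comul R) (a b : A) :
    killingMap P R (a * b) =
      evalLast P (R * incl k H H (killingMap P R a) * swap R) b := by
  let E : H ⊗[k] (H ⊗[k] H) →ₗ[k] H := (TensorProduct.lid k H).toLinearMap ∘ₗ
    TensorProduct.map (P.form a) ((TensorProduct.lid k H).toLinearMap ∘ₗ (P.form b).rTensor H)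
  have h1 : ∀ t : H ⊗[k] H, contractLeft P t (a * b) =
      E (TensorProduct.assoc k H H H (Coalgebra.comul.rTensor H t)) := by
    intro t
    rw [contractLeft_apply]
    induction t with
    | zero => simp
    | add s t hs ht => simp only [map_add, hs, ht]
    | tmul x y =>
      rw [LinearMap.rTensor_tmul, LinearMap.rTensor_tmul, TensorProduct.lid_tmul, P.mul_left]
      generalize (Coalgebra.comul x : H ⊗[k] H) = t
      induction t with
      | zero => simp
      | add s t hs ht => simp only [map_add, add_smul, TensorProduct.add_tmul, hs, ht]
      | tmul u v => simp [E, smul_smul, mul_comm]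
  have c₁₂ : CommutingLegs (fst₃ k H) (snd₃ k H) := comm₁₂
  have c₁₃ : CommutingLegs (fst₃ k H) (trd₃ k H) := comm₁₃
  have c₂₃ : CommutingLegs (snd₃ k H) (trd₃ k H) := comm₂₃
  have hp : ∀ x, comulFirst (Bialgebra.comulAlgHom k H) x =
    legs (fst₃ k H) (snd₃ k H) (Coalgebra.comul x) := comulFirst_apply (Bialgebra.comulAlgHom k H)
  -- `(Δ ⊗ id) Q = R₃₂ Q₁₃ R₂₃`
  have h2 : TensorProduct.assoc k H H H (Coalgebra.comul.rTensor H (quantumKilling R)) =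
      legs (trd₃ k H) (snd₃ k H) R * legs (fst₃ k H) (trd₃ k H) (quantumKilling R) *
        legs (snd₃ k H) (trd₃ k H) R := by
    have : Coalgebra.comul.rTensor H (quantumKilling R) =
      (Bialgebra.comulAlgHom k H).toLinearMap.rTensor H (quantumKilling R) := rfl
    rw [this, assoc_rTensor_eq_legs, legs_quantumKilling (commutingLegs_of_apply hp c₁₃ c₂₃),
      hR.legs_left hp c₁₂ c₁₃ c₂₃, hR.legs_right hp c₁₂ c₁₃.symm c₂₃.symm,
      legs_quantumKilling c₁₃]
    simp only [mul_assoc]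
  have h3 : ∀ r q s : H ⊗[k] H, E (legs (trd₃ k H) (snd₃ k H) r * legs (fst₃ k H) (trd₃ k H) q *
      legs (snd₃ k H) (trd₃ k H) s) =
        evalLast P (r * incl k H H (contractLeft P q a) * swap s) b := by
    intro r q s
    simp only [swap, contractLeft_apply]
    induction r, s using quad_induction with
    | h0 t => simp
    | h0' t => simp
    | ha s s' t h h' => simp only [map_add, add_mul, LinearMap.add_apply, h, h']
    | ha' s t t' h h' => simp only [map_add, mul_add, LinearMap.add_apply, h, h']
    | h r₁ r₂ s₁ s₂ =>
      induction q with
      | zero => simp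
      | add s t hs ht => simp only [map_add, mul_add, add_mul, LinearMap.add_apply, hs, ht]
      | tmul x y => simp [E, smul_smul, mul_assoc, mul_comm]
  rw [killingMap, h1, h2, h3]

/-- `(h ↦ h ▷ φ) ⊗ S` maps `R⁻¹` to `R (φ ⊗ 1) R⁻¹`. -/
theorem map_adAct_inverse (hR : IsQuasitriangular Coalgebra.comul R) (φ : H) :
    TensorProduct.map ((adAct k H).flip φ) (S) (Ring.inverse R) =
      R * incl k H H φ * Ring.inverse R := by
  let E : H ⊗[k] (H ⊗[k] H) →ₗ[k] H ⊗[k] H :=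
    (LinearMap.mul' k H ∘ₗ TensorProduct.map (LinearMap.mulRight k φ) (S)).rTensor H ∘ₗ
      (TensorProduct.assoc k H H H).symm.toLinearMap ∘ₗ ((S).lTensor H).lTensor H
  have h1 : ∀ t : H ⊗[k] H, TensorProduct.map ((adAct k H).flip φ) (S) t =
      E (TensorProduct.assoc k H H H (Coalgebra.comul.rTensor H t)) := by
    intro t
    induction t with
    | zero => simp
    | add s t hs ht => simp only [map_add, hs, ht]
    | tmul x y =>
      rw [LinearMap.rTensor_tmul, TensorProduct.map_tmul, LinearMap.flip_apply, adAct_apply]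
      generalize (Coalgebra.comul x : H ⊗[k] H) = t
      induction t with
      | zero => simp
      | add s t hs ht => simp only [map_add, TensorProduct.add_tmul, hs, ht]
      | tmul u v => simp [E]
  have c₁₂ : CommutingLegs (fst₃ k H) (snd₃ k H) := comm₁₂
  have c₁₃ : CommutingLegs (fst₃ k H) (trd₃ k H) := comm₁₃
  have c₂₃ : CommutingLegs (snd₃ k H) (trd₃ k H) := comm₂₃
  have hp : ∀ x, comulFirst (Bialgebra.comulAlgHom k H) x =
    legs (fst₃ k H) (snd₃ k H) (Coalgebra.comul x) := comulFirst_apply (Bialgebra.comulAlgHom k H)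
  have h2 : TensorProduct.assoc k H H H (Coalgebra.comul.rTensor H (Ring.inverse R)) =
      legs (snd₃ k H) (trd₃ k H) (Ring.inverse R) *
        legs (fst₃ k H) (trd₃ k H) (Ring.inverse R) := by
    have : Coalgebra.comul.rTensor H (Ring.inverse R) =
      (Bialgebra.comulAlgHom k H).toLinearMap.rTensor H (Ring.inverse R) := rfl
    rw [this, assoc_rTensor_eq_legs, hR.legs_left_inverse hp c₁₂ c₁₃ c₂₃]
  have h3 : ∀ s t : H ⊗[k] H, E (legs (snd₃ k H) (trd₃ k H) s * legs (fst₃ k H) (trd₃ k H) t) =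
      (S).lTensor H t * incl k H H φ * TensorProduct.map (S) (S) s := by
    intro s t
    induction s, t using quad_induction with
    | h0 t => simp
    | h0' t => simp
    | ha s s' t h h' => simp only [map_add, add_mul, mul_add, h, h']
    | ha' s t t' h h' => simp only [map_add, mul_add, add_mul, h, h']
    | h s₁ s₂ t₁ t₂ => simp [E, HopfAlgebra.antipode_mul_antidistrib]
  have h4 : TensorProduct.map (S) (S) (Ring.inverse R) = Ring.inverse R := by
    have := congrArg swap hR.comul_swap_inverse.map_antipode
    rwa [map_swap, swap_swap, swap_swap] at this
  rw [h1, h2, h3, hR.antipode_right, h4]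

/-- `Q(a b) = · (Q ⊗ Q)(χ ▷ (a ⊗ b))`. The right-hand side is the evaluation at `b` of
`R (Q(a) ⊗ 1) R⁻¹ Q₂₁ = R (Q(a) ⊗ 1) R₂₁`, which gives `Q(a b)` by `killingMap_mul`. -/
theorem killingMap_mul_eq (hR : IsQuasitriangular Coalgebra.comul R) (t : A ⊗[k] A) :
    killingMap P R (LinearMap.mul' k A t) = LinearMap.mul' k H
      (TensorProduct.map (killingMap P R) (killingMap P R) ((tensorOnDual P).act₂ (chi R) t)) := by
  induction t with
  | zero => simp
  | add s t hs ht => simp only [map_add, hs, ht]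
  | tmul a b =>
    have h1 : ∀ t : H ⊗[k] H, LinearMap.mul' k H (TensorProduct.map (killingMap P R)
        (killingMap P R) ((tensorOnDual P).act₂ (legs ((incl k (H ⊗[k] H) (H ⊗[k] H)).comp
          (Bialgebra.comulAlgHom k H)) (quadTrd k H) t) (a ⊗ₜ b))) =
        evalLast P (TensorProduct.map ((adAct k H).flip (killingMap P R a)) (S) t *
          swap (quantumKilling R)) b := by
      intro t
      induction t with
      | zero => simp
      | add s t hs ht => simp only [map_add, add_mul, LinearMap.add_apply, hs, ht]
      | tmul x y =>
        have h2 : legs ((incl k (H ⊗[k] H) (H ⊗[k] H)).comp (Bialgebra.comulAlgHom k H))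
          (quadTrd k H) (x ⊗ₜ y) = Coalgebra.comul x ⊗ₜ (y ⊗ₜ 1) := by simp
        have h3 : killingMap P R (leftEval P (HopfAlgebra.antipode k y) b) =
            evalLast P (incr k H H (HopfAlgebra.antipode k y) * swap (quantumKilling R)) b := by
          have := contractLeft_biEval P (quantumKilling R) (HopfAlgebra.antipode k y) 1 b
          rwa [biEval_tmul, rightEval_one_left, map_one, mul_one] at this
        rw [h2, CovariantData.act₂_tmul_tmul, ← coadAct_eq, tensorOnDual_act_tmul,
          rightEval_one_left, TensorProduct.map_tmul, LinearMap.mul'_apply,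
          killingMap_coadAct P hR, h3, ← evalLast_incl_mul, ← mul_assoc]
        simp
    rw [chi_eq_legs hR, h1, map_adAct_inverse hR, LinearMap.mul'_apply, killingMap_mul P hR,
      quantumKilling, swap_mul, swap_swap, mul_assoc _ (Ring.inverse R),
      ← mul_assoc (Ring.inverse R),
      Ring.inverse_mul_cancel R hR.isUnit, one_mul]

variable {P} (hP : P.form.Nondegenerate) (hR : IsQuasitriangular Coalgebra.comul R)
  (hQ : Function.Bijective (killingMap P R))

theorem killingMap_one (hR : IsQuasitriangular Coalgebra.comul R) : killingMap P R 1 = 1 := by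
  have h1 : P.form 1 = Coalgebra.counit := LinearMap.ext P.one_left
  have hH := isHopfAlgebra_comul k H
  have h2 := hR.counit_left
  have h3 : TensorProduct.lid k H (Coalgebra.counit.rTensor H (swap R)) = 1 := by
    have h4 := hH.rid_inverse hR.isUnit.ringInverse hR.counit_right_inverse
    rw [inverse_inverse hR.isUnit] at h4
    rw [← h4, swap]
    generalize R = t
    induction t with
    | zero => simp
    | add s t hs ht => simp only [map_add, hs, ht]
    | tmul x y => simp
  rw [killingMap, contractLeft_apply, h1, quantumKilling, hH.lid_mul, h2, h3, one_mul]

/-- `(id, Q)` is an isomorphism from `(D(H), A)`, with the transmuted product, to `(D(H), H)`. -/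
theorem isIso_doubleOnDual_doubleOnH (hE : (tensorOnDual P).IsCovariantSystem)
    (hR : IsQuasitriangular Coalgebra.comul R) : (doubleOnDual P R).IsIso (doubleOnH P)
      AlgEquiv.refl (LinearEquiv.ofBijective (killingMap P R) hQ) where
  comul x := by
    have : (AlgEquiv.refl : Double P ≃ₐ[k] Double P).toLinearMap = LinearMap.id := rfl
    rw [this, TensorProduct.map_id]; rfl
  counit _ := rfl
  mul a b := by
    have h1 : (doubleOnDual P R).mul (a ⊗ₜ b) = _ := transmutedMul_eq P hR a b
    rw [h1, LinearEquiv.ofBijective_apply, killingMap_mul_eq P hR, ← hE.act₂_mul,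
      Ring.mul_inverse_cancel _ (isUnit_chi hR), hE.act₂_one]
    rfl
  one := killingMap_one hR
  act x b := by
    obtain ⟨x, rfl⟩ := (Double.of P).surjective x
    induction x with
    | zero => simp
    | add s t hs ht =>
      simp only [map_add, LinearMap.add_apply, AlgEquiv.coe_refl, id] at *
      rw [hs, ht]
    | tmul h a =>
      exact (killingMap_coadAct P hR h _).trans (congrArg _ (killingMap_braidAct P hR a b))

end KillingMap

/-! ### Semiduality -/

section Transport

variable {k K L : Type*} [Field k] [Ring K] [Algebra k K] [Ring L] [Algebra k L]
  {Δ : K →ₗ[k] K ⊗[k] K} {ε : K →ₗ[k] k} {Δ' : L →ₗ[k] L ⊗[k] L} {ε' : L →ₗ[k] k} {θ : K ≃ₐ[k] L}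

/-- `IsAntipode.transport` for a bijective antipode, keeping track of the inverse. -/
theorem IsAntipode.transport_equiv (hΔ : ∀ x, mapTwo θ (Δ x) = Δ' (θ x))
    (hε : ∀ x, ε' (θ x) = ε x) {S : K ≃ₗ[k] K} (hS : IsAntipode Δ ε S.toLinearMap) :
    IsAntipode Δ' ε'
      (θ.symm.toLinearEquiv.trans (S.trans θ.toLinearEquiv)).toLinearMap :=
  hS.transport hΔ hε

end Transport

section Semidual

variable {k H A : Type*} [Field k] [Ring H] [HopfAlgebra k H] [Ring A] [HopfAlgebra k A]
  (P : HopfPairing k H A)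

theorem matchedRight_apply (h : H) (a : A) : matchedRight P h a =
    biEval P ((HopfAlgebra.antipode k).lTensor H (Coalgebra.comul h)) a := rfl

/-- The coaction of `Hᶜᵒᵖ` is dual to the action of `Aᵒᵖ` on `H`. -/
theorem form_coadCoact (a : A) (h : H) :
    TensorProduct.rid k H ((P.form a).lTensor H (coadCoact k H h)) = matchedLeft P a h := by
  have h1 : matchedLeft P a h =
    biEval P.flip ((HopfAlgebra.antipode k).lTensor A (Coalgebra.comul a)) h := rfl
  let ℛ := Coalgebra.Repr.arbitrary k a
  rw [h1, ← ℛ.eq, map_sum, map_sum, LinearMap.sum_apply, coadCoact]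
  simp only [LinearMap.lTensor_tmul, biEval_tmul, biEval_apply, LinearMap.comp_apply]
  generalize comul₃ k H h = t
  induction t with
  | zero => simp
  | add s t hs ht => simp only [map_add, Finset.sum_add_distrib, hs, ht]
  | tmul u t =>
    induction t with
    | zero => simp
    | add s t hs ht =>
      simp only [map_add, TensorProduct.tmul_add, Finset.sum_add_distrib, hs, ht]
    | tmul v w =>
      simp only [LinearEquiv.coe_coe, TensorProduct.leftComm_tmul, LinearMap.lTensor_tmul,
        LinearMap.comp_apply, LinearMap.mul'_apply, TensorProduct.rid_tmul, P.mul_right]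
      rw [← ℛ.eq]
      simp [HopfPairing.flip, P.antipode_right, smul_smul, Finset.sum_smul, mul_comm]

/-- The adjoint action of `H` on itself is dual to its action on `Aᵒᵖ`. -/
theorem form_adAct (a : A) (h φ : H) :
    P.form a (adAct k H h φ) = P.form (matchedRight P h a) φ := by
  rw [matchedRight_apply, adAct_apply]
  generalize (Coalgebra.comul h : H ⊗[k] H) = t
  induction t with
  | zero => simp
  | add s t hs ht => simp only [map_add, LinearMap.add_apply, hs, ht]
  | tmul x y => simp [biEval_tmul, form_leftEval, form_rightEval, mul_assoc]

/-- `h₂ ⊗ ((h₁ S h₃) h₄ ⊗ S h₅) = h₂ ⊗ (h₁ ⊗ S h₃)`, in terms of the coaction. -/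
theorem coadCoact_word (h : H) :
    LinearMap.mul' k (H ⊗[k] (H ⊗[k] H)) (TensorProduct.map
      ((incl k H H).toLinearMap.lTensor H ∘ₗ coadCoact k H)
      ((incr k H (H ⊗[k] H)).toLinearMap ∘ₗ (HopfAlgebra.antipode k).lTensor H ∘ₗ Coalgebra.comul)
      (Coalgebra.comul h)) =
    ((HopfAlgebra.antipode k).lTensor H).lTensor H (TensorProduct.leftComm k H H H
      (comul₃ k H h)) := by
  -- `(S h₃) h₄` cancels in the second leg
  have e : (leg (snd₃ k H) * (leg (fst₃ k H) * legInv (snd₃ k H))) *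
      (leg (snd₃ k H) * legInv (trd₃ k H)) =
      leg (snd₃ k H) * (leg (fst₃ k H) * legInv (trd₃ k H)) := by
    simp only [mul_assoc, legInv_mul_leg_mul]
  have e' := congrArg (fun F : WithConv (H →ₗ[k] H ⊗[k] (H ⊗[k] H)) => F.ofConv h) e
  have e₁ := LinearMap.convMul_apply (leg (snd₃ k H) * (leg (fst₃ k H) * legInv (snd₃ k H)))
    (leg (snd₃ k H) * legInv (trd₃ k H)) h
  have h1 : (leg (snd₃ k H) * (leg (fst₃ k H) * legInv (snd₃ k H))).ofConv =
      (incl k H H).toLinearMap.lTensor H ∘ₗ coadCoact k H := by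
    refine LinearMap.ext fun x => ?_
    rw [conv_mul_mul_apply, coadCoact]
    simp only [LinearMap.comp_apply]
    generalize comul₃ k H x = t
    induction t with
    | zero => simp
    | add s t hs ht => simp only [map_add, hs, ht]
    | tmul u t =>
      induction t with
      | zero => simp
      | add s t hs ht => simp only [map_add, TensorProduct.tmul_add, hs, ht]
      | tmul v w => simp [leg_apply, legInv_apply]
  have h2 : (leg (snd₃ k H) * legInv (trd₃ k H)).ofConv =
      (incr k H (H ⊗[k] H)).toLinearMap ∘ₗ (HopfAlgebra.antipode k).lTensor H ∘ₗ
        Coalgebra.comul := by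
    refine LinearMap.ext fun x => ?_
    simp only [LinearMap.comp_apply]
    rw [LinearMap.convMul_apply]
    generalize (Coalgebra.comul x : H ⊗[k] H) = t
    induction t with
    | zero => simp
    | add s t hs ht => simp only [map_add, hs, ht]
    | tmul v w => simp [leg_apply, legInv_apply]
  rw [h1, h2] at e₁
  rw [← e₁]
  refine e'.trans ?_
  rw [conv_mul_mul_apply]
  generalize comul₃ k H h = t
  induction t with
  | zero => simp
  | add s t hs ht => simp only [map_add, hs, ht]
  | tmul u t =>
    induction t with
    | zero => simp
    | add s t hs ht => simp only [map_add, TensorProduct.tmul_add, hs, ht]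
    | tmul v w => simp [leg_apply, legInv_apply]

/-- The cross relations of `D(H)` are those of the matched pair. -/
theorem crossMap_eq_matched (a : A) (h : H) : crossMap P a h =
    TensorProduct.map (TensorProduct.lift (matchedLeft P))
      (TensorProduct.lift (matchedRight P).flip) (Coalgebra.comul (a ⊗ₜ[k] h)) := by
  have h1 : Coalgebra.comul (a ⊗ₜ[k] h) = TensorProduct.tensorTensorTensorComm k A A H H
    (Coalgebra.comul a ⊗ₜ Coalgebra.comul h) := rfl
  have h2 : crossMap P a h = ((biEval P).flip a).lTensor H
      (((HopfAlgebra.antipode k).lTensor H).lTensor H (TensorProduct.leftComm k H H H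
        (comul₃ k H h))) := by
    rw [crossMap_apply, LinearMap.lTensor_comp_apply]
  let ℛ := Coalgebra.Repr.arbitrary k a
  rw [h1, h2, ← coadCoact_word]
  generalize (Coalgebra.comul h : H ⊗[k] H) = t
  induction t with
  | zero => simp
  | add s t hs ht => simp only [map_add, TensorProduct.tmul_add, hs, ht]
  | tmul u v =>
    rw [← ℛ.eq]
    simp only [TensorProduct.sum_tmul, map_sum, TensorProduct.tensorTensorTensorComm_tmul,
      TensorProduct.map_tmul, TensorProduct.lift.tmul, LinearMap.flip_apply, ← form_coadCoact,
      LinearMap.comp_apply, LinearMap.mul'_apply]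
    generalize coadCoact k H u = c
    induction c with
    | zero => simp
    | add s t hs ht =>
      simp only [map_add, TensorProduct.add_tmul, add_mul, Finset.sum_add_distrib, hs, ht]
    | tmul x y =>
      have h3 : leftEval P y a = ∑ i ∈ ℛ.index, P.form (ℛ.left i) y • ℛ.right i := by
        rw [leftEval_apply, ← ℛ.eq]
        simp
      have h4 : ∑ i ∈ ℛ.index, TensorProduct.rid k H ((P.form (ℛ.left i)).lTensor H (x ⊗ₜ y)) ⊗ₜ[k]
          matchedRight P v (ℛ.right i) = x ⊗ₜ matchedRight P v (leftEval P y a) := by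
        simp [h3, TensorProduct.tmul_sum, TensorProduct.smul_tmul]
      rw [h4, matchedRight_apply]
      generalize (Coalgebra.comul v : H ⊗[k] H) = t
      induction t with
      | zero => simp
      | add s t hs ht =>
        simp only [map_add, mul_add, TensorProduct.tmul_add, LinearMap.add_apply, hs, ht]
      | tmul p q => simp [biEval_tmul, leftEval_mul, leftEval_rightEval]

/-- The canonical right action of `B` is the right action `⟨φ, a₁⟩ a₂ ⟨S h, a₃⟩` of `Hᶜᵒᵖ ⊗ H`,
through `θ₁⁻¹`. -/
theorem mirrorRightAct_apply (x : Bicross k H) (a : A) : mirrorRightAct P x a =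
    biEval P ((HopfAlgebra.antipode k).lTensor H (thetaOneInvEquiv k H x)) a := by
  obtain ⟨x, rfl⟩ := (Bicross.of k H).surjective x
  rw [thetaOneInvEquiv_of]
  induction x with
  | zero => simp
  | add s t hs ht => simp only [map_add, LinearMap.add_apply, hs, ht]
  | tmul φ h =>
    have h1 : mirrorRightAct P (Bicross.of k H (φ ⊗ₜ h)) a =
      matchedRight P h (leftEval P φ a) := rfl
    rw [theta₁Inv_tmul, h1, matchedRight_apply]
    generalize (Coalgebra.comul h : H ⊗[k] H) = t
    induction t with
    | zero => simp
    | add s t hs ht => simp only [map_add, mul_add, LinearMap.add_apply, hs, ht]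
    | tmul u v => simp [biEval_tmul, leftEval_mul, leftEval_rightEval]

theorem mirrorOnDual_act_eq (x : Bicross k H) (a : A) : (mirrorOnDual P).act x a =
    biEval P ((HopfAlgebra.antipode k).rTensor H (thetaOneInvEquiv k H x)) a := by
  rw [mirrorOnDual_act]
  generalize thetaOneInvEquiv k H x = t
  induction t with
  | zero => simp
  | add s t hs ht => simp only [map_add, LinearMap.add_apply, hs, ht]
  | tmul u v => rw [tensorOnDual_act_tmul]; rfl

variable (k H) in
/-- The antipode of the bicrossproduct: `S⁻¹ ⊗ S`, the antipode of `Hᶜᵒᵖ ⊗ H`, transported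
along `θ₁`. -/
def bicrossAntipode (hS : Function.Bijective (HopfAlgebra.antipode k (A := H))) :
    Bicross k H ≃ₗ[k] Bicross k H :=
  (thetaOneInvEquiv k H).symm.symm.toLinearEquiv.trans
    ((TensorProduct.congr (LinearEquiv.ofBijective _ hS).symm (LinearEquiv.ofBijective _ hS)).trans
      (thetaOneInvEquiv k H).symm.toLinearEquiv)

include P in
theorem isAntipode_bicrossAntipode (hS : Function.Bijective (HopfAlgebra.antipode k (A := H))) :
    IsAntipode (Bicross.comul k H) (Bicross.counit k H)
      (bicrossAntipode k H hS).toLinearMap := by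
  have h1 : IsAntipode (copComul (Bialgebra.comulAlgHom k H)).toLinearMap
      (Coalgebra.counit (R := k) (A := H)) (LinearEquiv.ofBijective _ hS).symm.toLinearMap :=
    isAntipode_antipode.cop HopfAlgebra.antipode_mul_antidistrib HopfAlgebra.antipode_one
      hS.injective (LinearEquiv.apply_symm_apply (LinearEquiv.ofBijective _ hS))
  have h2 : IsAntipode (tensorOnDual P).comul (tensorOnDual P).counit (TensorProduct.congr
      (LinearEquiv.ofBijective _ hS).symm (LinearEquiv.ofBijective _ hS)).toLinearMap :=
    h1.tensor isAntipode_antipode fun x y => by simp [tensorOnDual, mul_comm]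
  have h3 : ∀ x, mapTwo (thetaOneInvEquiv k H).symm ((tensorOnDual P).comul x) =
    Bicross.comul k H ((thetaOneInvEquiv k H).symm x) := (isIso_tensorOnDual_mirrorOnDual P).comul
  have h4 : ∀ x, Bicross.counit k H ((thetaOneInvEquiv k H).symm x) = (tensorOnDual P).counit x :=
    (isIso_tensorOnDual_mirrorOnDual P).counit
  exact h2.transport_equiv h3 h4

theorem thetaOneInvEquiv_bicrossAntipode_symm
    (hS : Function.Bijective (HopfAlgebra.antipode k (A := H))) (x : Bicross k H) :
    thetaOneInvEquiv k H ((bicrossAntipode k H hS).symm x) =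
      TensorProduct.congr (LinearEquiv.ofBijective _ hS) (LinearEquiv.ofBijective _ hS).symm
        (thetaOneInvEquiv k H x) :=
  (thetaOneInvEquiv k H).apply_symm_apply _

/-- The antipode `S⁻¹ ⊗ S` converts the right action `⟨φ, a₁⟩ a₂ ⟨S h, a₃⟩` of `Hᶜᵒᵖ ⊗ H` into
the left action `⟨S φ, a₁⟩ a₂ ⟨h, a₃⟩`. -/
theorem mirrorOnDual_act_eq_mirrorRightAct
    (hS : Function.Bijective (HopfAlgebra.antipode k (A := H))) (x : Bicross k H) (a : A) :
    (mirrorOnDual P).act x a = mirrorRightAct P ((bicrossAntipode k H hS).symm x) a := by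
  rw [mirrorOnDual_act_eq, mirrorRightAct_apply, thetaOneInvEquiv_bicrossAntipode_symm]
  congr 2
  generalize thetaOneInvEquiv k H x = t
  induction t with
  | zero => simp
  | add s t hs ht => simp only [map_add, hs, ht]
  | tmul u v =>
    have h1 : HopfAlgebra.antipode k ((LinearEquiv.ofBijective _ hS).symm v) = v :=
      LinearEquiv.apply_symm_apply (LinearEquiv.ofBijective _ hS) v
    simp [h1]

/-- `(B, A)` is the semidual of `(D(H), H)`, as soon as the antipode of `H` is bijective. -/
theorem isSemidual (hS : Function.Bijective (HopfAlgebra.antipode k (A := H))) :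
    IsSemidual P where
  double a h := by
    rw [← crossMap_eq_matched]
    have h1 : Double.of P (1 ⊗ₜ a) * Double.of P (h ⊗ₜ 1) =
      Double.of P (doubleMul P (1 ⊗ₜ a) (h ⊗ₜ 1)) := rfl
    rw [h1, doubleMul_tmul, ← Algebra.TensorProduct.one_def, one_mul]
  act := form_adAct P
  coact := form_coadCoact P
  flip := ⟨bicrossAntipode k H hS, isAntipode_bicrossAntipode P hS,
    mirrorOnDual_act_eq_mirrorRightAct P hS⟩

end Semidual

/-! ### The isomorphism `θ` -/

section Theta

variable {k H A : Type*} [Field k] [Ring H] [HopfAlgebra k H] [Ring A] [HopfAlgebra k A]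
  (P : HopfPairing k H A) {R : H ⊗[k] H}

/-- `θ₁⁻¹`, which multiplies by the coproduct of the second factor, replaces `R₂₃` by `(Δ ⊗ id) R`.
-/
theorem theta₁Inv_evalLast (s t : H ⊗[k] H) (a : A) :
    theta₁Inv k H (evalLast P (legs (tripFst k H) (tripTrd k H) s *
      legs (tripSnd k H) (tripTrd k H) t) a) =
    evalLast P (legs (tripFst k H) (tripTrd k H) s * legs (tripComul k H) (tripTrd k H) t) a := by
  induction s, t using quad_induction with
  | h0 t => simp
  | h0' t => simp
  | ha s s' t hs hs' => simp only [map_add, add_mul, LinearMap.add_apply, hs, hs']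
  | ha' s t t' hs hs' => simp only [map_add, mul_add, LinearMap.add_apply, hs, hs']
  | h x x' y y' => simp [theta₁Inv_tmul]

theorem inverse_quantumKilling_mul_swap (hR : IsUnit R) :
    Ring.inverse (quantumKilling R) * swap R = Ring.inverse R := by
  have h1 : Ring.inverse (quantumKilling R) = Ring.inverse R * Ring.inverse (swap R) :=
    ring_inverse_eq_of_mul_eq_one (by
      rw [quantumKilling, mul_assoc, ← mul_assoc (Ring.inverse (swap R)),
        Ring.inverse_mul_cancel _ (isUnit_swap hR), one_mul, Ring.inverse_mul_cancel _ hR])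
      ((isUnit_swap hR).mul hR)
  rw [h1, mul_assoc, Ring.inverse_mul_cancel _ (isUnit_swap hR), mul_one]

/-- `θ₁⁻¹` takes `Q₃₁⁻¹ R₂₃` to `Q₃₁⁻¹ R₁₃ R₂₃ = R₃₁⁻¹ R₂₃`. -/
theorem theta₁Inv_contractThird (hR : IsQuasitriangular Coalgebra.comul R) (a : A) :
    theta₁Inv k H (contractThird P
      (leg₁₃ (swap (Ring.inverse (quantumKilling R))) * leg₂₃ R) a) = thetaTwoDual P R a := by
  have c₁₃ : CommutingLegs (tripFst k H) (tripTrd k H) := commTrip₁₃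
  rw [contractThird_leg_mul_leg, theta₁Inv_evalLast,
    hR.legs_left tripComul_apply commTrip₁₂ commTrip₁₃ commTrip₂₃, ← mul_assoc, ← legs_mul c₁₃,
    thetaTwoDual, doubleLeg, ← legs_swap c₁₃ (Ring.inverse R),
    ← inverse_quantumKilling_mul_swap hR.isUnit, swap_mul, swap_swap]

/-- The explicit formula for `θ₁ ∘ θ₂`, checked after applying `θ₁⁻¹`. -/
theorem thetaOne_thetaTwo_of (hR : IsQuasitriangular Coalgebra.comul R) (h : H) (a : A) :
    thetaOne k H (thetaTwo P R (Double.of P (h ⊗ₜ a))) = thetaFormula P R h a := by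
  rw [← thetaOneInvEquiv_symm_apply, AlgEquiv.symm_apply_eq, thetaFormula, thetaOneInvEquiv_of,
    theta₁Inv_smashAct, theta₁Inv_contractThird P hR, thetaTwo_of]

variable {P} (hP : P.form.Nondegenerate) (hR : IsQuasitriangular Coalgebra.comul R)
  (hQ : Function.Bijective (killingMap P R))

include hP hR hQ in
/-- `(θ₁ θ₂, id)` is an isomorphism from `(D(H), A)` to the twist of `(B, A)` by `R₂₃⁻¹`: `θ₂`
leads to the twist of `Hᶜᵒᵖ ⊗ H` by `χ`, and `θ₁` from there to the twist of `B`. -/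
theorem exists_isIso_doubleOnDual_twist_chiMirror : ∃ θ : Double P ≃ₐ[k] Bicross k H,
    (∀ x : Double P, θ x = thetaOne k H (thetaTwo P R x)) ∧
    (∀ (h : H) (a : A), θ (Double.of P (h ⊗ₜ a)) = thetaFormula P R h a) ∧
    (doubleOnDual P R).IsIso ((mirrorOnDual P).twist (chiMirror R)) θ (LinearEquiv.refl k A) :=
  ⟨(thetaTwoEquiv hP hR hQ).trans (thetaOneInvEquiv k H).symm, fun _ => rfl,
    fun h a => thetaOne_thetaTwo_of P hR h a,
    (isIso_doubleOnDual_twist hP hR hQ).trans (isIso_twist_chi_twist_chiMirror P hR)⟩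

theorem thetaOneTwice_eq_mapTwo (t : (H ⊗[k] H) ⊗[k] (H ⊗[k] H)) :
    thetaOneTwice k H t = mapTwo (thetaOneInvEquiv k H).symm t := rfl

variable (P)

include P in
/-- A quasitriangular structure `u` of `Hᶜᵒᵖ` and `R` give the structure `u₁₃ R₂₄` of `Hᶜᵒᵖ ⊗ H`,
which `θ₁` carries to `B`. -/
theorem isQuasitriangular_thetaOneTwice {u : H ⊗[k] H}
    (hu : IsQuasitriangular (copComul (Bialgebra.comulAlgHom k H)).toLinearMap u)
    (hR : IsQuasitriangular Coalgebra.comul R) :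
    IsQuasitriangular (Bicross.comul k H) (thetaOneTwice k H (quad₁₃ u * quad₂₄ R)) := by
  have h1 : IsQuasitriangular (tensorOnDual P).comul (quad₁₃ u * quad₂₄ R) :=
    hu.tensor hR.comulAlgHom
  have h2 : ∀ x, mapTwo (thetaOneInvEquiv k H).symm ((tensorOnDual P).comul x) =
    Bicross.comul k H ((thetaOneInvEquiv k H).symm x) := (isIso_tensorOnDual_mirrorOnDual P).comul
  rw [thetaOneTwice_eq_mapTwo]
  exact h1.transport h2

variable {P}

include hP hQ in
theorem isTwistingCocycle_chiMirror (hR : IsQuasitriangular Coalgebra.comul R) :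
    IsTwistingCocycle (Bicross.comul k H) (Bicross.counit k H) (chiMirror R) := by
  have hE := isCovariantSystem_tensorOnDual P (bijective_antipode hP hR hQ)
  have h2 : ∀ x, mapTwo (thetaOneInvEquiv k H).symm ((tensorOnDual P).comul x) =
    Bicross.comul k H ((thetaOneInvEquiv k H).symm x) := (isIso_tensorOnDual_mirrorOnDual P).comul
  have h3 : ∀ x, Bicross.counit k H ((thetaOneInvEquiv k H).symm x) = (tensorOnDual P).counit x :=
    (isIso_tensorOnDual_mirrorOnDual P).counit
  have h4 : IsTwistingCocycle (tensorOnDual P).comul (tensorOnDual P).counit (chi R) :=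
    isTwistingCocycle_chi hR hE.hopf
  rw [← mapTwo_thetaOne_chi hR]
  exact h4.transport h2 h3

end Theta

end QuantumDouble

end

theorem mainTheorem1 {k H A : Type*} [Field k] [Ring H] [HopfAlgebra k H] [Ring A]
    [HopfAlgebra k A] (P : HopfPairing k H A) (hP : P.form.Nondegenerate)
    (R : H ⊗[k] H) (hR : IsQuasitriangular Coalgebra.comul R)
    (hQ : Function.Bijective (killingMap P R)) :
    (doubleOnH P).IsCovariantSystem ∧
    (mirrorOnDual P).IsCovariantSystem ∧
    IsSemidual P ∧
    (doubleOnDual P R).IsCovariantSystem ∧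
    (doubleOnDual P R).IsIso (doubleOnH P) AlgEquiv.refl
      (LinearEquiv.ofBijective (killingMap P R) hQ) ∧
    thetaOneTwice k H (chi R) = chiMirror R ∧
    IsTwistingCocycle (Bicross.comul k H) (Bicross.counit k H) (chiMirror R) ∧
    ((mirrorOnDual P).twist (chiMirror R)).IsCovariantSystem ∧
    (∃ θ : Double P ≃ₐ[k] Bicross k H,
      (∀ x : Double P, θ x = thetaOne k H (thetaTwo P R x)) ∧
      (∀ (h : H) (a : A), θ (Double.of P (h ⊗ₜ a)) = thetaFormula P R h a) ∧
      (doubleOnDual P R).IsIso ((mirrorOnDual P).twist (chiMirror R)) θ (LinearEquiv.refl k A)) ∧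
    IsQuasitriangular (Bicross.comul k H)
      (thetaOneTwice k H (quad₁₃ (Ring.inverse R) * quad₂₄ R)) ∧
    IsQuasitriangular (Bicross.comul k H)
      (thetaOneTwice k H (quad₁₃ (swap R) * quad₂₄ R)) := by
  have hS := bijective_antipode hP hR hQ
  have hE := isCovariantSystem_tensorOnDual P hS
  have hD := isCovariantSystem_doubleOnDual hP hR hQ
  have hI := isIso_doubleOnDual_doubleOnH hQ hE hR
  exact ⟨hD.transport hI, isCovariantSystem_mirrorOnDual hP hR hQ, isSemidual P hS, hD, hI,
    (thetaOneTwice_eq_mapTwo _).trans (mapTwo_thetaOne_chi hR),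
    isTwistingCocycle_chiMirror hP hQ hR, isCovariantSystem_twist_chiMirror hP hR hQ,
    exists_isIso_doubleOnDual_twist_chiMirror hP hR hQ,
    isQuasitriangular_thetaOneTwice P hR.comulAlgHom.cop_inverse hR,
    isQuasitriangular_thetaOneTwice P hR.comulAlgHom.cop_swap hR⟩
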